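/- **Proposition 3.2 (generalized Kakeya estimate).** *Curve and cone.* Let $k\ge 2$ be an integer and let $C_1,C_2,\dots\ge 1$. Let $\mathfrak f\in C([0,1])\cap C^k(0,1)$ be real-valued with $\mathfrak f(0)=0$ and $$C_m^{-1}\le \mathfrak f^{(m)}(\omega)/\omega^{k-m}\le C_m\qquad(0<\omega<1,\ 1\le m\le k),$$ and let $\mathcal C\gamma_k=\{h\,(\xi,\mathfrak f(\xi),1): 0\le\xi\le1,\ \tfrac12\le h\le 1\}\subset\mathbb R^3$ be the truncated cone over its graph. Put $\mathbf c(\xi)=(\xi,\mathfrak f(\xi),1)$, $\mathbf t(\xi)=(1,\mathfrak f'(\xi),0)$, $\mathbf n(\xi)=(-\mathfrak f'(\xi),1,0)$, $\mathbf n_3=(0,0,1)$, with one-sided derivatives at the end points. *Planks.* For $0<\delta\le 1$ let $\ell_\delta(\xi)=\delta^{1/k}$ if $|\xi|\le\delta^{1/k}$ and $\ell_\delta(\xi)=\delta^{1/2}/|\xi|^{(k-2)/2}$ otherwise. For $c_0>1$ let $$\theta(\delta,\xi)=\{a\,\mathbf c(\xi)+b\,\mathbf t(\xi)+c_1\mathbf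 n(\xi)+c_2\mathbf n_3:\ \tfrac12\le a\le 1,\ |b|\le c_0\ell_\delta(\xi),\ |c_1|,|c_2|\le c_0\delta\}.$$ For every $\delta\in(0,1]$ let $\mathcal R(\delta)\subset[0,1]$ be a finite set of centres such that: some $\xi\in\mathcal R(\delta)$ satisfies $\xi\le\delta^{1/k}$; at most $N$ elements of $\mathcal R(\delta)$ satisfy $\xi\le 2\delta^{1/k}$; and for each $K=2^{-m}\ge\delta^{1/k}$, $m\ge1$, any two distinct points of $\mathcal R(\delta)\cap(K,2K]$ have distance at least $\delta^{1/2}/K^{(k-2)/2}$, while every point of $(K,2K]$ has distance at most $\delta^{1/2}/K^{(k-2)/2}$ from some point of $\mathcal R(\delta)\cap(K,2K]$. Let $\Theta_\delta=\{\theta(\delta,\xi):\xi\in\mathcal R(\delta)\}$, indexed by $\mathcal R(\delta)$. *Square functions and wave envelopes.* Let $r\ge2$ and $\delta=r^{-2}$. Let $f$ be a Schwartz function on $\mathbb R^3$ with $\operatorname{supp}\hat f$ contained in the closed $\delta$-neighbourhood $\mathcal N_\delta(\mathcal C\gamma_k)$. Let $(\chi_\theta)_{\theta\in\Theta_\delta}$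 be nonnegative smooth functions with $\operatorname{supp}\chi_\theta\subset\theta$ and $\sum_\theta\chi_\theta=1$ on $\mathcal N_\delta(\mathcal C\gamma_k)$, and let $\hat f_\theta=\chi_\theta\hat f$. For $s\in\{2^j/r: j=0,1,2,\dots\}$ with $s\le1$ and $\tau\in\Theta_{s^2}$ let $$U_{\tau,r^2}=\operatorname{conv}\Big(\bigcup_{\theta\in\Theta_\delta,\,\theta\subseteq\tau}\theta^*\Big),\quad \theta^*=\{x:|\langle x,\omega\rangle|\le1\ \ \forall\omega\in\theta\},\qquad S_Uf=\Big(\sum_{\theta\in\Theta_\delta,\,\theta\subseteq\tau}|f_\theta|^2\Big)^{1/2}\Big|_U .$$ Whenever some $\theta\in\Theta_\delta$ is contained in $\tau$, fix a family of translates of $U_{\tau,r^2}$ that covers $\mathbb R^3$ and in which every point of $\mathbb R^3$ lies in at most $N$ members; $U\parallel U_{\tau,r^2}$ means that $U$ belongs to this family. (If no $\theta$ is contained in $\tau$, the contribution of $\tau$ is $0$.) *Claim.* There is $c_*>1$, depending only on $k$ and $(C_m)$, such that for every $c_0\ge c_*$ and every $N\in\mathbb N$ there is $C>0$, depending only on $k,(C_m),c_0,N$,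 such that for all $\mathfrak f$, $r$, $\mathcal R$, $(\chi_\theta)$, $f$ and all families of translates as above $$\int_{\mathbb R^3}\Big(\sum_{\theta\in\Theta_\delta}|f_\theta|^2\Big)^2\le C\,\log(r)\sum_{\substack{r^{-1}\le s\le1\\ s\in r^{-1}2^{\mathbb Z}}}\ \sum_{\tau\in\Theta_{s^2}}\ \sum_{U\parallel U_{\tau,r^2}}|U|^{-1}\,\|S_Uf\|_{L^2(U)}^4 .$$ If $k=2$, the same estimate holds without the factor $\log(r)$. -/

import Mathlib

open scoped FourierTransform SchwartzMap ENNReal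

namespace ConeKakeya

/-- Euclidean three-space; it is used both as physical space and as frequency space. -/
abbrev E3 : Type := EuclideanSpace ℝ (Fin 3)

/-- Finite-type base function of order `k` on `[0,1]`, with derivative constants `Cm 1, …, Cm k`:
`f 0 = 0`, `f` is continuous on `[0,1]` and `C^k` on `(0,1)`, and
`(Cm m)⁻¹ ≤ f^{(m)}(ω) / ω^{k-m} ≤ Cm m` on `(0,1)` for `1 ≤ m ≤ k`. -/
structure IsFiniteType (k : ℕ) (Cm : ℕ → ℝ) (f : ℝ → ℝ) : Prop where
  contDiffOn : ContDiffOn ℝ k f (Set.Ioo 0 1)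
  continuousOn : ContinuousOn f (Set.Icc 0 1)
  map_zero : f 0 = 0
  deriv_bounds : ∀ m : ℕ, 1 ≤ m → m ≤ k → ∀ ω ∈ Set.Ioo (0 : ℝ) 1,
    (Cm m)⁻¹ ≤ iteratedDeriv m f ω / ω ^ (k - m) ∧ iteratedDeriv m f ω / ω ^ (k - m) ≤ Cm m

/-- The slope of the base curve on `[0,1]` (one-sided at the end points). -/
noncomputable def slope (f : ℝ → ℝ) (ξ : ℝ) : ℝ := derivWithin f (Set.Icc 0 1) ξ

/-- The central line `c(ξ) = (ξ, f ξ, 1)`. -/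
noncomputable def centralVec (f : ℝ → ℝ) (ξ : ℝ) : E3 := !₂[ξ, f ξ, 1]

/-- The (unnormalized) tangent vector `t(ξ) = (1, f' ξ, 0)`. -/
noncomputable def tangentVec (f : ℝ → ℝ) (ξ : ℝ) : E3 := !₂[1, slope f ξ, 0]

/-- The (unnormalized) normal vector `n(ξ) = (-f' ξ, 1, 0)`. -/
noncomputable def normalVec (f : ℝ → ℝ) (ξ : ℝ) : E3 := !₂[-slope f ξ, 1, 0]

/-- The vertical vector `n₃ = (0, 0, 1)`. -/
noncomputable def verticalVec : E3 := !₂[0, 0, 1]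

/-- The truncated cone over the curve `{(ξ, f ξ) : 0 ≤ ξ ≤ 1}`, at heights in `[1/2, 1]`. -/
def cone (f : ℝ → ℝ) : Set E3 :=
  {p | ∃ ξ ∈ Set.Icc (0 : ℝ) 1, ∃ h ∈ Set.Icc (1 / 2 : ℝ) 1, p = h • centralVec f ξ}

/-- The canonical tangential length at base point `ξ`: `δ^{1/k}` for `|ξ| ≤ δ^{1/k}` and
`δ^{1/2} / |ξ|^{(k-2)/2}` otherwise. -/
noncomputable def tangentialLength (k : ℕ) (δ ξ : ℝ) : ℝ :=
  if |ξ| ≤ δ ^ (1 / (k : ℝ)) then δ ^ (1 / (k : ℝ))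
  else δ ^ (1 / 2 : ℝ) / |ξ| ^ (((k : ℝ) - 2) / 2)

/-- The canonical plank `θ(δ, ξ)`, with implicit constant `c₀`. -/
def plank (k : ℕ) (f : ℝ → ℝ) (c₀ δ ξ : ℝ) : Set E3 :=
  {p | ∃ a b c₁ c₂ : ℝ, 1 / 2 ≤ a ∧ a ≤ 1 ∧ |b| ≤ c₀ * tangentialLength k δ ξ ∧
    |c₁| ≤ c₀ * δ ∧ |c₂| ≤ c₀ * δ ∧
    p = a • centralVec f ξ + b • tangentVec f ξ + c₁ • normalVec f ξ + c₂ • verticalVec}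

/-- Admissible collections of (first coordinates of) centres of the canonical covering at scale
`δ`. Near the origin there is at least one and there are at most `N` centres. In each dyadic block
`(K, 2K]`, `K = 2^{-m}` with `m ≥ 1` and `K ≥ δ^{1/k}`, the centres form a maximal set of points
separated by `δ^{1/2} / K^{(k-2)/2}`. -/
structure IsCenters (k N : ℕ) (δ : ℝ) (R : Finset ℝ) : Prop where
  subset : ∀ ξ ∈ R, ξ ∈ Set.Icc (0 : ℝ) 1
  exists_near_zero : ∃ ξ ∈ R, ξ ≤ δ ^ (1 / (k : ℝ))
  card_near_zero : (R.filter (fun ξ => ξ ≤ 2 * δ ^ (1 / (k : ℝ)))).card ≤ N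
  separated : ∀ (m : ℕ) (K : ℝ), 1 ≤ m → K = (2 : ℝ)⁻¹ ^ m → δ ^ (1 / (k : ℝ)) ≤ K →
    ∀ ξ ∈ R, ∀ ξ' ∈ R, ξ ∈ Set.Ioc K (2 * K) → ξ' ∈ Set.Ioc K (2 * K) → ξ ≠ ξ' →
      δ ^ (1 / 2 : ℝ) / K ^ (((k : ℝ) - 2) / 2) ≤ |ξ - ξ'|
  maximal : ∀ (m : ℕ) (K : ℝ), 1 ≤ m → K = (2 : ℝ)⁻¹ ^ m → δ ^ (1 / (k : ℝ)) ≤ K →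
    ∀ ω ∈ Set.Ioc K (2 * K), ∃ ξ ∈ R, ξ ∈ Set.Ioc K (2 * K) ∧
      |ω - ξ| ≤ δ ^ (1 / 2 : ℝ) / K ^ (((k : ℝ) - 2) / 2)

/-- A smooth partition of unity on the closed `δ`-neighbourhood of the cone, subordinate to the
planks `θ(δ, ξ)`, `ξ ∈ R`. -/
structure IsPartition (k : ℕ) (f : ℝ → ℝ) (c₀ δ : ℝ) (R : Finset ℝ) (χ : ℝ → E3 → ℝ) : Prop where
  contDiff : ∀ ξ ∈ R, ContDiff ℝ ((⊤ : ℕ∞) : WithTop ℕ∞) (χ ξ)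
  nonneg : ∀ ξ ∈ R, ∀ ω, 0 ≤ χ ξ ω
  support : ∀ ξ ∈ R, tsupport (χ ξ) ⊆ plank k f c₀ δ ξ
  sum_eq_one : ∀ ω ∈ Metric.cthickening δ (cone f), ∑ ξ ∈ R, χ ξ ω = 1

/-- The mollified Fourier projection `F_θ` of `F`, with Fourier transform `χ · F̂`. -/
noncomputable def proj (χ : E3 → ℝ) (F : 𝓢(E3, ℂ)) : E3 → ℂ :=
  𝓕⁻ (fun ω : E3 => (χ ω : ℂ) * 𝓕 (F : E3 → ℂ) ω)

open Classical in
/-- The base points of those planks `θ` at scale `δ` with `θ ⊆ τ`. -/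
noncomputable def planksIn (k : ℕ) (f : ℝ → ℝ) (c₀ δ : ℝ) (R : Finset ℝ) (τ : Set E3) : Finset ℝ :=
  R.filter (fun ξ => plank k f c₀ δ ξ ⊆ τ)

/-- The wave envelope `U_τ`: the convex hull of the union of the polar sets
`θ* = {x : |⟨x, ω⟩| ≤ 1 for all ω ∈ θ}` of the planks `θ ⊆ τ` at scale `δ`. -/
noncomputable def envelope (k : ℕ) (f : ℝ → ℝ) (c₀ δ : ℝ) (R : Finset ℝ) (τ : Set E3) : Set E3 :=
  convexHull ℝ (⋃ ξ ∈ planksIn k f c₀ δ R τ, (innerₗ E3).polar (plank k f c₀ δ ξ))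

/-- The translate of `U` by `v`. -/
def translate (U : Set E3) (v : E3) : Set E3 := (fun y => v + y) '' U

/-- The translates of `U` by the vectors in `T` cover space, with overlap at most `N`. -/
def IsTranslateCover (N : ℕ) (U T : Set E3) : Prop :=
  (∀ x, ∃ v ∈ T, x ∈ translate U v) ∧ ∀ x, {v ∈ T | x ∈ translate U v}.encard ≤ N

/-- The square function `(∑_{θ ⊆ τ} |F_θ|²)^{1/2}` over the planks `θ ⊆ τ` at scale `δ`; its
restriction to a set `U` is `S_U F`. -/
noncomputable def squareFn (k : ℕ) (f : ℝ → ℝ) (c₀ δ : ℝ) (R : Finset ℝ) (χ : ℝ → E3 → ℝ)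
    (F : 𝓢(E3, ℂ)) (τ : Set E3) (x : E3) : ℝ :=
  Real.sqrt (∑ ξ ∈ planksIn k f c₀ δ R τ, ‖proj (χ ξ) F x‖ ^ 2)

/-- The dyadic scales `s = 2^j / r`, `j = 0, 1, 2, …`, with `r⁻¹ ≤ s ≤ 1`. -/
def scales (r : ℝ) : Set ℝ := {s | s ≤ 1 ∧ ∃ j : ℕ, s = 2 ^ j / r}

/-- The left-hand side `∫ (∑_θ |F_θ|²)²`, the sum being over all planks at scale `δ`. -/
noncomputable def kakeyaLHS (R : Finset ℝ) (χ : ℝ → E3 → ℝ) (F : 𝓢(E3, ℂ)) : ℝ≥0∞ :=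
  ∫⁻ x : E3, ENNReal.ofReal ((∑ ξ ∈ R, ‖proj (χ ξ) F x‖ ^ 2) ^ 2)

/-- The right-hand side `∑_s ∑_{τ ∈ Θ_{s²}} ∑_{U ∥ U_τ} |U|⁻¹ ‖S_U F‖_{L²(U)}⁴`. Here `R δ` is the
set of centres at scale `δ`, and, for `τ` the plank at scale `s²` with base point `ξ`, the sets
`U ∥ U_τ` are the translates of `U_τ` by the vectors in `T s ξ`. -/
noncomputable def kakeyaRHS (k : ℕ) (f : ℝ → ℝ) (c₀ r : ℝ) (R : ℝ → Finset ℝ)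
    (T : ℝ → ℝ → Set E3) (χ : ℝ → E3 → ℝ) (F : 𝓢(E3, ℂ)) : ℝ≥0∞ :=
  ∑' s : scales r, ∑ ξ ∈ R ((s : ℝ) ^ 2), ∑' v : T s ξ,
    (MeasureTheory.volume (translate (envelope k f c₀ (r⁻¹ ^ 2) (R (r⁻¹ ^ 2))
      (plank k f c₀ ((s : ℝ) ^ 2) ξ)) v))⁻¹ *
    MeasureTheory.eLpNorm
      (squareFn k f c₀ (r⁻¹ ^ 2) (R (r⁻¹ ^ 2)) χ F (plank k f c₀ ((s : ℝ) ^ 2) ξ)) 2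
      (MeasureTheory.volume.restrict (translate (envelope k f c₀ (r⁻¹ ^ 2) (R (r⁻¹ ^ 2))
        (plank k f c₀ ((s : ℝ) ^ 2) ξ)) v)) ^ 4

end ConeKakeya

/-! By Plancherel the left side equals $\int|\sum_\theta\hat g_\theta|^2$ with
$g_\theta=|f_\theta|^2\ge0$, and $\hat g_\theta$ vanishes off $\theta-\theta$. The planks are split
into blocks. For a fixed block and a fixed frequency $\omega$, the planks with
$\omega\in\theta-\theta$ lie in boundedly many $\tau\in\Theta_{s^2}$ at one common scale
$s=s(\omega)$, and $\omega$ is dual to each of their envelopes: $|\langle x,\omega\rangle|\le C$ on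
$U_\tau$. This is `IsOrganized`. It allows Cauchy–Schwarz over the few $\tau$, after which each
$\tau$ is treated only on the set $D$ of frequencies dual to $U_\tau$. There the transform of the
indicator of a small multiple $V$ of $U_\tau$ has modulus at least $|V|/2$, so Plancherel bounds
$\int_D|\hat G|^2$ by averages of $g\ge0$ over translates of $V$, hence by those over the covering
translates of $U_\tau$ (`lintegral_dual_envelope_le`). `kakeyaLHS_le` adds everything up.

The geometric input is the normal defect $g(x)=w_2-h\mathfrak f(x)-\mathfrak f'(x)(w_1-hx)$ of
$\omega=(w_1,w_2,h)$. If $\omega\in\theta-\theta$ and $\theta$ has base point $x$, then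
$|g(x)|\lesssim\delta$; moreover $g'(x)=-\mathfrak f''(x)(w_1-hx)$. Suppose $\mathfrak
f''\sim\kappa$ on the block, and let $d$ be the largest distance of two admissible base points on
the same side of the zero of $w_1-hx$. Integrating $g'$ gives $\kappa d\,|w_1-hx|\lesssim\delta$ and
$\kappa d^2|h|\lesssim\delta$ (`IsRegular.exists_cluster`). With $s\sim d\sqrt\kappa$, planks at
scale $s^2$ have length $\sim d$: boundedly many of them contain all the planks in question
(`IsRegular.plank_subset_plank`), and the two inequalities say that $\omega$ is dual to their
envelopes (`IsRegular.abs_inner_envelope_le`). If $d$ is comparable to the finest length, only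
boundedly many planks occur and the finest scale is used.

Since $\mathfrak f''\sim x^{k-2}$, the blocks are the dyadic intervals $(K,2K]$, with
$\kappa=K^{k-2}$, and a neighbourhood of $0$ containing at most $N$ centres; there are $O(\log r)$
of them. Cauchy–Schwarz over the blocks costs one factor $\log r$ and no more, because different
blocks use disjoint sets of planks and recombine into $S_Uf$. For $k=2$, $\mathfrak f''\sim1$
throughout, two blocks suffice and the logarithm disappears. -/

namespace ConeKakeya

/-! ### Fourier analysis: Plancherel and localization to dual frequencies. -/

open MeasureTheory Convolution ComplexConjugate Pointwise

/-- `|𝓕⁻ g|²` is a Schwartz function for `g` smooth and compactly supported; its Fourier transform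
is supported in the difference set of the support of `g`. -/
theorem exists_schwartz_normSq_fourierInv (g : E3 → ℂ) (hg : ContDiff ℝ ((⊤ : ℕ∞) : WithTop ℕ∞) g)
    (hs : HasCompactSupport g) :
    ∃ G : 𝓢(E3, ℂ), (∀ x, G x = ((‖𝓕⁻ g x‖ ^ 2 : ℝ) : ℂ)) ∧
      ∀ ω, 𝓕 G ω ≠ 0 → ∃ p q, g p ≠ 0 ∧ g q ≠ 0 ∧ ω = p - q := by
  have hb : HasCompactSupport (fun x : E3 => conj (g (-x))) := by
    have h1 : HasCompactSupport (g ∘ (Homeomorph.neg E3)) := hs.comp_homeomorph _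
    exact h1.comp_left (g := fun z : ℂ => conj z) (by simp)
  have hb' : ContDiff ℝ ((⊤ : ℕ∞) : WithTop ℕ∞) (fun x : E3 => conj (g (-x))) :=
    Complex.conjCLE.contDiff.comp (hg.comp contDiff_neg)
  set a : 𝓢(E3, ℂ) := hs.toSchwartzMap hg with ha
  set b : 𝓢(E3, ℂ) := hb.toSchwartzMap hb' with hbdef
  have ha' : ∀ x, a x = g x := fun x => rfl
  have hb'' : ∀ x, b x = conj (g (-x)) := fun x => rfl
  -- The autocorrelation of `g`: its inverse transform is $|\mathcal F^{-1}g|^2$, and at `ω` it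
  -- integrates $g(t)\overline{g(t-\omega)}$, which forces `ω` into the difference set.
  set Q : 𝓢(E3, ℂ) := SchwartzMap.convolution (ContinuousLinearMap.mul ℂ ℂ) a b with hQ
  refine ⟨𝓕⁻ Q, ?_, ?_⟩
  · intro x
    have h1 : 𝓕 Q = SchwartzMap.pairing (ContinuousLinearMap.mul ℂ ℂ) (𝓕 a) (𝓕 b) :=
      SchwartzMap.fourier_convolution _ _ _
    have h2 : (𝓕⁻ Q) x = (𝓕 Q) (-x) := by
      rw [SchwartzMap.fourierInv_coe, SchwartzMap.fourier_coe, Real.fourierInv_eq_fourier_neg]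
    rw [h2, h1, SchwartzMap.pairing_apply_apply]
    have h3 : (𝓕 a) (-x) = 𝓕⁻ g x := by
      rw [SchwartzMap.fourier_coe, Real.fourierInv_eq_fourier_neg]; rfl
    have h4 : (𝓕 b) (-x) = conj (𝓕⁻ g x) := by
      rw [SchwartzMap.fourier_coe, Real.fourierInv_eq', Real.fourier_eq', ← integral_conj,
        ← integral_neg_eq_self]
      congr 1
      ext v
      simp only [hb'', smul_eq_mul, map_mul, ← Complex.exp_conj]
      simp [map_ofNat]
    rw [h3, h4]
    simp [Complex.mul_conj, Complex.normSq_eq_norm_sq]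
  · intro ω hω
    rw [FourierTransform.fourier_fourierInv_eq, hQ, SchwartzMap.convolution_apply] at hω
    by_contra hcon
    push Not at hcon
    apply hω
    rw [convolution_def]
    apply integral_eq_zero_of_ae
    filter_upwards with t
    simp only [ContinuousLinearMap.mul_apply', Pi.zero_apply, ha', hb'', neg_sub]
    by_cases h1 : g t = 0
    · simp [h1]
    · by_cases h2 : g (t - ω) = 0
      · simp [h2]
      · exact absurd (by abel) (hcon t (t - ω) h1 h2)

/-- Plancherel for an integrable continuous function with integrable Fourier transform. -/
theorem integral_norm_sq_fourier_eq {H : E3 → ℂ} (h1 : Integrable H) (h2 : Continuous H)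
    (h3 : Integrable (𝓕 H)) : ∫ ω, ‖𝓕 H ω‖ ^ 2 = ∫ x, ‖H x‖ ^ 2 := by
  have hc : Integrable (fun ω => conj (𝓕 H ω)) :=
    (Complex.conjCLE : ℂ ≃L[ℝ] ℂ).toContinuousLinearMap.integrable_comp h3
  -- The multiplication formula for `H` and the conjugate of its transform; by inversion the
  -- transform of the latter is the conjugate of `H`.
  have key := VectorFourier.integral_fourierIntegral_smul_eq_flip (μ := (volume : Measure E3))
    (ν := (volume : Measure E3)) (L := innerₗ E3) (e := Real.fourierChar) (f := H)
    (g := fun ω => conj (𝓕 H ω)) Real.continuous_fourierChar (by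
      simpa using continuous_inner) h1 hc
  have h4 : ∀ x, VectorFourier.fourierIntegral Real.fourierChar volume (innerₗ E3).flip
      (fun ω => conj (𝓕 H ω)) x = conj (H x) := by
    intro x
    have hinv : 𝓕⁻ (𝓕 H) x = H x := congrFun (Continuous.fourierInv_fourier_eq h2 h1 h3) x
    rw [← hinv, Real.fourierInv_eq', ← integral_conj, VectorFourier.fourierIntegral]
    congr 1
    ext v
    simp only [smul_eq_mul, map_mul, ← Complex.exp_conj, Circle.smul_def, Real.fourierChar_apply]
    congr 2
    simp [real_inner_comm, map_ofNat]
  have h5 : ∫ ω, ((‖𝓕 H ω‖ ^ 2 : ℝ) : ℂ) = ∫ x, ((‖H x‖ ^ 2 : ℝ) : ℂ) := by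
    have e1 : ∀ z : ℂ, ((‖z‖ ^ 2 : ℝ) : ℂ) = z • conj z := by
      intro z; simp [Complex.mul_conj, Complex.normSq_eq_norm_sq]
    simp_rw [e1]
    refine Eq.trans ?_ (key.trans ?_)
    · rfl
    · congr 1; ext x; rw [h4]
  rw [integral_complex_ofReal, integral_complex_ofReal] at h5
  exact_mod_cast h5

theorem norm_fourier_le_integral_norm (H : E3 → ℂ) (ω : E3) : ‖𝓕 H ω‖ ≤ ∫ x, ‖H x‖ :=
  VectorFourier.norm_fourierIntegral_le_integral_norm _ _ _ _ _

theorem norm_fourierInv_le_integral_norm (H : E3 → ℂ) (ω : E3) : ‖𝓕⁻ H ω‖ ≤ ∫ x, ‖H x‖ :=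
  VectorFourier.norm_fourierIntegral_le_integral_norm _ _ _ _ _

theorem lintegral_enorm_sq_eq_ofReal {H : E3 → ℂ} (h1 : Integrable H) (h2 : Continuous H) {M : ℝ}
    (hM : ∀ x, ‖H x‖ ≤ M) : ∫⁻ x, ‖H x‖ₑ ^ 2 = ENNReal.ofReal (∫ x, ‖H x‖ ^ 2) := by
  have h3 : Integrable (fun x => ‖H x‖ ^ 2) := by
    simp_rw [pow_two]
    exact h1.norm.bdd_mul (c := M) h2.norm.aestronglyMeasurable (by
      filter_upwards with x; simpa using hM x)
  rw [ofReal_integral_eq_lintegral_ofReal h3 (by filter_upwards with x; positivity)]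
  congr 1; ext x
  rw [← ofReal_norm, ENNReal.ofReal_pow (norm_nonneg _)]

theorem lintegral_enorm_sq_fourier_eq {H : E3 → ℂ} (h1 : Integrable H) (h2 : Continuous H)
    (h3 : Integrable (𝓕 H)) : ∫⁻ ω, ‖𝓕 H ω‖ₑ ^ 2 = ∫⁻ x, ‖H x‖ₑ ^ 2 := by
  rw [lintegral_enorm_sq_eq_ofReal h3 (VectorFourier.fourierIntegral_continuous
      Real.continuous_fourierChar (by simpa using continuous_inner) h1)
      (norm_fourier_le_integral_norm H),
    lintegral_enorm_sq_eq_ofReal (M := ∫ x, ‖𝓕 H x‖) h1 h2, integral_norm_sq_fourier_eq h1 h2 h3]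
  intro x
  rw [← congrFun (Continuous.fourierInv_fourier_eq h2 h1 h3) x]
  exact norm_fourierInv_le_integral_norm _ _

/-- The phase is at most $2\pi/6=\pi/3$ on `V`, so the real part of the exponential stays above
$\cos(\pi/3)=1/2$. -/
theorem le_norm_fourier_indicator {V : Set E3} (hV : MeasurableSet V) (hfin : volume V ≠ ∞) {ω : E3}
    (hω : ∀ x ∈ V, |inner ℝ x ω| ≤ 1 / 6) :
    volume.real V / 2 ≤ ‖𝓕 (V.indicator (fun _ => (1 : ℂ))) ω‖ := by
  have e1 : 𝓕 (V.indicator (fun _ => (1 : ℂ))) ω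
      = ∫ x in V, Complex.exp (↑(-2 * Real.pi * inner ℝ x ω) * Complex.I) := by
    rw [Real.fourier_eq', ← integral_indicator hV]
    congr 1; ext v
    by_cases hv : v ∈ V <;> simp [hv]
  have hint : IntegrableOn (fun x : E3 => Complex.exp (↑(-2 * Real.pi * inner ℝ x ω) * Complex.I))
      V := by
    apply IntegrableOn.of_bound (C := 1) (lt_top_iff_ne_top.2 hfin)
    · apply Continuous.aestronglyMeasurable; fun_prop
    · filter_upwards with x
      rw [Complex.norm_exp_ofReal_mul_I]
  refine le_trans ?_ (Complex.re_le_norm _)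
  rw [e1, ← Complex.reCLM_apply, ← ContinuousLinearMap.integral_comp_comm _ hint]
  have h2 : ∫ x in V, (1 / 2 : ℝ) = volume.real V / 2 := by
    simp [Measure.real]; ring
  rw [← h2]
  apply setIntegral_mono_on (integrableOn_const hfin) (Complex.reCLM.integrable_comp hint) hV
  intro x hx
  rw [Complex.reCLM_apply, Complex.exp_ofReal_mul_I_re, ← Real.cos_pi_div_three,
    ← Real.cos_abs (-2 * Real.pi * _)]
  apply Real.cos_le_cos_of_nonneg_of_le_pi (abs_nonneg _) (by linarith [Real.pi_pos])
  have h3 := hω x hx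
  have : |(-2 * Real.pi * inner ℝ x ω)| = 2 * Real.pi * |inner ℝ x ω| := by
    rw [abs_mul, abs_mul, abs_of_pos Real.pi_pos]; norm_num
  rw [this]
  nlinarith [Real.pi_pos]

/-- Local `L²` estimate on the frequency set `D` dual to `V`, in terms of averages over the
translates of `V`. -/
theorem lintegral_fourier_dual_le {V D : Set E3} (hV : MeasurableSet V) (hfin : volume V ≠ ∞)
    (hD : ∀ ω ∈ D, ∀ x ∈ V, |inner ℝ x ω| ≤ 1 / 6) (G : 𝓢(E3, ℂ)) (g : E3 → ℝ)
    (hg : ∀ x, 0 ≤ g x) (hG : ∀ x, G x = (g x : ℂ)) (hDm : MeasurableSet D) :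
    volume V ^ 2 * ∫⁻ ω in D, ‖𝓕 G ω‖ₑ ^ 2 ≤
      4 * ∫⁻ x, (∫⁻ y in V, ENNReal.ofReal (g (x - y))) ^ 2 := by
  set I : E3 → ℂ := V.indicator (fun _ => (1 : ℂ)) with hI
  have hIint : Integrable I := (integrable_indicator_iff hV).2 (integrableOn_const hfin)
  -- Convolving with the indicator multiplies the transform of `G` by a factor of modulus at least
  -- $|V|/2$ on `D`, and turns `G` into its integrals over translates of `V` reflected in the
  -- origin.
  set H : E3 → ℂ := I ⋆[ContinuousLinearMap.mul ℂ ℂ] (G : E3 → ℂ) with hH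
  have hHint : Integrable H := hIint.integrable_convolution _ G.integrable
  have hHc : Continuous H := by
    refine BddAbove.continuous_convolution_right_of_integrable _ ?_ hIint G.continuous
    exact ⟨SchwartzMap.seminorm ℝ 0 0 G, fun x ⟨y, hy⟩ ↦ hy ▸ SchwartzMap.norm_le_seminorm ℝ G y⟩
  have hF : ∀ ω, 𝓕 H ω = 𝓕 I ω * 𝓕 G ω := fun ω =>
    Real.fourier_mul_convolution_eq hIint G.integrable ω
  have hIc : Continuous (𝓕 I) := VectorFourier.fourierIntegral_continuous
      Real.continuous_fourierChar (by simpa using continuous_inner) hIint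
  have hHF : Integrable (𝓕 H) := by
    have : 𝓕 H = fun ω => 𝓕 I ω * 𝓕 G ω := funext hF
    rw [this]
    exact (𝓕 G).integrable.bdd_mul (c := ∫ x, ‖I x‖) hIc.aestronglyMeasurable (by
      filter_upwards with x; exact norm_fourier_le_integral_norm I x)
  have hHval : ∀ x, ‖H x‖ₑ ≤ ∫⁻ y in V, ENNReal.ofReal (g (x - y)) := by
    intro x
    rw [hH, convolution_def]
    refine (enorm_integral_le_lintegral_enorm _).trans ?_
    rw [← lintegral_indicator hV]
    apply lintegral_mono
    intro t
    by_cases ht : t ∈ V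
    · simp only [hI, ht, Set.indicator_of_mem, ContinuousLinearMap.mul_apply', one_mul, hG]
      rw [← ofReal_norm, Complex.norm_real, Real.norm_of_nonneg (hg _)]
    · simp [hI, ht]
  have hvol : volume V = ENNReal.ofReal (volume.real V) := (ENNReal.ofReal_toReal hfin).symm
  calc volume V ^ 2 * ∫⁻ ω in D, ‖𝓕 G ω‖ₑ ^ 2
      = ∫⁻ ω in D, volume V ^ 2 * ‖𝓕 G ω‖ₑ ^ 2 := by
        rw [lintegral_const_mul' _ _ (by finiteness)]
    _ ≤ ∫⁻ ω in D, 4 * ‖𝓕 H ω‖ₑ ^ 2 := by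
        apply setLIntegral_mono' hDm
        intro ω hω
        have h1 := le_norm_fourier_indicator hV hfin (hD ω hω)
        have h2 : volume V ≤ 2 * ‖𝓕 I ω‖ₑ := by
          have h3 : (2 : ℝ≥0∞) * ENNReal.ofReal ‖𝓕 I ω‖ = ENNReal.ofReal (2 * ‖𝓕 I ω‖) := by
            rw [ENNReal.ofReal_mul (by norm_num)]; simp
          rw [hvol, ← ofReal_norm, h3]
          apply ENNReal.ofReal_le_ofReal
          linarith
        calc volume V ^ 2 * ‖𝓕 G ω‖ₑ ^ 2 ≤ (2 * ‖𝓕 I ω‖ₑ) ^ 2 * ‖𝓕 G ω‖ₑ ^ 2 := by gcongr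
          _ = 4 * ‖𝓕 H ω‖ₑ ^ 2 := by rw [hF, enorm_mul]; ring
    _ ≤ ∫⁻ ω, 4 * ‖𝓕 H ω‖ₑ ^ 2 := setLIntegral_le_lintegral _ _
    _ = 4 * ∫⁻ ω, ‖𝓕 H ω‖ₑ ^ 2 := lintegral_const_mul' _ _ (by finiteness)
    _ = 4 * ∫⁻ x, ‖H x‖ₑ ^ 2 := by rw [lintegral_enorm_sq_fourier_eq hHint hHc hHF]
    _ ≤ _ := by
        gcongr with x
        exact hHval x

end ConeKakeya

/-! ### Covering families of translates of a symmetric convex set. -/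

namespace ConeKakeya

open MeasureTheory Convolution ComplexConjugate Pointwise

theorem mem_translate {U : Set E3} {v x : E3} : x ∈ translate U v ↔ x - v ∈ U := by
  constructor
  · rintro ⟨y, hy, rfl⟩; simpa using hy
  · intro h; exact ⟨x - v, h, by simp⟩

theorem volume_translate (U : Set E3) (v : E3) : volume (translate U v) = volume U := by
  rw [translate, Set.image_add_left, measure_preimage_add]

theorem volume_smul_set (c : ℝ) (hc : 0 ≤ c) (U : Set E3) :
    volume (c • U) = ENNReal.ofReal (c ^ 3) * volume U := by
  rw [Measure.addHaar_smul]
  simp [abs_of_nonneg hc]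

theorem sq_sum_le_card_mul {ι : Type*} (s : Finset ι) (φ : ι → ℝ≥0∞) :
    (∑ i ∈ s, φ i) ^ 2 ≤ s.card * ∑ i ∈ s, φ i ^ 2 := by
  have h := ENNReal.rpow_sum_le_const_mul_sum_rpow s φ (p := 2) (by norm_num)
  norm_num at h
  exact h

theorem add_mem_smul_of_convex {U : Set E3} (hU : Convex ℝ U) {a b : ℝ} (ha : 0 < a) (hb : 0 < b)
    {x y : E3} (hx : x ∈ a • U) (hy : y ∈ b • U) : x + y ∈ (a + b) • U := by
  rw [hU.add_smul ha.le hb.le]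
  exact Set.add_mem_add hx hy

theorem smul_set_neg_mem {U : Set E3} (hs : ∀ x ∈ U, -x ∈ U) {a : ℝ} {x : E3} (hx : x ∈ a • U) :
    -x ∈ a • U := by
  obtain ⟨y, hy, rfl⟩ := hx
  exact ⟨-y, hs y hy, by simp⟩

/-- The translates of `U` by `F` all lie in $x+3U$, of volume $27|U|$, and overlap at most `N`
times. Measurability of `U` is avoided by using its interior, of the same volume since a convex set
has null frontier, and a measurable hull of $x+3U$. -/
theorem card_mul_volume_le {U T : Set E3} {N : ℕ} (hU : Convex ℝ U) (hs : ∀ x ∈ U, -x ∈ U)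
    (hT : IsTranslateCover N U T) (x : E3) (F : Finset E3) (hF : ∀ v ∈ F, v ∈ T)
    (hF2 : ∀ v ∈ F, x - v ∈ (2 : ℝ) • U) : F.card * volume U ≤ N * (27 * volume U) := by
  classical
  set W := toMeasurable volume (translate ((3 : ℝ) • U) x) with hW
  have hvW : volume W = 27 * volume U := by
    rw [hW, measure_toMeasurable, volume_translate, volume_smul_set _ (by norm_num)]
    norm_num
  have hint : volume (interior U) = volume U := by
    apply le_antisymm (measure_mono interior_subset)
    calc volume U ≤ volume (interior U ∪ frontier U) := by
          apply measure_mono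
          intro y hy
          by_cases h : y ∈ interior U
          · exact Or.inl h
          · exact Or.inr ⟨subset_closure hy, h⟩
      _ ≤ volume (interior U) + volume (frontier U) := measure_union_le _ _
      _ = volume (interior U) := by rw [hU.addHaar_frontier volume]; simp
  have hm : ∀ v, MeasurableSet (translate (interior U) v) := by
    intro v
    rw [translate, Set.image_add_left]
    exact (isOpen_interior.preimage (by fun_prop)).measurableSet
  calc F.card * volume U = ∑ v ∈ F, ∫⁻ y, (translate (interior U) v).indicator 1 y := by
        simp_rw [lintegral_indicator_one (hm _), volume_translate, hint]
        simp
    _ = ∫⁻ y, ∑ v ∈ F, (translate (interior U) v).indicator 1 y := by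
        rw [lintegral_finsetSum]
        intro v _
        exact measurable_one.indicator (hm v)
    _ ≤ ∫⁻ y, W.indicator (fun _ => (N : ℝ≥0∞)) y := by
        apply lintegral_mono
        intro y
        dsimp only
        have h1 : ∑ v ∈ F, (translate (interior U) v).indicator (1 : E3 → ℝ≥0∞) y
            = (F.filter (fun v => y ∈ translate (interior U) v)).card := by
          rw [Finset.card_filter]; push_cast
          apply Finset.sum_congr rfl
          intro v _
          by_cases h : y ∈ translate (interior U) v <;> simp [h]
        rw [h1]
        by_cases hy : y ∈ W
        · rw [Set.indicator_of_mem hy]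
          have h2 := hT.2 y
          have h3 : ((F.filter (fun v => y ∈ translate (interior U) v) : Finset E3) : Set E3)
              ⊆ {v ∈ T | y ∈ translate U v} := by
            intro v hv
            simp only [Finset.coe_filter, Set.mem_ofPred_eq] at hv
            exact ⟨hF v hv.1, Set.image_mono interior_subset hv.2⟩
          have h4 := (Set.encard_le_encard h3).trans h2
          rw [Set.encard_coe_eq_coe_finsetCard] at h4
          exact_mod_cast h4
        · rw [Set.indicator_of_notMem hy]
          simp only [nonpos_iff_eq_zero, Nat.cast_eq_zero, Finset.card_eq_zero,
            Finset.filter_eq_empty_iff]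
          intro v hv hyv
          apply hy
          apply subset_toMeasurable
          rw [mem_translate] at hyv ⊢
          have h5 : y - v ∈ (1 : ℝ) • U := by rw [one_smul]; exact interior_subset hyv
          have := add_mem_smul_of_convex hU one_pos two_pos h5 (smul_set_neg_mem hs (hF2 v hv))
          rw [show (1 : ℝ) + 2 = 3 by norm_num, show y - v + -(x - v) = y - x by abel] at this
          exact this
    _ = N * (27 * volume U) := by
        rw [lintegral_indicator (measurableSet_toMeasurable _ _), setLIntegral_const, hvW]

theorem finite_near {U T : Set E3} {N : ℕ} (hU : Convex ℝ U) (hs : ∀ x ∈ U, -x ∈ U)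
    (hT : IsTranslateCover N U T) (h0 : volume U ≠ 0) (h1 : volume U ≠ ∞) (x : E3) :
    ∃ F : Finset E3, F.card ≤ 27 * N ∧ ∀ v, v ∈ F ↔ v ∈ T ∧ x - v ∈ (2 : ℝ) • U := by
  have hcard : ∀ F : Finset E3, (∀ v ∈ F, v ∈ T ∧ x - v ∈ (2 : ℝ) • U) → F.card ≤ 27 * N := by
    intro F hF
    have h := card_mul_volume_le hU hs hT x F (fun v hv => (hF v hv).1) (fun v hv => (hF v hv).2)
    rw [← mul_assoc] at h
    have h2 : (F.card : ℝ≥0∞) ≤ N * 27 := (ENNReal.mul_le_mul_iff_left h0 h1).1 h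
    have h3 : F.card ≤ N * 27 := by exact_mod_cast h2
    omega
  have hfin : {v | v ∈ T ∧ x - v ∈ (2 : ℝ) • U}.Finite := by
    by_contra hinf
    obtain ⟨F, hF, hF2⟩ := Set.Infinite.exists_subset_card_eq hinf (27 * N + 1)
    have := hcard F (fun v hv => hF hv)
    omega
  exact ⟨hfin.toFinset, hcard _ (fun v hv => by simpa using hv), fun v => by simp⟩

/-- Every $v+2U$ has interior points, hence meets a dense sequence, and each term of the sequence
lies in only finitely many of these sets. -/
theorem countable_of_cover {U T : Set E3} {N : ℕ} (hU : Convex ℝ U) (hs : ∀ x ∈ U, -x ∈ U)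
    (hT : IsTranslateCover N U T) (h0 : volume U ≠ 0) (h1 : volume U ≠ ∞) : T.Countable := by
  have hne : (interior U).Nonempty := by
    rw [Set.nonempty_iff_ne_empty]
    intro h
    apply h0
    have h2 : U ⊆ frontier U := fun y hy => ⟨subset_closure hy, by simp [h]⟩
    exact measure_mono_null h2 (hU.addHaar_frontier volume)
  obtain ⟨u, hu⟩ := hne
  have hsub : T ⊆ ⋃ n : ℕ, {v | v ∈ T ∧ TopologicalSpace.denseSeq E3 n - v ∈ (2 : ℝ) • U} := by
    intro v hv
    have ho : IsOpen (translate (interior ((2 : ℝ) • U)) v) := by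
      rw [translate, Set.image_add_left]
      exact isOpen_interior.preimage (by fun_prop)
    have hn : (translate (interior ((2 : ℝ) • U)) v).Nonempty := by
      refine ⟨v + (2 : ℝ) • u, (2 : ℝ) • u, ?_, rfl⟩
      rw [interior_smul₀ (by norm_num)]
      exact Set.smul_mem_smul_set hu
    obtain ⟨y, hy, n, rfl⟩ := (TopologicalSpace.denseRange_denseSeq E3).exists_mem_open ho hn |>.elim
      fun n hn => (⟨_, hn, n, rfl⟩ : ∃ y ∈ translate (interior ((2 : ℝ) • U)) v,
        ∃ n, TopologicalSpace.denseSeq E3 n = y)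
    refine Set.mem_iUnion.2 ⟨n, hv, ?_⟩
    rw [mem_translate] at hy
    exact interior_subset hy
  refine Set.Countable.mono hsub (Set.countable_iUnion fun n => ?_)
  obtain ⟨F, -, hF⟩ := finite_near hU hs hT h0 h1 (TopologicalSpace.denseSeq E3 n)
  refine Set.Countable.mono ?_ F.countable_toSet
  intro v hv
  exact (hF v).2 hv

/-- The square of local averages at scale `V ⊆ U` is controlled by the sum over a covering family
of translates of `U`. -/
theorem lintegral_sq_average_le {U T V : Set E3} {N : ℕ} (hU : Convex ℝ U) (hs : ∀ x ∈ U, -x ∈ U)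
    (hT : IsTranslateCover N U T) (h0 : volume U ≠ 0) (h1 : volume U ≠ ∞) (hV : V ⊆ U)
    (φ : E3 → ℝ≥0∞) :
    ∫⁻ x, (∫⁻ y in V, φ (x - y)) ^ 2 ≤
      216 * N * volume U * ∑' v : T, (∫⁻ z in translate U v, φ z) ^ 2 := by
  classical
  have hc : Countable T := countable_of_cover hU hs hT h0 h1
  set J : E3 → ℝ≥0∞ := fun v => ∫⁻ z in translate U v, φ z with hJ
  set W : E3 → Set E3 := fun v => toMeasurable volume (translate ((2 : ℝ) • U) v) with hW
  have hvW : ∀ v, volume (W v) = 8 * volume U := by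
    intro v
    rw [hW]
    simp only
    rw [measure_toMeasurable, volume_translate, volume_smul_set _ (by norm_num)]
    norm_num
  -- The set $x-V$ is covered by the translates with $x-v\in2U$, at most $27N$ in number.
  -- Integrating in `x` then costs $|v+2U|=8|U|$, whence $216=27\cdot8$.
  have hpt : ∀ x, (∫⁻ y in V, φ (x - y)) ^ 2 ≤
      27 * N * ∑' v : T, (W v).indicator (fun _ => J v ^ 2) x := by
    intro x
    obtain ⟨F, hFc, hF⟩ := finite_near hU hs hT h0 h1 x
    have e1 : ∫⁻ y in V, φ (x - y) = ∫⁻ z in (fun y => x - y) ⁻¹' V, φ z := by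
      have hmp : MeasurePreserving (fun y : E3 => x - y) volume volume :=
        Measure.measurePreserving_sub_left volume x
      have := hmp.setLIntegral_comp_preimage_emb (MeasurableEquiv.subLeft x).measurableEmbedding
        φ ((fun y => x - y) ⁻¹' V)
      rw [← this]
      congr 2
      ext y; simp
    have hsub : (fun y => x - y) ⁻¹' V ⊆ ⋃ v : F, translate U v := by
      intro z hz
      obtain ⟨v, hvT, hv⟩ := hT.1 z
      refine Set.mem_iUnion.2 ⟨⟨v, (hF v).2 ⟨hvT, ?_⟩⟩, hv⟩
      have h2 : x - z ∈ (1 : ℝ) • U := by rw [one_smul]; exact hV hz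
      have h3 : z - v ∈ (1 : ℝ) • U := by rw [one_smul]; exact mem_translate.1 hv
      have := add_mem_smul_of_convex hU one_pos one_pos h2 h3
      rw [show (1 : ℝ) + 1 = 2 by norm_num, show x - z + (z - v) = x - v by abel] at this
      exact this
    have e2 : ∫⁻ y in V, φ (x - y) ≤ ∑ v ∈ F, J v := by
      rw [e1]
      calc _ ≤ ∫⁻ z in ⋃ v : F, translate U v, φ z := lintegral_mono_set hsub
        _ ≤ ∑' v : F, ∫⁻ z in translate U v, φ z := lintegral_iUnion_le _ _
        _ = ∑ v ∈ F, J v := by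
          rw [tsum_fintype, Finset.sum_coe_sort F J]
    calc (∫⁻ y in V, φ (x - y)) ^ 2 ≤ (∑ v ∈ F, J v) ^ 2 := by gcongr
      _ ≤ F.card * ∑ v ∈ F, J v ^ 2 := sq_sum_le_card_mul _ _
      _ ≤ 27 * N * ∑' v : T, (W v).indicator (fun _ => J v ^ 2) x := by
        gcongr
        · exact_mod_cast hFc
        · have hFT : ∀ v ∈ F, v ∈ T := fun v hv => ((hF v).1 hv).1
          have : ∑ v ∈ F, J v ^ 2 = ∑ v ∈ F.attach.map ⟨fun v : F => (⟨v.1, hFT v.1 v.2⟩ : T),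
              fun a b h => Subtype.ext (congrArg (fun t : T => (t : E3)) h)⟩,
              (W v).indicator (fun _ => J v ^ 2) x := by
            rw [Finset.sum_map, ← Finset.sum_attach]
            apply Finset.sum_congr rfl
            intro v _
            rw [Set.indicator_of_mem]
            · rfl
            · apply subset_toMeasurable
              rw [mem_translate]
              exact ((hF v.1).1 v.2).2
          rw [this]
          exact ENNReal.sum_le_tsum _
  calc ∫⁻ x, (∫⁻ y in V, φ (x - y)) ^ 2
      ≤ ∫⁻ x, 27 * N * ∑' v : T, (W v).indicator (fun _ => J v ^ 2) x := lintegral_mono hpt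
    _ = 27 * N * ∑' v : T, ∫⁻ x, (W v).indicator (fun _ => J v ^ 2) x := by
        rw [lintegral_const_mul' _ _ (by finiteness), lintegral_tsum]
        intro v
        exact (measurable_const.indicator (measurableSet_toMeasurable _ _)).aemeasurable
    _ = 27 * N * ∑' v : T, (J v ^ 2 * (8 * volume U)) := by
        congr 2
        ext v
        rw [lintegral_indicator (measurableSet_toMeasurable _ _), setLIntegral_const, hvW]
    _ = 216 * N * volume U * ∑' v : T, J v ^ 2 := by
        rw [ENNReal.tsum_mul_right]; ring

end ConeKakeya

/-! ### Planks, their polar sets and wave envelopes. -/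

namespace ConeKakeya

open MeasureTheory Convolution ComplexConjugate Pointwise

theorem tangentialLength_pos {k : ℕ} {δ : ℝ} (hδ : 0 < δ) (ξ : ℝ) : 0 < tangentialLength k δ ξ := by
  unfold tangentialLength
  split_ifs with h
  · positivity
  · have : 0 < |ξ| := lt_of_le_of_lt (by positivity) (not_le.1 h)
    positivity

theorem norm_le_sum_abs (x : E3) : ‖x‖ ≤ |x 0| + |x 1| + |x 2| := by
  rw [EuclideanSpace.norm_eq, Fin.sum_univ_three]
  apply Real.sqrt_le_iff.2
  constructor
  · positivity
  · simp only [Real.norm_eq_abs]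
    nlinarith [abs_nonneg (x 0), abs_nonneg (x 1), abs_nonneg (x 2),
      mul_nonneg (abs_nonneg (x 0)) (abs_nonneg (x 1)),
      mul_nonneg (abs_nonneg (x 0)) (abs_nonneg (x 2)),
      mul_nonneg (abs_nonneg (x 1)) (abs_nonneg (x 2))]

theorem isBounded_plank (k : ℕ) (f : ℝ → ℝ) (c₀ δ ξ : ℝ) :
    Bornology.IsBounded (plank k f c₀ δ ξ) := by
  rw [isBounded_iff_forall_norm_le]
  refine ⟨1 * ‖centralVec f ξ‖ + c₀ * tangentialLength k δ ξ * ‖tangentVec f ξ‖ +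
    c₀ * δ * ‖normalVec f ξ‖ + c₀ * δ * ‖verticalVec‖, ?_⟩
  rintro p ⟨a, b, c₁, c₂, ha, ha', hb, hc₁, hc₂, rfl⟩
  have h1 : ‖a‖ ≤ 1 := by rw [Real.norm_of_nonneg (by linarith)]; exact ha'
  rw [← Real.norm_eq_abs] at hb hc₁ hc₂
  refine (norm_add_le _ _).trans (add_le_add ((norm_add_le _ _).trans (add_le_add
    ((norm_add_le _ _).trans (add_le_add ?_ ?_)) ?_)) ?_) <;>
  · rw [norm_smul]; gcongr

theorem mem_polar_plank_iff {k : ℕ} {f : ℝ → ℝ} {c₀ δ ξ : ℝ} {x : E3} :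
    x ∈ (innerₗ E3).polar (plank k f c₀ δ ξ) ↔ ∀ p ∈ plank k f c₀ δ ξ, |inner ℝ p x| ≤ 1 := by
  simp [LinearMap.polar_mem_iff]

/-- Pairings of the plank's frame with an element of the polar set. -/
theorem polar_plank_bounds {k : ℕ} {f : ℝ → ℝ} {c₀ δ ξ : ℝ} (hc : 0 < c₀) (hδ : 0 < δ) {x : E3}
    (hx : x ∈ (innerₗ E3).polar (plank k f c₀ δ ξ)) :
    |inner ℝ (centralVec f ξ) x| ≤ 1 ∧
    c₀ * tangentialLength k δ ξ * |inner ℝ (tangentVec f ξ) x| ≤ 2 ∧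
    c₀ * δ * |inner ℝ (normalVec f ξ) x| ≤ 2 ∧ c₀ * δ * |inner ℝ verticalVec x| ≤ 2 := by
  rw [mem_polar_plank_iff] at hx
  have hl := tangentialLength_pos (k := k) hδ ξ
  have hB : 0 < c₀ * tangentialLength k δ ξ := by positivity
  have hd : 0 < c₀ * δ := by positivity
  -- Testing with the central vector and its displacement along one frame vector at a time;
  -- subtracting the two bounds yields the constant 2.
  have h0 := hx (centralVec f ξ) ⟨1, 0, 0, 0, by norm_num, le_rfl, by simpa using hB.le,
    by simpa using hd.le, by simpa using hd.le, by simp⟩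
  have h1 := hx (centralVec f ξ + (c₀ * tangentialLength k δ ξ) • tangentVec f ξ)
    ⟨1, c₀ * tangentialLength k δ ξ, 0, 0, by norm_num, le_rfl, by rw [abs_of_pos hB],
      by simpa using hd.le, by simpa using hd.le, by simp⟩
  have h2 := hx (centralVec f ξ + (c₀ * δ) • normalVec f ξ)
    ⟨1, 0, c₀ * δ, 0, by norm_num, le_rfl, by simpa using hB.le,
      by rw [abs_of_pos hd], by simpa using hd.le, by simp⟩
  have h3 := hx (centralVec f ξ + (c₀ * δ) • verticalVec)
    ⟨1, 0, 0, c₀ * δ, by norm_num, le_rfl, by simpa using hB.le,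
      by simpa using hd.le, by rw [abs_of_pos hd], by simp⟩
  rw [inner_add_left, real_inner_smul_left] at h1 h2 h3
  refine ⟨h0, ?_, ?_, ?_⟩
  · rw [← abs_of_pos hB, ← abs_mul]
    rw [abs_le] at *; constructor <;> linarith
  · rw [← abs_of_pos hd, ← abs_mul]
    rw [abs_le] at *; constructor <;> linarith
  · rw [← abs_of_pos hd, ← abs_mul]
    rw [abs_le] at *; constructor <;> linarith

theorem isBounded_polar_plank {k : ℕ} {f : ℝ → ℝ} {c₀ δ ξ : ℝ} (hc : 0 < c₀) (hδ : 0 < δ) :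
    Bornology.IsBounded ((innerₗ E3).polar (plank k f c₀ δ ξ)) := by
  rw [isBounded_iff_forall_norm_le]
  have hl := tangentialLength_pos (k := k) hδ ξ
  have hB : 0 < c₀ * tangentialLength k δ ξ := by positivity
  have hd : 0 < c₀ * δ := by positivity
  set m := slope f ξ
  set L := 2 / (c₀ * tangentialLength k δ ξ)
  set M := 2 / (c₀ * δ)
  refine ⟨(L + |m| * M) + (|m| * L + M) + M, fun x hx => ?_⟩
  obtain ⟨-, h1, h2, h3⟩ := polar_plank_bounds hc hδ hx
  rw [← le_div_iff₀' hB] at h1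
  rw [← le_div_iff₀' hd] at h2 h3
  have e1 : inner ℝ (tangentVec f ξ) x = x 0 + m * x 1 := by
    simp [tangentVec, PiLp.inner_apply, Fin.sum_univ_three, m]; ring
  have e2 : inner ℝ (normalVec f ξ) x = -m * x 0 + x 1 := by
    simp [normalVec, PiLp.inner_apply, Fin.sum_univ_three, m]; ring
  have e3 : inner ℝ verticalVec x = x 2 := by
    simp [verticalVec, PiLp.inner_apply, Fin.sum_univ_three]
  rw [e1] at h1; rw [e2] at h2; rw [e3] at h3
  -- The tangent and normal vectors are orthogonal with squared length $1+m^2$; inverting this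
  -- planar frame recovers the coordinates.
  have key : ∀ y z : ℝ, (1 + m ^ 2) * y = z → |y| ≤ |z| := by
    intro y z h
    rw [← h, abs_mul, abs_of_pos (by positivity : 0 < 1 + m ^ 2)]
    nlinarith [abs_nonneg y, sq_nonneg m]
  have h4 : |x 0| ≤ L + |m| * M := by
    refine (key (x 0) ((x 0 + m * x 1) + (-m) * (-m * x 0 + x 1)) (by ring)).trans ?_
    refine (abs_add_le _ _).trans ?_
    rw [abs_mul, abs_neg]
    gcongr
  have h5 : |x 1| ≤ |m| * L + M := by
    refine (key (x 1) (m * (x 0 + m * x 1) + (-m * x 0 + x 1)) (by ring)).trans ?_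
    refine (abs_add_le _ _).trans ?_
    rw [abs_mul]
    gcongr
  refine (norm_le_sum_abs x).trans ?_
  gcongr

section Envelope

variable {k : ℕ} {f : ℝ → ℝ} {c₀ δ : ℝ} {R : Finset ℝ} {τ : Set E3}

theorem convex_envelope : Convex ℝ (envelope k f c₀ δ R τ) := convex_convexHull _ _

theorem neg_mem_envelope : ∀ x ∈ envelope k f c₀ δ R τ, -x ∈ envelope k f c₀ δ R τ := by
  intro x hx
  have h : -x ∈ -envelope k f c₀ δ R τ := by simpa using hx
  unfold envelope at h ⊢
  rw [← convexHull_neg] at h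
  refine convexHull_mono ?_ h
  intro y hy
  rw [Set.mem_neg] at hy
  simp only [Set.mem_iUnion, mem_polar_plank_iff] at hy ⊢
  simpa using hy

theorem isBounded_envelope (hc : 0 < c₀) (hδ : 0 < δ) :
    Bornology.IsBounded (envelope k f c₀ δ R τ) := by
  unfold envelope
  rw [isBounded_convexHull]
  exact (Bornology.isBounded_biUnion_finset _).2 fun ξ _ => isBounded_polar_plank hc hδ

/-- A plank bounded in norm by `M` has a polar set containing the ball of radius $1/M$. -/
theorem volume_envelope_ne_zero (hne : (planksIn k f c₀ δ R τ).Nonempty) :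
    volume (envelope k f c₀ δ R τ) ≠ 0 := by
  obtain ⟨ξ, hξ⟩ := hne
  obtain ⟨M, hM0, hM⟩ := (isBounded_plank k f c₀ δ ξ).exists_pos_norm_le
  have hsub : Metric.ball (0 : E3) (1 / M) ⊆ envelope k f c₀ δ R τ := by
    refine Set.Subset.trans ?_ (subset_convexHull _ _)
    intro x hx
    refine Set.mem_iUnion₂.2 ⟨ξ, hξ, ?_⟩
    rw [mem_polar_plank_iff]
    intro p hp
    rw [mem_ball_zero_iff] at hx
    calc |inner ℝ p x| ≤ ‖p‖ * ‖x‖ := abs_real_inner_le_norm _ _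
      _ ≤ M * (1 / M) := by gcongr; exact hM p hp
      _ = 1 := by field_simp
  exact ((Metric.measure_ball_pos volume _ (by positivity)).trans_le (measure_mono hsub)).ne'

/-- A slab is convex, so duality to an envelope needs checking only on the individual polar sets. -/
theorem abs_inner_le_of_mem_envelope {ω : E3} {C : ℝ}
    (h : ∀ ξ ∈ planksIn k f c₀ δ R τ, ∀ x ∈ (innerₗ E3).polar (plank k f c₀ δ ξ),
      |inner ℝ x ω| ≤ C) : ∀ x ∈ envelope k f c₀ δ R τ, |inner ℝ x ω| ≤ C := by
  have hconv : Convex ℝ {x : E3 | |inner ℝ x ω| ≤ C} := by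
    intro x hx y hy a b ha hb hab
    simp only [Set.mem_ofPred_eq] at *
    rw [inner_add_left, real_inner_smul_left, real_inner_smul_left]
    calc |a * inner ℝ x ω + b * inner ℝ y ω| ≤ |a * inner ℝ x ω| + |b * inner ℝ y ω| :=
          abs_add_le _ _
      _ = a * |inner ℝ x ω| + b * |inner ℝ y ω| := by
          rw [abs_mul, abs_mul, abs_of_nonneg ha, abs_of_nonneg hb]
      _ ≤ a * C + b * C := by gcongr
      _ = C := by rw [← add_mul, hab, one_mul]
  refine fun x hx => convexHull_min ?_ hconv hx
  intro y hy
  obtain ⟨ξ, hξ, hy⟩ := Set.mem_iUnion₂.1 hy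
  exact h ξ hξ y hy

end Envelope

theorem eLpNorm_two_pow_four (h : E3 → ℝ) (μ : Measure E3) :
    eLpNorm h 2 μ ^ 4 = (∫⁻ x, ‖h x‖ₑ ^ 2 ∂μ) ^ 2 := by
  rw [eLpNorm_eq_lintegral_rpow_enorm_toReal (by norm_num) (by norm_num)]
  simp only [ENNReal.toReal_ofNat, ENNReal.rpow_ofNat, one_div]
  rw [← ENNReal.rpow_natCast, ← ENNReal.rpow_mul, ← ENNReal.rpow_natCast _ 2]
  norm_num

theorem enorm_squareFn_sq (k : ℕ) (f : ℝ → ℝ) (c₀ δ : ℝ) (R : Finset ℝ) (χ : ℝ → E3 → ℝ)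
    (F : 𝓢(E3, ℂ)) (τ : Set E3) (x : E3) :
    ‖squareFn k f c₀ δ R χ F τ x‖ₑ ^ 2 =
      ENNReal.ofReal (∑ ξ ∈ planksIn k f c₀ δ R τ, ‖proj (χ ξ) F x‖ ^ 2) := by
  rw [squareFn, ← ofReal_norm, ← ENNReal.ofReal_pow (norm_nonneg _), Real.norm_eq_abs, sq_abs,
    Real.sq_sqrt (Finset.sum_nonneg fun _ _ => by positivity)]

/-- The squared modulus of a mollified Fourier projection as a Schwartz function. -/
theorem exists_schwartz_normSq_proj {k : ℕ} {f : ℝ → ℝ} {c₀ δ ξ : ℝ} {χ : E3 → ℝ}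
    (hχ : ContDiff ℝ ((⊤ : ℕ∞) : WithTop ℕ∞) χ) (hs : tsupport χ ⊆ plank k f c₀ δ ξ)
    (F : 𝓢(E3, ℂ)) :
    ∃ G : 𝓢(E3, ℂ), (∀ x, G x = ((‖proj χ F x‖ ^ 2 : ℝ) : ℂ)) ∧
      ∀ ω, 𝓕 G ω ≠ 0 → ω ∈ plank k f c₀ δ ξ - plank k f c₀ δ ξ := by
  have hcs : HasCompactSupport χ :=
    Metric.isCompact_of_isClosed_isBounded (isClosed_tsupport χ)
      ((isBounded_plank k f c₀ δ ξ).subset hs)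
  have hg : HasCompactSupport (fun ω : E3 => (χ ω : ℂ) * 𝓕 (F : E3 → ℂ) ω) :=
    (hcs.comp_left (g := fun t : ℝ => (t : ℂ)) (by simp)).mul_right
  have hg' : ContDiff ℝ ((⊤ : ℕ∞) : WithTop ℕ∞) (fun ω : E3 => (χ ω : ℂ) * 𝓕 (F : E3 → ℂ) ω) :=
    (Complex.ofRealCLM.contDiff.comp hχ).mul ((𝓕 F).smooth _)
  obtain ⟨G, hG, hG2⟩ := exists_schwartz_normSq_fourierInv _ hg' hg
  refine ⟨G, hG, fun ω hω => ?_⟩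
  obtain ⟨p, q, hp, hq, rfl⟩ := hG2 ω hω
  have hmem : ∀ p : E3, (χ p : ℂ) * 𝓕 (F : E3 → ℂ) p ≠ 0 → p ∈ plank k f c₀ δ ξ := by
    intro p hp
    apply hs
    apply subset_tsupport
    intro h
    apply hp
    simp [h]
  exact Set.sub_mem_sub (hmem p hp) (hmem q hq)

end ConeKakeya

/-! ### From organized planks to the square function estimate. -/

namespace ConeKakeya

open MeasureTheory Convolution ComplexConjugate Pointwise

/-- The planks with base point in `A` can be organized, frequency by frequency, in boundedly many
planks at a common coarser scale, the frequency being dual to the corresponding wave envelopes. -/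
def IsOrganized (k : ℕ) (f : ℝ → ℝ) (c₀ r : ℝ) (R : ℝ → Finset ℝ) (A : Finset ℝ)
    (m : ℝ → ℝ → ℝ) (M : ℕ) (C : ℝ) : Prop :=
  ∀ ω : E3, ∃ s ∈ scales r, ∃ S ⊆ R (s ^ 2), S.card ≤ M ∧
    (∀ τ ∈ S, ∀ x ∈ envelope k f c₀ (r⁻¹ ^ 2) (R (r⁻¹ ^ 2)) (plank k f c₀ (s ^ 2) τ),
      |inner ℝ x ω| ≤ C) ∧
    ∀ ξ ∈ A, ω ∈ plank k f c₀ (r⁻¹ ^ 2) ξ - plank k f c₀ (r⁻¹ ^ 2) ξ →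
      m s ξ ∈ S ∧ plank k f c₀ (r⁻¹ ^ 2) ξ ⊆ plank k f c₀ (s ^ 2) (m s ξ)

/-- The local contribution of one wave envelope. -/
theorem lintegral_dual_envelope_le {k N : ℕ} {f : ℝ → ℝ} {c₀ δ C : ℝ} {R : Finset ℝ} {τ T : Set E3}
    (hc : 0 < c₀) (hδ : 0 < δ) (hC : 1 ≤ C) (hne : (planksIn k f c₀ δ R τ).Nonempty)
    (hT : IsTranslateCover N (envelope k f c₀ δ R τ) T) {D : Set E3} (hDm : MeasurableSet D)
    (hD : ∀ ω ∈ D, ∀ x ∈ envelope k f c₀ δ R τ, |inner ℝ x ω| ≤ C)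
    (G : 𝓢(E3, ℂ)) (g : E3 → ℝ) (hg : ∀ x, 0 ≤ g x) (hG : ∀ x, G x = (g x : ℂ)) :
    ∫⁻ ω in D, ‖𝓕 G ω‖ₑ ^ 2 ≤ ENNReal.ofReal (864 * N * (6 * C) ^ 6) *
      ∑' v : T, (volume (translate (envelope k f c₀ δ R τ) v))⁻¹ *
        (∫⁻ z in translate (envelope k f c₀ δ R τ) v, ENNReal.ofReal (g z)) ^ 2 := by
  set U := envelope k f c₀ δ R τ with hU
  have hconv : Convex ℝ U := convex_envelope
  have hneg : ∀ x ∈ U, -x ∈ U := neg_mem_envelope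
  have h0 : volume U ≠ 0 := volume_envelope_ne_zero hne
  have h1 : volume U ≠ ∞ := (isBounded_envelope hc hδ).measure_lt_top.ne
  -- This scaling lowers the pairing bound from `C` to $1/6$. The loss is $c^{-6}=(6C)^6$, as
  -- $|V|^2=c^6|U|^2$, and $864=4\cdot216$.
  set c : ℝ := 1 / (6 * C) with hcdef
  have hcpos : 0 < c := by positivity
  set V := interior (c • U) with hV
  have hVU : V ⊆ U := by
    refine interior_subset.trans ?_
    rintro _ ⟨u, hu, rfl⟩
    have hc1 : c ≤ 1 := by rw [hcdef, div_le_one (by positivity)]; linarith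
    have h00 : (0 : E3) ∈ U := by
      have := hconv hu (hneg u hu) (by norm_num : (0 : ℝ) ≤ 1 / 2) (by norm_num : (0 : ℝ) ≤ 1 / 2)
        (by norm_num)
      simpa using this
    exact hconv.smul_mem_of_zero_mem h00 hu ⟨hcpos.le, hc1⟩
  have hvV : volume V = ENNReal.ofReal (c ^ 3) * volume U := by
    rw [← volume_smul_set c hcpos.le]
    apply le_antisymm (measure_mono interior_subset)
    calc volume (c • U) ≤ volume (V ∪ frontier (c • U)) := by
          apply measure_mono
          intro y hy
          by_cases h : y ∈ V
          · exact Or.inl h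
          · exact Or.inr ⟨subset_closure hy, h⟩
      _ ≤ volume V + volume (frontier (c • U)) := measure_union_le _ _
      _ = volume V := by rw [(hconv.smul c).addHaar_frontier volume]; simp
  have hVfin : volume V ≠ ∞ := by rw [hvV]; finiteness
  have hV0 : volume V ≠ 0 := by
    rw [hvV]
    exact mul_ne_zero (by simp; positivity) h0
  have key := lintegral_fourier_dual_le (V := V) (D := D) isOpen_interior.measurableSet hVfin (by
    intro ω hω x hx
    obtain ⟨u, hu, rfl⟩ := interior_subset hx
    simp only [real_inner_smul_left]
    rw [abs_mul, abs_of_pos hcpos]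
    calc c * |inner ℝ u ω| ≤ c * C := by gcongr; exact hD ω hω u hu
      _ = 1 / 6 := by rw [hcdef]; field_simp) G g hg hG hDm
  have key2 := lintegral_sq_average_le hconv hneg hT h0 h1 hVU (fun z => ENNReal.ofReal (g z))
  set X := ∫⁻ ω in D, ‖𝓕 G ω‖ₑ ^ 2
  set Y := ∑' v : T, (∫⁻ z in translate U v, ENNReal.ofReal (g z)) ^ 2
  have h3 : volume V ^ 2 * X ≤ 4 * (216 * N * volume U * Y) := key.trans (by gcongr)
  have e1 : ∑' v : T, (volume (translate U v))⁻¹ *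
        (∫⁻ z in translate U v, ENNReal.ofReal (g z)) ^ 2 = (volume U)⁻¹ * Y := by
    simp_rw [volume_translate]
    rw [ENNReal.tsum_mul_left]
  rw [e1]
  have e2 : volume V ^ 2 ≠ 0 := pow_ne_zero _ hV0
  have e3 : volume V ^ 2 ≠ ∞ := by finiteness
  rw [← ENNReal.mul_le_mul_iff_right e2 e3]
  refine h3.trans (le_of_eq ?_)
  have e4 : ENNReal.ofReal (864 * N * (6 * C) ^ 6) * ENNReal.ofReal (c ^ 3) ^ 2
      = 864 * N := by
    rw [← ENNReal.ofReal_pow (by positivity), ← ENNReal.ofReal_mul (by positivity)]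
    have : 864 * (N : ℝ) * (6 * C) ^ 6 * (c ^ 3) ^ 2 = 864 * N := by
      rw [hcdef]; field_simp
    rw [this, ENNReal.ofReal_mul (by norm_num)]
    simp
  have e5 : volume U * (volume U)⁻¹ = 1 := ENNReal.mul_inv_cancel h0 h1
  calc 4 * (216 * N * volume U * Y) = 864 * N * volume U * Y := by ring
    _ = (ENNReal.ofReal (864 * N * (6 * C) ^ 6) * ENNReal.ofReal (c ^ 3) ^ 2) *
        volume U * (volume U * (volume U)⁻¹) * Y := by rw [e4, e5, mul_one]
    _ = volume V ^ 2 * (ENNReal.ofReal (864 * N * (6 * C) ^ 6) * ((volume U)⁻¹ * Y)) := by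
        rw [hvV]; ring

theorem countable_scales (r : ℝ) : (scales r).Countable := by
  refine (Set.countable_range (fun j : ℕ => (2 : ℝ) ^ j / r)).mono ?_
  rintro s ⟨-, j, rfl⟩
  exact ⟨j, rfl⟩

theorem fourier_sum_apply {ι : Type*} (s : Finset ι) (G : ι → 𝓢(E3, ℂ)) (ω : E3) :
    𝓕 (∑ i ∈ s, G i) ω = ∑ i ∈ s, 𝓕 (G i) ω := by
  rw [FourierTransform.fourier_sum, sum_apply]

/-- Cauchy–Schwarz is applied twice at each frequency, over the `n` blocks and over the at most `M`
planks `τ` of a block; then the local estimate is summed over all scales and all `τ`. -/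
theorem kakeyaLHS_le {k N n M : ℕ} {f : ℝ → ℝ} {c₀ r C : ℝ} (hc : 0 < c₀) (hr : 0 < r)
    (hC : 1 ≤ C) {R : ℝ → Finset ℝ} {T : ℝ → ℝ → Set E3}
    (hT : ∀ s ∈ scales r, ∀ ξ ∈ R (s ^ 2),
      (planksIn k f c₀ (r⁻¹ ^ 2) (R (r⁻¹ ^ 2)) (plank k f c₀ (s ^ 2) ξ)).Nonempty →
      IsTranslateCover N (envelope k f c₀ (r⁻¹ ^ 2) (R (r⁻¹ ^ 2)) (plank k f c₀ (s ^ 2) ξ)) (T s ξ))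
    {χ : ℝ → E3 → ℝ} (hχ : IsPartition k f c₀ (r⁻¹ ^ 2) (R (r⁻¹ ^ 2)) χ) (F : 𝓢(E3, ℂ))
    (blk : ℝ → ℕ) (hblk : ∀ ξ ∈ R (r⁻¹ ^ 2), blk ξ < n) (m : ℕ → ℝ → ℝ → ℝ)
    (hm : ∀ b < n, IsOrganized k f c₀ r R ((R (r⁻¹ ^ 2)).filter (fun ξ => blk ξ = b)) (m b) M C) :
    kakeyaLHS (R (r⁻¹ ^ 2)) χ F ≤ ENNReal.ofReal (n * (M * (864 * N * (6 * C) ^ 6))) *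
      kakeyaRHS k f c₀ r R T χ F := by
  classical
  set δ := r⁻¹ ^ 2 with hδ
  have hδ0 : 0 < δ := by positivity
  have hex : ∀ ξ, ∃ G : 𝓢(E3, ℂ), ξ ∈ R δ → (∀ x, G x = ((‖proj (χ ξ) F x‖ ^ 2 : ℝ) : ℂ)) ∧
      ∀ ω, 𝓕 G ω ≠ 0 → ω ∈ plank k f c₀ δ ξ - plank k f c₀ δ ξ := by
    intro ξ
    by_cases h : ξ ∈ R δ
    · obtain ⟨G, hG⟩ := exists_schwartz_normSq_proj (hχ.contDiff ξ h) (hχ.support ξ h) F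
      exact ⟨G, fun _ => hG⟩
    · exact ⟨0, fun h' => absurd h' h⟩
  choose G hG using hex
  set g : ℝ → E3 → ℝ := fun ξ x => ‖proj (χ ξ) F x‖ ^ 2 with hg
  have hg0 : ∀ ξ x, 0 ≤ g ξ x := fun ξ x => by positivity
  have hGg : ∀ A ⊆ R δ, ∀ x, (∑ ξ ∈ A, G ξ) x = ((∑ ξ ∈ A, g ξ x : ℝ) : ℂ) := by
    intro A hA x
    rw [sum_apply]
    push_cast
    exact Finset.sum_congr rfl fun ξ hξ => by rw [(hG ξ (hA hξ)).1 x]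
  have hgm : ∀ A ⊆ R δ, Measurable fun x => ENNReal.ofReal (∑ ξ ∈ A, g ξ x) := by
    intro A hA
    have : (fun x => ENNReal.ofReal (∑ ξ ∈ A, g ξ x)) = fun x => ‖(∑ ξ ∈ A, G ξ) x‖ₑ := by
      ext x
      rw [hGg A hA, ← ofReal_norm, Complex.norm_real,
        Real.norm_of_nonneg (Finset.sum_nonneg fun _ _ => hg0 _ _)]
    rw [this]
    exact (∑ ξ ∈ A, G ξ).continuous.measurable.enorm
  set A : ℕ → Finset ℝ := fun b => (R δ).filter (fun ξ => blk ξ = b) with hA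
  -- The assignment `m b s` does not depend on the frequency, so these groups are fixed sets of
  -- planks and the local estimate applies to each. For fixed `b` and `s` they are disjoint as `τ`
  -- varies.
  set B : ℕ → ℝ → ℝ → Finset ℝ := fun b s τ =>
    (A b).filter (fun ξ => m b s ξ = τ ∧ plank k f c₀ δ ξ ⊆ plank k f c₀ (s ^ 2) τ) with hB
  have hAR : ∀ b, A b ⊆ R δ := fun b => Finset.filter_subset _ _
  have hBA : ∀ b s τ, B b s τ ⊆ A b := fun b s τ => Finset.filter_subset _ _
  have hBR : ∀ b s τ, B b s τ ⊆ R δ := fun b s τ => (hBA b s τ).trans (hAR b)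
  have hBin : ∀ b s τ, B b s τ ⊆ planksIn k f c₀ δ (R δ) (plank k f c₀ (s ^ 2) τ) := by
    intro b s τ ξ hξ
    rw [planksIn, Finset.mem_filter]
    exact ⟨hBR b s τ hξ, (Finset.mem_filter.1 hξ).2.2⟩
  set D : ℝ → ℝ → Set E3 := fun s τ => {ω | ∀ x ∈ envelope k f c₀ δ (R δ) (plank k f c₀ (s ^ 2) τ),
    |inner ℝ x ω| ≤ C} with hD
  have hDm : ∀ s τ, MeasurableSet (D s τ) := by
    intro s τ
    apply IsClosed.measurableSet
    have : D s τ = ⋂ x ∈ envelope k f c₀ δ (R δ) (plank k f c₀ (s ^ 2) τ),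
        {ω | |inner ℝ x ω| ≤ C} := by ext; simp [hD]
    rw [this]
    exact isClosed_biInter fun x _ => isClosed_le (by fun_prop) continuous_const
  have hpt1 : ∀ b < n, ∀ ω, ‖𝓕 (∑ ξ ∈ A b, G ξ) ω‖ₑ ^ 2 ≤ M * ∑' s : scales r, ∑ τ ∈ R ((s : ℝ) ^ 2),
      (D s τ).indicator (fun ω => ‖𝓕 (∑ ξ ∈ B b s τ, G ξ) ω‖ₑ ^ 2) ω := by
    intro b hb ω
    obtain ⟨s, hs, S, hSR, hSM, hSD, hS⟩ := hm b hb ω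
    have e1 : 𝓕 (∑ ξ ∈ A b, G ξ) ω = ∑ τ ∈ S, 𝓕 (∑ ξ ∈ B b s τ, G ξ) ω := by
      simp_rw [fourier_sum_apply]
      rw [← Finset.sum_biUnion]
      · symm
        apply Finset.sum_subset
        · exact Finset.biUnion_subset.2 fun τ _ => hBA b s τ
        · intro ξ hξ hξ2
          -- A nonzero transform at `ω` puts `ω` in the difference set of the plank, so the plank
          -- belongs to a group over `S`; all other terms vanish.
          by_contra h
          obtain ⟨h1, h2⟩ := hS ξ hξ ((hG ξ (hAR b hξ)).2 ω h)
          exact hξ2 (Finset.mem_biUnion.2 ⟨_, h1, Finset.mem_filter.2 ⟨hξ, rfl, h2⟩⟩)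
      · intro τ _ τ' _ hne
        rw [Function.onFun, Finset.disjoint_left]
        intro ξ h1 h2
        exact hne ((Finset.mem_filter.1 h1).2.1.symm.trans (Finset.mem_filter.1 h2).2.1)
    calc ‖𝓕 (∑ ξ ∈ A b, G ξ) ω‖ₑ ^ 2 ≤ (∑ τ ∈ S, ‖𝓕 (∑ ξ ∈ B b s τ, G ξ) ω‖ₑ) ^ 2 := by
          rw [e1]; gcongr; exact enorm_sum_le _ _
      _ ≤ S.card * ∑ τ ∈ S, ‖𝓕 (∑ ξ ∈ B b s τ, G ξ) ω‖ₑ ^ 2 := sq_sum_le_card_mul _ _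
      _ ≤ M * ∑ τ ∈ R (s ^ 2), (D s τ).indicator (fun ω => ‖𝓕 (∑ ξ ∈ B b s τ, G ξ) ω‖ₑ ^ 2) ω := by
          gcongr
          calc ∑ τ ∈ S, ‖𝓕 (∑ ξ ∈ B b s τ, G ξ) ω‖ₑ ^ 2
              = ∑ τ ∈ S, (D s τ).indicator (fun ω => ‖𝓕 (∑ ξ ∈ B b s τ, G ξ) ω‖ₑ ^ 2) ω := by
                apply Finset.sum_congr rfl
                intro τ hτ
                rw [Set.indicator_of_mem]
                exact hSD τ hτ
            _ ≤ _ := Finset.sum_le_sum_of_subset hSR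
      _ ≤ _ := by
          gcongr
          exact ENNReal.le_tsum (f := fun s : scales r => ∑ τ ∈ R ((s : ℝ) ^ 2),
            (D s τ).indicator (fun ω => ‖𝓕 (∑ ξ ∈ B b s τ, G ξ) ω‖ₑ ^ 2) ω) ⟨s, hs⟩
  have hpt : ∀ ω, ‖𝓕 (∑ ξ ∈ R δ, G ξ) ω‖ₑ ^ 2 ≤ n * ∑ b ∈ Finset.range n, (M *
      ∑' s : scales r, ∑ τ ∈ R ((s : ℝ) ^ 2),
      (D s τ).indicator (fun ω => ‖𝓕 (∑ ξ ∈ B b s τ, G ξ) ω‖ₑ ^ 2) ω) := by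
    intro ω
    have e1 : 𝓕 (∑ ξ ∈ R δ, G ξ) ω = ∑ b ∈ Finset.range n, 𝓕 (∑ ξ ∈ A b, G ξ) ω := by
      simp_rw [fourier_sum_apply]
      rw [Finset.sum_fiberwise_of_maps_to]
      intro ξ hξ
      exact Finset.mem_range.2 (hblk ξ hξ)
    calc _ ≤ (∑ b ∈ Finset.range n, ‖𝓕 (∑ ξ ∈ A b, G ξ) ω‖ₑ) ^ 2 := by
          rw [e1]; gcongr; exact enorm_sum_le _ _
      _ ≤ (Finset.range n).card * ∑ b ∈ Finset.range n, ‖𝓕 (∑ ξ ∈ A b, G ξ) ω‖ₑ ^ 2 :=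
          sq_sum_le_card_mul _ _
      _ ≤ _ := by
          rw [Finset.card_range]
          gcongr with b hb
          exact hpt1 b (Finset.mem_range.1 hb) ω
  have hLHS : kakeyaLHS (R δ) χ F = ∫⁻ ω, ‖𝓕 (∑ ξ ∈ R δ, G ξ) ω‖ₑ ^ 2 := by
    have h2 : 𝓕 ((∑ ξ ∈ R δ, G ξ : 𝓢(E3, ℂ)) : E3 → ℂ) = (𝓕 (∑ ξ ∈ R δ, G ξ) : 𝓢(E3, ℂ)) := by
      rw [SchwartzMap.fourier_coe]
    have h3 := lintegral_enorm_sq_fourier_eq (∑ ξ ∈ R δ, G ξ).integrable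
      (∑ ξ ∈ R δ, G ξ).continuous (by rw [h2]; exact (𝓕 (∑ ξ ∈ R δ, G ξ)).integrable)
    rw [h2] at h3
    rw [h3, kakeyaLHS]
    congr 1; ext x
    rw [hGg _ subset_rfl, ← ofReal_norm, Complex.norm_real, Real.norm_eq_abs,
      ← ENNReal.ofReal_pow (abs_nonneg _), sq_abs]
  have := (countable_scales r).to_subtype
  have hmeas : ∀ b s τ, Measurable
      ((D s τ).indicator (fun ω => ‖𝓕 (∑ ξ ∈ B b s τ, G ξ) ω‖ₑ ^ 2)) := by
    intro b s τ
    exact ((𝓕 (∑ ξ ∈ B b s τ, G ξ)).continuous.measurable.enorm.pow_const 2).indicator (hDm s τ)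
  set K := ENNReal.ofReal (864 * N * (6 * C) ^ 6) with hK
  set J : ℝ → ℝ → E3 → ℕ → ℝ≥0∞ := fun s τ v b =>
    ∫⁻ z in translate (envelope k f c₀ δ (R δ) (plank k f c₀ (s ^ 2) τ)) v,
      ENNReal.ofReal (∑ ξ ∈ B b s τ, g ξ z) with hJ
  have hloc : ∀ b, ∀ s : scales r, ∀ τ ∈ R ((s : ℝ) ^ 2),
      ∫⁻ ω in D s τ, ‖𝓕 (∑ ξ ∈ B b s τ, G ξ) ω‖ₑ ^ 2 ≤ K * ∑' v : T s τ,
        (volume (translate (envelope k f c₀ δ (R δ) (plank k f c₀ ((s : ℝ) ^ 2) τ)) v))⁻¹ *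
          J s τ v b ^ 2 := by
    intro b s τ hτ
    -- A covering family is available only if `τ` contains some plank; otherwise the group is empty
    -- and its contribution is zero.
    by_cases hne : (B b s τ).Nonempty
    · have hne' := hne.mono (hBin b s τ)
      exact lintegral_dual_envelope_le hc hδ0 hC hne' (hT s s.2 τ hτ hne') (hDm s τ)
        (fun ω hω => hω) _ _ (fun x => Finset.sum_nonneg fun _ _ => hg0 _ _) (hGg _ (hBR b s τ))
    · rw [Finset.not_nonempty_iff_eq_empty] at hne
      have : ∀ ω, 𝓕 (∑ ξ ∈ B b s τ, G ξ) ω = 0 := by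
        intro ω
        rw [fourier_sum_apply, hne, Finset.sum_empty]
      simp only [this]
      simp
  -- By nonnegativity the sum of squares is at most the square of the sum, and the groups of
  -- different blocks are disjoint sets of planks inside `τ`. Thus summing over the blocks costs no
  -- second factor `n`.
  have hJsum : ∀ s : scales r, ∀ τ, ∀ v, ∑ b ∈ Finset.range n, J s τ v b ^ 2 ≤
      (∫⁻ x in translate (envelope k f c₀ δ (R δ) (plank k f c₀ ((s : ℝ) ^ 2) τ)) v,
        ‖squareFn k f c₀ δ (R δ) χ F (plank k f c₀ ((s : ℝ) ^ 2) τ) x‖ₑ ^ 2) ^ 2 := by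
    intro s τ v
    have h1 : ∀ t : Finset ℕ, ∑ b ∈ t, J s τ v b ^ 2 ≤ (∑ b ∈ t, J s τ v b) ^ 2 := by
      intro t
      induction t using Finset.induction_on with
      | empty => simp
      | insert a t ha ih =>
        rw [Finset.sum_insert ha, Finset.sum_insert ha, add_sq]
        calc _ ≤ J s τ v a ^ 2 + (∑ b ∈ t, J s τ v b) ^ 2 := by gcongr
          _ ≤ _ := by gcongr; exact le_self_add
    refine (h1 _).trans ?_
    gcongr
    rw [hJ]
    simp only
    rw [← lintegral_finsetSum _ fun b _ => hgm _ (hBR b s τ)]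
    apply lintegral_mono
    intro x
    simp only
    rw [enorm_squareFn_sq, ← ENNReal.ofReal_sum_of_nonneg
      (fun b _ => Finset.sum_nonneg fun _ _ => hg0 _ _)]
    apply ENNReal.ofReal_le_ofReal
    rw [← Finset.sum_biUnion]
    · apply Finset.sum_le_sum_of_subset_of_nonneg
      · exact Finset.biUnion_subset.2 fun b _ => hBin b s τ
      · intro _ _ _; exact hg0 _ _
    · intro b _ b' _ hne
      rw [Function.onFun, Finset.disjoint_left]
      intro ξ h1 h2
      exact hne ((Finset.mem_filter.1 (hBA _ _ _ h1)).2.symm.trans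
        (Finset.mem_filter.1 (hBA _ _ _ h2)).2)
  calc kakeyaLHS (R δ) χ F = ∫⁻ ω, ‖𝓕 (∑ ξ ∈ R δ, G ξ) ω‖ₑ ^ 2 := hLHS
    _ ≤ ∫⁻ ω, n * ∑ b ∈ Finset.range n, (M * ∑' s : scales r, ∑ τ ∈ R ((s : ℝ) ^ 2),
      (D s τ).indicator (fun ω => ‖𝓕 (∑ ξ ∈ B b s τ, G ξ) ω‖ₑ ^ 2) ω) := lintegral_mono hpt
    _ = n * ∑ b ∈ Finset.range n, (M * ∑' s : scales r, ∑ τ ∈ R ((s : ℝ) ^ 2),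
      ∫⁻ ω in D s τ, ‖𝓕 (∑ ξ ∈ B b s τ, G ξ) ω‖ₑ ^ 2) := by
        have hm1 : ∀ b, ∀ s : scales r, Measurable fun ω => ∑ τ ∈ R ((s : ℝ) ^ 2),
            (D s τ).indicator (fun ω => ‖𝓕 (∑ ξ ∈ B b s τ, G ξ) ω‖ₑ ^ 2) ω :=
          fun b s => Finset.measurable_sum _ fun τ _ => hmeas b s τ
        rw [lintegral_const_mul' _ _ (by finiteness), lintegral_finsetSum]
        · congr 1
          apply Finset.sum_congr rfl
          intro b _
          rw [lintegral_const_mul' _ _ (by finiteness), lintegral_tsum]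
          · congr 2
            ext s
            rw [lintegral_finsetSum _ fun τ _ => hmeas b s τ]
            apply Finset.sum_congr rfl
            intro τ _
            rw [lintegral_indicator (hDm s τ)]
          · exact fun s => (hm1 b s).aemeasurable
        · exact fun b _ => (Measurable.tsum (hm1 b)).const_mul _
    _ ≤ n * ∑ b ∈ Finset.range n, (M * ∑' s : scales r, ∑ τ ∈ R ((s : ℝ) ^ 2), (K * ∑' v : T s τ,
        (volume (translate (envelope k f c₀ δ (R δ) (plank k f c₀ ((s : ℝ) ^ 2) τ)) v))⁻¹ *
          J s τ v b ^ 2)) := by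
        gcongr with b _ s τ hτ
        exact hloc b s τ hτ
    _ = n * (M * (K * ∑' s : scales r, ∑ τ ∈ R ((s : ℝ) ^ 2), ∑' v : T s τ,
        (volume (translate (envelope k f c₀ δ (R δ) (plank k f c₀ ((s : ℝ) ^ 2) τ)) v))⁻¹ *
          ∑ b ∈ Finset.range n, J s τ v b ^ 2)) := by
        have hsw : ∑ b ∈ Finset.range n, ∑' s : scales r, ∑ τ ∈ R ((s : ℝ) ^ 2), ∑' v : T s τ,
            (volume (translate (envelope k f c₀ δ (R δ) (plank k f c₀ ((s : ℝ) ^ 2) τ)) v))⁻¹ *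
            J s τ v b ^ 2 = ∑' s : scales r, ∑ τ ∈ R ((s : ℝ) ^ 2), ∑' v : T s τ,
            (volume (translate (envelope k f c₀ δ (R δ) (plank k f c₀ ((s : ℝ) ^ 2) τ)) v))⁻¹ *
            ∑ b ∈ Finset.range n, J s τ v b ^ 2 := by
          rw [← Summable.tsum_finsetSum fun _ _ => ENNReal.summable]
          refine tsum_congr fun s => ?_
          rw [Finset.sum_comm]
          refine Finset.sum_congr rfl fun τ _ => ?_
          rw [← Summable.tsum_finsetSum fun _ _ => ENNReal.summable]
          refine tsum_congr fun v => ?_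
          rw [Finset.mul_sum]
        rw [← hsw, ← Finset.mul_sum]
        congr 2
        rw [Finset.mul_sum]
        refine Finset.sum_congr rfl fun b _ => ?_
        rw [← ENNReal.tsum_mul_left]
        refine tsum_congr fun s => ?_
        rw [Finset.mul_sum]
    _ ≤ n * (M * (K * kakeyaRHS k f c₀ r R T χ F)) := by
        unfold kakeyaRHS
        gcongr with s τ hτ v
        rw [eLpNorm_two_pow_four]
        exact hJsum s τ v
    _ = _ := by
        rw [ENNReal.ofReal_mul (by positivity), ENNReal.ofReal_mul (by positivity),
          ENNReal.ofReal_natCast, ENNReal.ofReal_natCast, mul_assoc, mul_assoc]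

end ConeKakeya

/-! ### Regularity of the base curve and the normal defect. -/

namespace ConeKakeya

open Set Filter Topology

/-- Quantitative regularity of a finite-type function on `[0,1]`, in terms of its slope and of its
second derivative `q` in the interior. -/
structure IsRegular (k : ℕ) (C : ℝ) (f q : ℝ → ℝ) : Prop where
  map_zero : f 0 = 0
  continuousOn : ContinuousOn f (Icc 0 1)
  continuousOn_slope : ContinuousOn (slope f) (Icc 0 1)
  hasDerivAt : ∀ x ∈ Ioo (0 : ℝ) 1, HasDerivAt f (slope f x) x
  hasDerivAt_slope : ∀ x ∈ Ioo (0 : ℝ) 1, HasDerivAt (slope f) (q x) x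
  slope_nonneg : ∀ x ∈ Icc (0 : ℝ) 1, 0 ≤ slope f x
  slope_le : ∀ x ∈ Icc (0 : ℝ) 1, slope f x ≤ C
  le_second : ∀ x ∈ Ioo (0 : ℝ) 1, C⁻¹ * x ^ (k - 2) ≤ q x
  second_le : ∀ x ∈ Ioo (0 : ℝ) 1, q x ≤ C * x ^ (k - 2)

/-- Only the bounds on the first two derivatives enter. The derivative has limits at both end
points, $0$ at the left by the bound $C_1x^{k-1}$ and at the right by monotonicity and boundedness;
these limits are the one-sided derivatives, so the slope is continuous on the closed interval. -/
theorem IsFiniteType.isRegular {k : ℕ} {Cm : ℕ → ℝ} {f : ℝ → ℝ} (hk : 2 ≤ k) (hCm : ∀ m, 1 ≤ Cm m)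
    (hf : IsFiniteType k Cm f) : IsRegular k (max (Cm 1) (Cm 2)) f (iteratedDeriv 2 f) := by
  have hC1 := hCm 1
  have hC2 := hCm 2
  have hk2 : ContDiffOn ℝ 2 f (Ioo 0 1) := hf.contDiffOn.of_le (by exact_mod_cast hk)
  have hderiv : ∀ x ∈ Ioo (0 : ℝ) 1, HasDerivAt f (deriv f x) x := fun x hx =>
    ((hk2.differentiableOn (by norm_num)).differentiableAt (Ioo_mem_nhds hx.1 hx.2)).hasDerivAt
  have hslope : ∀ x ∈ Ioo (0 : ℝ) 1, slope f x = deriv f x := fun x hx =>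
    derivWithin_of_mem_nhds (Icc_mem_nhds hx.1 hx.2)
  have hderiv2 : ∀ x ∈ Ioo (0 : ℝ) 1, HasDerivAt (deriv f) (iteratedDeriv 2 f x) x := by
    intro x hx
    have h1 : ContDiffOn ℝ 1 (deriv f) (Ioo 0 1) := by
      have : ContDiffOn ℝ (1 + 1) f (Ioo 0 1) := by norm_num; exact hk2
      exact ((contDiffOn_succ_iff_deriv_of_isOpen isOpen_Ioo).1 this).2.2
    have h2 := ((h1.differentiableOn (by norm_num)).differentiableAt
      (Ioo_mem_nhds hx.1 hx.2)).hasDerivAt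
    rwa [iteratedDeriv_succ, iteratedDeriv_one]
  have hb1 : ∀ x ∈ Ioo (0 : ℝ) 1, 0 ≤ deriv f x ∧ deriv f x ≤ Cm 1 * x ^ (k - 1) := by
    intro x hx
    have h := hf.deriv_bounds 1 le_rfl (by omega) x hx
    have hp : 0 < x ^ (k - 1) := pow_pos hx.1 _
    rw [iteratedDeriv_one, le_div_iff₀ hp, div_le_iff₀ hp] at h
    exact ⟨le_trans (by positivity) h.1, h.2⟩
  have hb2 : ∀ x ∈ Ioo (0 : ℝ) 1, (Cm 2)⁻¹ * x ^ (k - 2) ≤ iteratedDeriv 2 f x ∧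
      iteratedDeriv 2 f x ≤ Cm 2 * x ^ (k - 2) := by
    intro x hx
    have h := hf.deriv_bounds 2 (by norm_num) hk x hx
    have hp : 0 < x ^ (k - 2) := pow_pos hx.1 _
    rw [le_div_iff₀ hp, div_le_iff₀ hp] at h
    exact h
  have hb1' : ∀ x ∈ Ioo (0 : ℝ) 1, deriv f x ≤ Cm 1 := by
    intro x hx
    refine (hb1 x hx).2.trans ?_
    have : x ^ (k - 1) ≤ 1 := pow_le_one₀ hx.1.le hx.2.le
    nlinarith
  have hmono : MonotoneOn (deriv f) (Ioo 0 1) := by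
    apply monotoneOn_of_deriv_nonneg (convex_Ioo 0 1)
    · exact fun x hx => (hderiv2 x hx).continuousAt.continuousWithinAt
    · rw [interior_Ioo]
      exact fun x hx => (hderiv2 x hx).differentiableAt.differentiableWithinAt
    · rw [interior_Ioo]
      intro x hx
      rw [(hderiv2 x hx).deriv]
      refine le_trans ?_ (hb2 x hx).1
      have := hx.1
      positivity
  have hdiff : DifferentiableOn ℝ f (Ioo 0 1) := fun x hx =>
    (hderiv x hx).differentiableAt.differentiableWithinAt
  have hlim0 : Tendsto (deriv f) (𝓝[>] 0) (𝓝 0) := by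
    have h1 : Tendsto (fun x : ℝ => Cm 1 * x ^ (k - 1)) (𝓝[>] 0) (𝓝 0) := by
      have : Tendsto (fun x : ℝ => Cm 1 * x ^ (k - 1)) (𝓝 0) (𝓝 (Cm 1 * 0 ^ (k - 1))) :=
        (continuous_const.mul (continuous_pow _)).tendsto 0
      rw [zero_pow (by omega), mul_zero] at this
      exact this.mono_left nhdsWithin_le_nhds
    refine tendsto_of_tendsto_of_tendsto_of_le_of_le' tendsto_const_nhds h1 ?_ ?_
    · filter_upwards [Ioo_mem_nhdsGT (zero_lt_one' ℝ)] with x hx using (hb1 x hx).1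
    · filter_upwards [Ioo_mem_nhdsGT (zero_lt_one' ℝ)] with x hx using (hb1 x hx).2
  obtain ⟨e, hlim1⟩ : ∃ e, Tendsto (deriv f) (𝓝[<] 1) (𝓝 e) :=
    ⟨_, hmono.tendsto_nhdsWithin_Ioo_left ⟨1 / 2, by norm_num, by norm_num⟩
      ⟨Cm 1, by rintro _ ⟨x, hx, rfl⟩; exact hb1' x hx⟩⟩
  have hs0 : slope f 0 = 0 := by
    have h := hasDerivWithinAt_Ici_of_tendsto_deriv hdiff
      ((hf.continuousOn 0 (by simp)).mono Ioo_subset_Icc_self) (Ioo_mem_nhdsGT one_pos) hlim0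
    exact (h.mono Icc_subset_Ici_self).derivWithin
      (uniqueDiffOn_Icc one_pos 0 (by simp))
  have hs1 : slope f 1 = e := by
    have h := hasDerivWithinAt_Iic_of_tendsto_deriv hdiff
      ((hf.continuousOn 1 (by simp)).mono Ioo_subset_Icc_self) (Ioo_mem_nhdsLT one_pos) hlim1
    exact (h.mono Icc_subset_Iic_self).derivWithin
      (uniqueDiffOn_Icc one_pos 1 (by simp))
  have he : 0 ≤ e ∧ e ≤ Cm 1 := by
    constructor
    · apply ge_of_tendsto hlim1
      filter_upwards [Ioo_mem_nhdsLT (zero_lt_one' ℝ)] with x hx using (hb1 x hx).1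
    · apply le_of_tendsto hlim1
      filter_upwards [Ioo_mem_nhdsLT (zero_lt_one' ℝ)] with x hx using hb1' x hx
  have hcases : ∀ x ∈ Icc (0 : ℝ) 1, x = 0 ∨ x = 1 ∨ x ∈ Ioo (0 : ℝ) 1 := by
    intro x hx
    rcases hx.1.eq_or_lt with h | h
    · exact Or.inl h.symm
    · rcases hx.2.eq_or_lt with h' | h'
      · exact Or.inr (Or.inl h')
      · exact Or.inr (Or.inr ⟨h, h'⟩)
  have hsderiv : ∀ x ∈ Ioo (0 : ℝ) 1, HasDerivAt (slope f) (iteratedDeriv 2 f x) x := by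
    intro x hx
    apply (hderiv2 x hx).congr_of_eventuallyEq
    filter_upwards [Ioo_mem_nhds hx.1 hx.2] with y hy using hslope y hy
  have hsl : ∀ x ∈ Icc (0 : ℝ) 1, 0 ≤ slope f x ∧ slope f x ≤ Cm 1 := by
    intro x hx
    rcases hcases x hx with rfl | rfl | hx
    · rw [hs0]; exact ⟨le_rfl, by linarith⟩
    · rw [hs1]; exact he
    · rw [hslope x hx]; exact ⟨(hb1 x hx).1, hb1' x hx⟩
  refine ⟨hf.map_zero, hf.continuousOn, ?_, ?_, hsderiv, fun x hx => (hsl x hx).1,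
    fun x hx => (hsl x hx).2.trans (le_max_left _ _), ?_, ?_⟩
  · intro x hx
    rcases hcases x hx with rfl | rfl | hx
    · rw [← continuousWithinAt_sdiff_self]
      have h2 : Tendsto (slope f) (𝓝[>] 0) (𝓝 (slope f 0)) := by
        rw [hs0]
        apply hlim0.congr'
        filter_upwards [Ioo_mem_nhdsGT (zero_lt_one' ℝ)] with x hx using (hslope x hx).symm
      exact h2.mono_left (nhdsWithin_mono _ fun y hy => lt_of_le_of_ne hy.1.1 (Ne.symm hy.2))
    · rw [← continuousWithinAt_sdiff_self]
      have h2 : Tendsto (slope f) (𝓝[<] 1) (𝓝 (slope f 1)) := by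
        rw [hs1]
        apply hlim1.congr'
        filter_upwards [Ioo_mem_nhdsLT (zero_lt_one' ℝ)] with x hx using (hslope x hx).symm
      exact h2.mono_left (nhdsWithin_mono _ fun y hy => lt_of_le_of_ne hy.1.2 hy.2)
    · exact (hsderiv x hx).continuousAt.continuousWithinAt
  · intro x hx
    rw [hslope x hx]
    exact hderiv x hx
  · intro x hx
    refine le_trans ?_ (hb2 x hx).1
    have := hx.1
    gcongr
    exact le_max_right _ _
  · intro x hx
    refine (hb2 x hx).2.trans ?_
    have := hx.1
    gcongr
    exact le_max_right _ _

namespace IsRegular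

variable {k : ℕ} {C : ℝ} {f q : ℝ → ℝ}

theorem slope_sub_le (hf : IsRegular k C f q) (hC : 0 ≤ C) {x y B : ℝ} (hx : x ∈ Icc (0 : ℝ) 1)
    (hy : y ∈ Icc (0 : ℝ) 1) (hxB : x ≤ B) (hyB : y ≤ B) :
    |slope f y - slope f x| ≤ C * B ^ (k - 2) * |y - x| := by
  wlog hxy : x ≤ y generalizing x y
  · rw [abs_sub_comm, abs_sub_comm y]
    exact this hy hx hyB hxB (le_of_not_ge hxy)
  rcases hxy.eq_or_lt with rfl | hlt
  · simp
  obtain ⟨z, hz, hz2⟩ := exists_hasDerivAt_eq_slope (slope f) q hlt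
    (hf.continuousOn_slope.mono (Icc_subset_Icc hx.1 hy.2))
    (fun t ht => hf.hasDerivAt_slope t ⟨hx.1.trans_lt ht.1, ht.2.trans_le hy.2⟩)
  have hz' : z ∈ Ioo (0 : ℝ) 1 := ⟨hx.1.trans_lt hz.1, hz.2.trans_le hy.2⟩
  have hyx : 0 < y - x := sub_pos.2 hlt
  rw [eq_div_iff hyx.ne'] at hz2
  have h1 := hf.second_le z hz'
  have h0 : 0 ≤ q z := by
    refine le_trans ?_ (hf.le_second z hz')
    have := hz'.1
    positivity
  rw [← hz2, abs_mul, abs_of_nonneg h0]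
  gcongr
  refine h1.trans ?_
  have := hz'.1
  have : z ≤ B := hz.2.le.trans hyB
  gcongr

theorem taylor_le (hf : IsRegular k C f q) (hC : 0 ≤ C) {x y B : ℝ} (hx : x ∈ Icc (0 : ℝ) 1)
    (hy : y ∈ Icc (0 : ℝ) 1) (hxB : x ≤ B) (hyB : y ≤ B) :
    |f y - f x - slope f x * (y - x)| ≤ C * B ^ (k - 2) * (y - x) ^ 2 := by
  have hB : 0 ≤ B := hx.1.trans hxB
  have key : ∃ z ∈ Icc (0 : ℝ) 1, z ≤ B ∧ |z - x| ≤ |y - x| ∧ f y - f x = slope f z * (y - x) := by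
    rcases lt_trichotomy x y with h | h | h
    · obtain ⟨z, hz, hz2⟩ := exists_hasDerivAt_eq_slope f (slope f) h
        (hf.continuousOn.mono (Icc_subset_Icc hx.1 hy.2))
        (fun t ht => hf.hasDerivAt t ⟨hx.1.trans_lt ht.1, ht.2.trans_le hy.2⟩)
      rw [eq_div_iff (sub_pos.2 h).ne'] at hz2
      refine ⟨z, ⟨hx.1.trans hz.1.le, hz.2.le.trans hy.2⟩, hz.2.le.trans hyB, ?_, hz2.symm⟩
      rw [abs_of_pos (sub_pos.2 hz.1), abs_of_pos (sub_pos.2 h)]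
      linarith [hz.2]
    · exact ⟨x, hx, hxB, by simp, by simp [h]⟩
    · obtain ⟨z, hz, hz2⟩ := exists_hasDerivAt_eq_slope f (slope f) h
        (hf.continuousOn.mono (Icc_subset_Icc hy.1 hx.2))
        (fun t ht => hf.hasDerivAt t ⟨hy.1.trans_lt ht.1, ht.2.trans_le hx.2⟩)
      rw [eq_div_iff (sub_pos.2 h).ne'] at hz2
      refine ⟨z, ⟨hy.1.trans hz.1.le, hz.2.le.trans hx.2⟩, hz.2.le.trans hxB, ?_, by linarith⟩
      rw [abs_of_neg (sub_neg.2 hz.2), abs_of_neg (sub_neg.2 h)]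
      linarith [hz.1]
  obtain ⟨z, hz, hzB, hzx, hzeq⟩ := key
  have h1 := hf.slope_sub_le hC hx hz hxB hzB
  rw [hzeq, ← sub_mul, abs_mul, ← sq_abs (y - x), pow_two, ← mul_assoc]
  gcongr
  refine h1.trans ?_
  gcongr

theorem abs_sub_le (hf : IsRegular k C f q) {x y : ℝ} (hx : x ∈ Icc (0 : ℝ) 1)
    (hy : y ∈ Icc (0 : ℝ) 1) : |f y - f x| ≤ C * |y - x| := by
  wlog hxy : x ≤ y generalizing x y
  · rw [abs_sub_comm, abs_sub_comm y]
    exact this hy hx (le_of_not_ge hxy)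
  rcases hxy.eq_or_lt with rfl | hlt
  · simp
  obtain ⟨z, hz, hz2⟩ := exists_hasDerivAt_eq_slope f (slope f) hlt
    (hf.continuousOn.mono (Icc_subset_Icc hx.1 hy.2))
    (fun t ht => hf.hasDerivAt t ⟨hx.1.trans_lt ht.1, ht.2.trans_le hy.2⟩)
  have hz' : z ∈ Icc (0 : ℝ) 1 := ⟨hx.1.trans hz.1.le, hz.2.le.trans hy.2⟩
  rw [eq_div_iff (sub_pos.2 hlt).ne'] at hz2
  rw [← hz2, abs_mul, abs_of_nonneg (hf.slope_nonneg z hz')]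
  gcongr
  exact hf.slope_le z hz'

theorem abs_le (hf : IsRegular k C f q) (hC : 0 ≤ C) {x : ℝ} (hx : x ∈ Icc (0 : ℝ) 1) :
    |f x| ≤ C := by
  have h := hf.abs_sub_le (by simp : (0 : ℝ) ∈ Icc (0 : ℝ) 1) hx
  rw [hf.map_zero, sub_zero, sub_zero, abs_of_nonneg hx.1] at h
  nlinarith [hx.2]

end IsRegular

/-- The normal defect of the frequency `(w₁, w₂, h)` with respect to the tangent plane of the cone
at base point `x`. -/
noncomputable def normalDefect (f : ℝ → ℝ) (w₁ w₂ h x : ℝ) : ℝ :=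
  w₂ - h * f x - slope f x * (w₁ - h * x)

theorem normalDefect_neg (f : ℝ → ℝ) (w₁ w₂ h x : ℝ) :
    normalDefect f (-w₁) (-w₂) (-h) x = -normalDefect f w₁ w₂ h x := by
  unfold normalDefect; ring

section Defect

variable {k : ℕ} {C : ℝ} {f q : ℝ → ℝ} {w₁ w₂ h : ℝ}

/-- The terms $h\mathfrak f'$ cancel in the derivative of the defect, leaving $-q(t)(w_1-ht)$, so
the displayed function has derivative $(\sigma q-c)(w_1-ht)$. The choices $(\sigma,c)=(1,c_1)$ and
$(-1,-c_2)$ serve as lower and upper integral estimates without integrating `q`. -/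
theorem IsRegular.monotoneOn_defect (hf : IsRegular k C f q) {x y : ℝ} (hx : x ∈ Icc (0 : ℝ) 1)
    (hy : y ∈ Icc (0 : ℝ) 1) (σ c : ℝ) (hc : ∀ t ∈ Ioo x y, 0 ≤ (σ * q t - c) * (w₁ - h * t)) :
    MonotoneOn (fun t => -(σ * normalDefect f w₁ w₂ h t) - c * (w₁ * t - h * t ^ 2 / 2))
      (Icc x y) := by
  have hsub : Icc x y ⊆ Icc (0 : ℝ) 1 := Icc_subset_Icc hx.1 hy.2
  have hder : ∀ t ∈ Ioo x y, HasDerivAt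
      (fun t => -(σ * normalDefect f w₁ w₂ h t) - c * (w₁ * t - h * t ^ 2 / 2))
      ((σ * q t - c) * (w₁ - h * t)) t := by
    intro t ht
    have ht' : t ∈ Ioo (0 : ℝ) 1 := ⟨hx.1.trans_lt ht.1, ht.2.trans_le hy.2⟩
    have h1 := hf.hasDerivAt t ht'
    have h2 := hf.hasDerivAt_slope t ht'
    have h3 : HasDerivAt (fun t => w₁ - h * t) (-h) t := by
      simpa using ((hasDerivAt_id t).const_mul h).const_sub w₁
    have h4 : HasDerivAt (normalDefect f w₁ w₂ h)
        (-(h * slope f t) - (q t * (w₁ - h * t) + slope f t * (-h))) t :=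
      ((h1.const_mul h).const_sub w₂).sub (h2.mul h3)
    have h5 : HasDerivAt (fun t => w₁ * t - h * t ^ 2 / 2) (w₁ - h * t) t := by
      have := ((hasDerivAt_id t).const_mul w₁).sub ((((hasDerivAt_id t).pow 2).const_mul h).div_const 2)
      convert! this using 1
      simp; ring
    convert! ((h4.const_mul σ).neg).sub (h5.const_mul c) using 1
    ring
  apply monotoneOn_of_deriv_nonneg (convex_Icc x y)
  · have h1 := hf.continuousOn.mono hsub
    have h2 := hf.continuousOn_slope.mono hsub
    unfold normalDefect
    fun_prop
  · rw [interior_Icc]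
    exact fun t ht => (hder t ht).differentiableAt.differentiableWithinAt
  · rw [interior_Icc]
    intro t ht
    rw [(hder t ht).deriv]
    exact hc t ht

/-- The defect difference is the integral of $q(t)(w_1-ht)$, compared with $c_1$ and $c_2$ times the
integral of the linear factor, which the trapezoid formula gives exactly. -/
theorem IsRegular.defect_sub_bounds (hf : IsRegular k C f q) {x y c₁ c₂ : ℝ}
    (hx : x ∈ Icc (0 : ℝ) 1) (hy : y ∈ Icc (0 : ℝ) 1) (hxy : x ≤ y)
    (h1 : ∀ t ∈ Ioo x y, c₁ ≤ q t) (h2 : ∀ t ∈ Ioo x y, q t ≤ c₂)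
    (hbx : 0 ≤ w₁ - h * x) (hby : 0 ≤ w₁ - h * y) :
    c₁ * ((y - x) * ((w₁ - h * x) + (w₁ - h * y)) / 2) ≤
        normalDefect f w₁ w₂ h x - normalDefect f w₁ w₂ h y ∧
      normalDefect f w₁ w₂ h x - normalDefect f w₁ w₂ h y ≤
        c₂ * ((y - x) * ((w₁ - h * x) + (w₁ - h * y)) / 2) := by
  have hb : ∀ t ∈ Ioo x y, 0 ≤ w₁ - h * t := by
    intro t ht
    rcases le_total 0 h with hh | hh
    · nlinarith [ht.2]
    · nlinarith [ht.1]
  have m1 := hf.monotoneOn_defect (w₁ := w₁) (w₂ := w₂) (h := h) hx hy 1 c₁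
    (fun t ht => mul_nonneg (by linarith [h1 t ht]) (hb t ht)) (left_mem_Icc.2 hxy)
    (right_mem_Icc.2 hxy) hxy
  have m2 := hf.monotoneOn_defect (w₁ := w₁) (w₂ := w₂) (h := h) hx hy (-1) (-c₂)
    (fun t ht => mul_nonneg (by linarith [h2 t ht]) (hb t ht)) (left_mem_Icc.2 hxy)
    (right_mem_Icc.2 hxy) hxy
  simp only at m1 m2
  constructor <;> nlinarith

/-- Separation of two base points with almost the same normal defect, on one side of the zero of
`t ↦ w₁ - h t`. -/
theorem IsRegular.same_side (hf : IsRegular k C f q) {x y c₁ c₂ : ℝ}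
    (hx : x ∈ Icc (0 : ℝ) 1) (hy : y ∈ Icc (0 : ℝ) 1) (hxy : x ≤ y)
    (h1 : ∀ t ∈ Ioo x y, c₁ ≤ q t) (h2 : ∀ t ∈ Ioo x y, q t ≤ c₂)
    (hb : (0 ≤ w₁ - h * x ∧ 0 ≤ w₁ - h * y) ∨ (w₁ - h * x ≤ 0 ∧ w₁ - h * y ≤ 0)) :
    c₁ * (y - x) * (|w₁ - h * x| + |w₁ - h * y|) ≤
      2 * |normalDefect f w₁ w₂ h x - normalDefect f w₁ w₂ h y| := by
  rcases hb with ⟨hbx, hby⟩ | ⟨hbx, hby⟩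
  · have h3 := (hf.defect_sub_bounds (w₂ := w₂) hx hy hxy h1 h2 hbx hby).1
    rw [abs_of_nonneg hbx, abs_of_nonneg hby]
    have := le_abs_self (normalDefect f w₁ w₂ h x - normalDefect f w₁ w₂ h y)
    nlinarith
  · have h3 := (hf.defect_sub_bounds (w₁ := -w₁) (h := -h) (w₂ := -w₂) hx hy hxy h1 h2
      (by linarith) (by linarith)).1
    rw [normalDefect_neg, normalDefect_neg] at h3
    rw [abs_of_nonpos hbx, abs_of_nonpos hby]
    have := neg_abs_le (normalDefect f w₁ w₂ h x - normalDefect f w₁ w₂ h y)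
    nlinarith

/-- The integral of $w_1-ht$ from `x` to its zero is $(w_1-hx)^2/(2h)$, and beyond the zero it is
$-(w_1-hy)^2/(2h)$. A small total change of the defect therefore makes the two squares comparable up
to the ratio of $c_2$ to $c_1$. -/
theorem IsRegular.opposite_side_aux (hf : IsRegular k C f q) {x y c₁ c₂ : ℝ}
    (hx : x ∈ Icc (0 : ℝ) 1) (hy : y ∈ Icc (0 : ℝ) 1) (hxy : x ≤ y)
    (h1 : ∀ t ∈ Ioo x y, c₁ ≤ q t) (h2 : ∀ t ∈ Ioo x y, q t ≤ c₂)
    (hbx : 0 ≤ w₁ - h * x) (hby : w₁ - h * y ≤ 0) :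
    c₁ * (w₁ - h * y) ^ 2 ≤ c₂ * (w₁ - h * x) ^ 2 +
        2 * |h| * |normalDefect f w₁ w₂ h x - normalDefect f w₁ w₂ h y| ∧
      c₁ * (w₁ - h * x) ^ 2 ≤ c₂ * (w₁ - h * y) ^ 2 +
        2 * |h| * |normalDefect f w₁ w₂ h x - normalDefect f w₁ w₂ h y| := by
  rcases le_or_gt h 0 with hh | hh
  · have e1 : w₁ - h * x = 0 := by nlinarith
    have e2 : w₁ - h * y = 0 := by nlinarith
    rw [e1, e2]
    constructor <;> · simp; positivity
  set z := w₁ / h with hz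
  have hzw : h * z = w₁ := by rw [hz]; field_simp
  have hxz : x ≤ z := by rw [hz, le_div_iff₀ hh]; linarith
  have hzy : z ≤ y := by rw [hz, div_le_iff₀ hh]; linarith
  have hz01 : z ∈ Icc (0 : ℝ) 1 := ⟨hx.1.trans hxz, hzy.trans hy.2⟩
  obtain ⟨a1, a2⟩ := hf.defect_sub_bounds (w₂ := w₂) hx hz01 hxz
    (fun t ht => h1 t ⟨ht.1, ht.2.trans_le hzy⟩) (fun t ht => h2 t ⟨ht.1, ht.2.trans_le hzy⟩)
    hbx (by linarith : 0 ≤ w₁ - h * z)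
  obtain ⟨b1, b2⟩ := hf.defect_sub_bounds (w₁ := -w₁) (h := -h) (w₂ := -w₂) hz01 hy hzy
    (fun t ht => h1 t ⟨hxz.trans_lt ht.1, ht.2⟩) (fun t ht => h2 t ⟨hxz.trans_lt ht.1, ht.2⟩)
    (by linarith) (by linarith)
  rw [normalDefect_neg, normalDefect_neg] at b1 b2
  set gx := normalDefect f w₁ w₂ h x
  set gy := normalDefect f w₁ w₂ h y
  set gz := normalDefect f w₁ w₂ h z
  rw [abs_of_pos hh]
  have e1 : h * ((z - x) * ((w₁ - h * x) + (w₁ - h * z)) / 2) = (w₁ - h * x) ^ 2 / 2 := by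
    have : h * (z - x) = w₁ - h * x := by rw [mul_sub, hzw]
    rw [hzw]
    linear_combination (w₁ - h * x) / 2 * this
  have e2 : h * ((y - z) * ((-w₁ - -h * z) + (-w₁ - -h * y)) / 2) = (w₁ - h * y) ^ 2 / 2 := by
    have h3 : h * (y - z) = -(w₁ - h * y) := by rw [mul_sub, hzw]; ring
    have h4 : -w₁ - -h * z = 0 := by linarith
    rw [h4]
    linear_combination (-w₁ + h * y) / 2 * h3
  have a1' := mul_le_mul_of_nonneg_left a1 hh.le
  have a2' := mul_le_mul_of_nonneg_left a2 hh.le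
  have b1' := mul_le_mul_of_nonneg_left b1 hh.le
  have b2' := mul_le_mul_of_nonneg_left b2 hh.le
  rw [mul_left_comm, e1] at a1'
  rw [mul_left_comm h c₂, e1] at a2'
  rw [mul_left_comm, e2] at b1'
  rw [mul_left_comm h c₂, e2] at b2'
  have g1 := mul_le_mul_of_nonneg_left (le_abs_self (gx - gy)) hh.le
  have g2 := mul_le_mul_of_nonneg_left (neg_abs_le (gx - gy)) hh.le
  constructor <;> nlinarith

theorem IsRegular.opposite_side (hf : IsRegular k C f q) {x y c₁ c₂ : ℝ}
    (hx : x ∈ Icc (0 : ℝ) 1) (hy : y ∈ Icc (0 : ℝ) 1) (hxy : x ≤ y)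
    (h1 : ∀ t ∈ Ioo x y, c₁ ≤ q t) (h2 : ∀ t ∈ Ioo x y, q t ≤ c₂)
    (hb : (0 ≤ w₁ - h * x ∧ w₁ - h * y ≤ 0) ∨ (w₁ - h * x ≤ 0 ∧ 0 ≤ w₁ - h * y)) :
    c₁ * (w₁ - h * y) ^ 2 ≤ c₂ * (w₁ - h * x) ^ 2 +
        2 * |h| * |normalDefect f w₁ w₂ h x - normalDefect f w₁ w₂ h y| ∧
      c₁ * (w₁ - h * x) ^ 2 ≤ c₂ * (w₁ - h * y) ^ 2 +
        2 * |h| * |normalDefect f w₁ w₂ h x - normalDefect f w₁ w₂ h y| := by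
  rcases hb with ⟨hbx, hby⟩ | ⟨hbx, hby⟩
  · exact hf.opposite_side_aux hx hy hxy h1 h2 hbx hby
  · have := hf.opposite_side_aux (w₁ := -w₁) (h := -h) (w₂ := -w₂) hx hy hxy h1 h2
      (by linarith) (by linarith)
    rw [normalDefect_neg, normalDefect_neg, abs_neg,
      show -normalDefect f w₁ w₂ h x - -normalDefect f w₁ w₂ h y
        = -(normalDefect f w₁ w₂ h x - normalDefect f w₁ w₂ h y) by ring, abs_neg] at this
    rw [show (w₁ - h * y) ^ 2 = (-w₁ - -h * y) ^ 2 by ring,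
      show (w₁ - h * x) ^ 2 = (-w₁ - -h * x) ^ 2 by ring]
    exact this

end Defect

end ConeKakeya

/-! ### Clusters of base points, and coordinates in the frame of a plank. -/

namespace ConeKakeya

open Set Pointwise

/-- `x` and `y` lie on the same side of the zero of `t ↦ w - h t`. -/
def SameSide (w h x y : ℝ) : Prop :=
  (0 ≤ w - h * x ∧ 0 ≤ w - h * y) ∨ (w - h * x ≤ 0 ∧ w - h * y ≤ 0)

theorem SameSide.symm {w h x y : ℝ} (H : SameSide w h x y) : SameSide w h y x := by
  unfold SameSide at *; tauto

theorem sameSide_self (w h x : ℝ) : SameSide w h x x := by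
  rcases le_total 0 (w - h * x) with H | H
  · exact Or.inl ⟨H, H⟩
  · exact Or.inr ⟨H, H⟩

/-- The base points with small normal defect form two clusters; their size controls the height and
the tangential displacement of the frequency. -/
theorem IsRegular.exists_cluster {k : ℕ} {C : ℝ} {f q : ℝ → ℝ} (hf : IsRegular k C f q)
    {w₁ w₂ h α β c₁ c₂ E : ℝ} (hα : 0 ≤ α) (hαβ : α ≤ β) (hβ : β ≤ 1) (hc₁ : 0 < c₁)
    (hc : c₁ ≤ c₂) (hq : ∀ t ∈ Ioo α β, c₁ ≤ q t ∧ q t ≤ c₂) (P : Finset ℝ)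
    (hP : ∀ x ∈ P, x ∈ Icc α β) (hE0 : 0 ≤ E) (hE : ∀ x ∈ P, |normalDefect f w₁ w₂ h x| ≤ E) :
    ∃ d, 0 ≤ d ∧ d ≤ β - α ∧ (∀ x ∈ P, ∀ y ∈ P, SameSide w₁ h x y → |x - y| ≤ d) ∧
      (∀ x ∈ P, c₁ * d * |w₁ - h * x| ≤ 8 * (c₂ / c₁) * E) ∧ c₁ * d ^ 2 * |h| ≤ 4 * E := by
  classical
  have hρ : 1 ≤ c₂ / c₁ := (one_le_div hc₁).2 hc
  rcases P.eq_empty_or_nonempty with rfl | ⟨x₀, hx₀⟩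
  · exact ⟨0, le_rfl, by linarith, by simp, by simp, by simp; positivity⟩
  -- `d` is the largest distance of a same-side pair. That extremal pair satisfies the estimates
  -- directly, and since $|h|d$ is the variation of $w_1-ht$ across it, the height bound follows as
  -- well.
  set Q := (P ×ˢ P).filter (fun z => SameSide w₁ h z.1 z.2)
  obtain ⟨⟨x, y⟩, hxy, hmax⟩ := Q.exists_max_image (fun z => |z.1 - z.2|)
    ⟨(x₀, x₀), by simp [Q, hx₀, sameSide_self]⟩
  simp only [Q, Finset.mem_filter, Finset.mem_product] at hxy hmax
  obtain ⟨⟨hx, hy⟩, hss⟩ := hxy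
  wlog hle : x ≤ y generalizing x y
  · exact this y x (fun b hb => by rw [abs_sub_comm y x]; exact hmax b hb) hss.symm hy hx
      (le_of_not_ge hle)
  have hdef : |x - y| = y - x := by rw [abs_sub_comm, abs_of_nonneg (by linarith)]
  have hIcc : ∀ z ∈ P, z ∈ Icc (0 : ℝ) 1 := fun z hz =>
    ⟨hα.trans (hP z hz).1, (hP z hz).2.trans hβ⟩
  have hq' : ∀ u ∈ P, ∀ v ∈ P, (∀ t ∈ Ioo u v, c₁ ≤ q t) ∧ ∀ t ∈ Ioo u v, q t ≤ c₂ := by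
    intro u hu v hv
    constructor
    · exact fun t ht => (hq t ⟨(hP u hu).1.trans_lt ht.1, ht.2.trans_le (hP v hv).2⟩).1
    · exact fun t ht => (hq t ⟨(hP u hu).1.trans_lt ht.1, ht.2.trans_le (hP v hv).2⟩).2
  have hgg : ∀ u ∈ P, ∀ v ∈ P,
      |normalDefect f w₁ w₂ h u - normalDefect f w₁ w₂ h v| ≤ 2 * E := by
    intro u hu v hv
    have h1 := abs_sub (normalDefect f w₁ w₂ h u) (normalDefect f w₁ w₂ h v)
    linarith [hE u hu, hE v hv]
  set d := y - x with hd
  have hd0 : 0 ≤ d := by linarith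
  have hb : c₁ * d * (|w₁ - h * x| + |w₁ - h * y|) ≤ 4 * E := by
    have := hf.same_side (w₂ := w₂) (hIcc x hx) (hIcc y hy) hle (hq' x hx y hy).1
      (hq' x hx y hy).2 hss
    linarith [hgg x hx y hy]
  have hcd : 0 ≤ c₁ * d := by positivity
  have hbx : c₁ * d * |w₁ - h * x| ≤ 4 * E := by
    have := mul_nonneg hcd (abs_nonneg (w₁ - h * y))
    linarith
  have hh : c₁ * d ^ 2 * |h| ≤ 4 * E := by
    have h1 : |h| * d = |(w₁ - h * x) - (w₁ - h * y)| := by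
      have : |h| * d = |h * d| := by rw [abs_mul, abs_of_nonneg hd0]
      rw [this, hd]; congr 1; ring
    have h2 := abs_sub (w₁ - h * x) (w₁ - h * y)
    calc c₁ * d ^ 2 * |h| = c₁ * d * (|h| * d) := by ring
      _ ≤ c₁ * d * (|w₁ - h * x| + |w₁ - h * y|) := by rw [h1]; gcongr
      _ ≤ _ := hb
  refine ⟨d, hd0, by linarith [(hP x hx).1, (hP y hy).2], ?_, ?_, hh⟩
  · intro u hu v hv huv
    rw [← hdef]
    exact hmax (u, v) ⟨⟨hu, hv⟩, huv⟩
  · intro z hz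
    -- A point on the side of `x` is compared with `x` through $|h|d$. A point on the other side is
    -- compared through `opposite_side`, with the bound on $|h|$ absorbing the error; this is why
    -- the ratio $c_2/c_1$ appears.
    by_cases hzx : SameSide w₁ h z x
    · have h1 : |z - x| ≤ d := by rw [← hdef]; exact hmax (z, x) ⟨⟨hz, hx⟩, hzx⟩
      have h2 : |w₁ - h * z| ≤ |w₁ - h * x| + |h| * d := by
        calc |w₁ - h * z| = |(w₁ - h * x) - h * (z - x)| := by congr 1; ring
          _ ≤ |w₁ - h * x| + |h * (z - x)| := abs_sub _ _
          _ ≤ _ := by rw [abs_mul]; gcongr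
      calc c₁ * d * |w₁ - h * z| ≤ c₁ * d * (|w₁ - h * x| + |h| * d) := by gcongr
        _ = c₁ * d * |w₁ - h * x| + c₁ * d ^ 2 * |h| := by ring
        _ ≤ 8 * 1 * E := by linarith
        _ ≤ _ := by gcongr
    · have hopp : (0 ≤ w₁ - h * z ∧ w₁ - h * x ≤ 0) ∨ (w₁ - h * z ≤ 0 ∧ 0 ≤ w₁ - h * x) := by
        unfold SameSide at hzx
        rcases le_total 0 (w₁ - h * z) with H | H <;> rcases le_total 0 (w₁ - h * x) with H' | H' <;>
          tauto
      have h1 : c₁ * (w₁ - h * z) ^ 2 ≤ c₂ * (w₁ - h * x) ^ 2 + 4 * (|h| * E) := by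
        rcases le_total z x with hle' | hle'
        · have := (hf.opposite_side (w₂ := w₂) (hIcc z hz) (hIcc x hx) hle' (hq' z hz x hx).1
            (hq' z hz x hx).2 hopp).2
          have := mul_le_mul_of_nonneg_left (hgg z hz x hx) (abs_nonneg h)
          linarith
        · have := (hf.opposite_side (w₂ := w₂) (hIcc x hx) (hIcc z hz) hle' (hq' x hx z hz).1
            (hq' x hx z hz).2 (by tauto)).1
          have := mul_le_mul_of_nonneg_left (hgg x hx z hz) (abs_nonneg h)
          linarith
      set ρ := c₂ / c₁ with hρdef
      have hc₂ : c₂ = ρ * c₁ := by rw [hρdef]; field_simp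
      apply abs_le_of_sq_le_sq' _ (by positivity) |>.2
      have h3 : (c₁ * d * |w₁ - h * x|) ^ 2 ≤ (4 * E) ^ 2 := by gcongr
      have h4 : (c₁ * d * |w₁ - h * z|) ^ 2 ≤
          ρ * (c₁ * d * |w₁ - h * x|) ^ 2 + 4 * E * (c₁ * d ^ 2 * |h|) := by
        have := mul_le_mul_of_nonneg_left h1 (by positivity : 0 ≤ c₁ * d ^ 2)
        rw [hc₂] at this
        simp only [mul_pow, sq_abs] at *
        nlinarith
      calc (c₁ * d * |w₁ - h * z|) ^ 2
          ≤ ρ * (c₁ * d * |w₁ - h * x|) ^ 2 + 4 * E * (c₁ * d ^ 2 * |h|) := h4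
        _ ≤ ρ * (4 * E) ^ 2 + 4 * E * (4 * E) := by gcongr
        _ ≤ (8 * ρ * E) ^ 2 := by nlinarith [sq_nonneg E, mul_nonneg (sq_nonneg E) (by linarith : 0 ≤ ρ - 1), mul_nonneg (mul_nonneg (sq_nonneg E) (by linarith : 0 ≤ ρ - 1)) (by linarith : 0 ≤ ρ)]

section Plank

variable {k : ℕ} {C : ℝ} {f q : ℝ → ℝ} {c₀ δ ξ : ℝ}

theorem mem_plank_iff {p : E3} : p ∈ plank k f c₀ δ ξ ↔ ∃ a b c₁ c₂ : ℝ, 1 / 2 ≤ a ∧ a ≤ 1 ∧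
    |b| ≤ c₀ * tangentialLength k δ ξ ∧ |c₁| ≤ c₀ * δ ∧ |c₂| ≤ c₀ * δ ∧
    p 0 = a * ξ + b - c₁ * slope f ξ ∧ p 1 = a * f ξ + b * slope f ξ + c₁ ∧ p 2 = a + c₂ := by
  unfold plank
  constructor
  · rintro ⟨a, b, c₁, c₂, h1, h2, h3, h4, h5, rfl⟩
    refine ⟨a, b, c₁, c₂, h1, h2, h3, h4, h5, ?_, ?_, ?_⟩ <;>
    (simp [centralVec, tangentVec, normalVec, verticalVec]; try ring)
  · rintro ⟨a, b, c₁, c₂, h1, h2, h3, h4, h5, e0, e1, e2⟩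
    refine ⟨a, b, c₁, c₂, h1, h2, h3, h4, h5, ?_⟩
    ext i
    fin_cases i
    · simp [centralVec, tangentVec, normalVec, verticalVec, e0]; ring
    · simp [centralVec, tangentVec, normalVec, verticalVec, e1]
    · simp [centralVec, tangentVec, normalVec, verticalVec, e2]

theorem centralVec_mem_plank (hc : 0 ≤ c₀) (hδ : 0 < δ) : centralVec f ξ ∈ plank k f c₀ δ ξ := by
  have := (tangentialLength_pos (k := k) hδ ξ).le
  exact ⟨1, 0, 0, 0, by norm_num, le_rfl, by simp; positivity, by simp; positivity,
    by simp; positivity, by simp⟩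

/-- Position, relative to the plank's frame, of a frequency in the difference set of a plank. -/
theorem IsRegular.sub_plank_bounds (hf : IsRegular k C f q) (hC : 1 ≤ C) (hc : 0 ≤ c₀)
    (hδ : 0 < δ) (hδ1 : δ ≤ 1) (hξ : ξ ∈ Icc (0 : ℝ) 1) {ω : E3}
    (hω : ω ∈ plank k f c₀ δ ξ - plank k f c₀ δ ξ) :
    |ω 2| ≤ 1 + 2 * c₀ ∧ |ω 0 - ω 2 * ξ| ≤ 2 * c₀ * (tangentialLength k δ ξ + (C + 1) * δ) ∧
      |normalDefect f (ω 0) (ω 1) (ω 2) ξ| ≤ 2 * c₀ * (1 + C) ^ 2 * δ := by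
  obtain ⟨p, hp, p', hp', rfl⟩ := hω
  obtain ⟨a, b, c₁, c₂, h1, h2, h3, h4, h5, e0, e1, e2⟩ := mem_plank_iff.1 hp
  obtain ⟨a', b', c₁', c₂', h1', h2', h3', h4', h5', e0', e1', e2'⟩ := mem_plank_iff.1 hp'
  simp only [PiLp.sub_apply, e0, e1, e2, e0', e1', e2']
  set m := slope f ξ
  have hm : |m| ≤ C := by rw [abs_of_nonneg (hf.slope_nonneg ξ hξ)]; exact hf.slope_le ξ hξ
  have hfξ : |f ξ| ≤ C := hf.abs_le (by linarith) hξ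
  have hξ' : |ξ| ≤ 1 := by rw [abs_of_nonneg hξ.1]; exact hξ.2
  have d1 : |c₁ - c₁'| ≤ 2 * c₀ * δ := by
    have := abs_sub c₁ c₁'
    linarith
  have d2 : |c₂ - c₂'| ≤ 2 * c₀ * δ := by
    have := abs_sub c₂ c₂'
    linarith
  have db : |b - b'| ≤ 2 * c₀ * tangentialLength k δ ξ := by
    have := abs_sub b b'
    linarith
  refine ⟨?_, ?_, ?_⟩
  · have e : a + c₂ - (a' + c₂') = (a - a') + (c₂ - c₂') := by ring
    rw [e]
    have e3 : |a - a'| ≤ 1 := by rw [_root_.abs_le]; constructor <;> linarith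
    have := abs_add_le (a - a') (c₂ - c₂')
    have : c₀ * δ ≤ c₀ * 1 := by gcongr
    linarith
  · have e : a * ξ + b - c₁ * m - (a' * ξ + b' - c₁' * m) - (a + c₂ - (a' + c₂')) * ξ
        = (b - b') - (c₁ - c₁') * m - (c₂ - c₂') * ξ := by ring
    rw [e]
    calc |(b - b') - (c₁ - c₁') * m - (c₂ - c₂') * ξ|
        ≤ |b - b'| + |c₁ - c₁'| * |m| + |c₂ - c₂'| * |ξ| := by
          rw [← abs_mul, ← abs_mul]
          exact (abs_sub _ _).trans (add_le_add_left (abs_sub _ _) _)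
      _ ≤ 2 * c₀ * tangentialLength k δ ξ + 2 * c₀ * δ * C + 2 * c₀ * δ * 1 := by gcongr
      _ = _ := by ring
  -- The defect at `ξ` annihilates the central and tangent vectors, so only the components of size
  -- $\delta$ remain.
  · have e : normalDefect f (a * ξ + b - c₁ * m - (a' * ξ + b' - c₁' * m))
        (a * f ξ + b * m + c₁ - (a' * f ξ + b' * m + c₁')) (a + c₂ - (a' + c₂')) ξ
        = (c₁ - c₁') * (1 + m * m) - (c₂ - c₂') * (f ξ - m * ξ) := by
      unfold normalDefect; ring
    rw [e]
    calc |(c₁ - c₁') * (1 + m * m) - (c₂ - c₂') * (f ξ - m * ξ)|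
        ≤ |c₁ - c₁'| * (1 + |m| * |m|) + |c₂ - c₂'| * (|f ξ| + |m| * |ξ|) := by
          refine (abs_sub _ _).trans ?_
          rw [abs_mul, abs_mul]
          gcongr
          · refine (abs_add_le _ _).trans ?_
            rw [abs_mul, abs_one]
          · refine (abs_sub _ _).trans ?_
            rw [abs_mul]
      _ ≤ (2 * c₀ * δ) * (1 + C * C) + (2 * c₀ * δ) * (C + C * 1) := by gcongr
      _ = _ := by ring

/-- The base point of a plank contained in another one is close to the base point of the latter. -/
theorem IsRegular.abs_sub_le_of_plank_subset (hf : IsRegular k C f q) (hc : 0 ≤ c₀)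
    (hδ : 0 < δ) {Δ T : ℝ} (hΔ : 0 < Δ) (hT : T ∈ Icc (0 : ℝ) 1)
    (h : plank k f c₀ δ ξ ⊆ plank k f c₀ Δ T) :
    |ξ - T| ≤ c₀ * (tangentialLength k Δ T + (1 + C) * Δ) := by
  obtain ⟨a, b, c₁, c₂, h1, h2, h3, h4, h5, e0, e1, e2⟩ :=
    mem_plank_iff.1 (h (centralVec_mem_plank hc hδ))
  simp [centralVec] at e0 e2
  have hm := hf.slope_le T hT
  have hm0 := hf.slope_nonneg T hT
  have e : ξ - T = b - c₁ * slope f T - c₂ * T := by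
    have : a = 1 - c₂ := by linarith
    rw [e0, this]; ring
  rw [e]
  calc |b - c₁ * slope f T - c₂ * T| ≤ |b| + |c₁| * |slope f T| + |c₂| * |T| := by
          rw [← abs_mul, ← abs_mul]
          exact (abs_sub _ _).trans (add_le_add_left (abs_sub _ _) _)
    _ ≤ c₀ * tangentialLength k Δ T + c₀ * Δ * C + c₀ * Δ * 1 := by
          rw [abs_of_nonneg hm0, abs_of_nonneg hT.1]
          gcongr
          · exact hT.1
          · exact hT.2
    _ = _ := by ring

/-- Change of base point for the tangential displacement and the normal defect. -/
theorem IsRegular.normalDefect_sub_le (hf : IsRegular k C f q) (hC : 0 ≤ C) {x y B : ℝ}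
    (hx : x ∈ Icc (0 : ℝ) 1) (hy : y ∈ Icc (0 : ℝ) 1) (hxB : x ≤ B) (hyB : y ≤ B) (w₁ w₂ h : ℝ) :
    |normalDefect f w₁ w₂ h y - normalDefect f w₁ w₂ h x| ≤
      C * B ^ (k - 2) * (|h| * (y - x) ^ 2 + |y - x| * |w₁ - h * x|) := by
  have h1 := hf.slope_sub_le hC hx hy hxB hyB
  have h2 := hf.taylor_le hC hy hx hyB hxB
  have e : normalDefect f w₁ w₂ h y - normalDefect f w₁ w₂ h x =
      h * (f x - f y - slope f y * (x - y)) - (slope f y - slope f x) * (w₁ - h * x) := by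
    unfold normalDefect; ring
  rw [e]
  calc _ ≤ |h| * |f x - f y - slope f y * (x - y)| + |slope f y - slope f x| * |w₁ - h * x| := by
        rw [← abs_mul, ← abs_mul]; exact abs_sub _ _
    _ ≤ |h| * (C * B ^ (k - 2) * (x - y) ^ 2) + C * B ^ (k - 2) * |y - x| * |w₁ - h * x| := by
        gcongr
    _ = _ := by ring

/-- After removing $h\,\mathbf c(\xi)$ from the frequency a planar vector remains, which is expanded
in the orthogonal frame $\mathbf t,\mathbf n$ of squared length $1+\mathfrak f'^2$. -/
theorem inner_frame_eq (f : ℝ → ℝ) (ξ : ℝ) (x ω : E3) :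
    inner ℝ x ω = ω 2 * inner ℝ (centralVec f ξ) x +
      ((ω 0 - ω 2 * ξ) + normalDefect f (ω 0) (ω 1) (ω 2) ξ * (slope f ξ / (1 + slope f ξ ^ 2))) *
        inner ℝ (tangentVec f ξ) x +
      normalDefect f (ω 0) (ω 1) (ω 2) ξ * (1 / (1 + slope f ξ ^ 2)) *
        inner ℝ (normalVec f ξ) x := by
  simp only [centralVec, tangentVec, normalVec, PiLp.inner_apply, Fin.sum_univ_three, normalDefect]
  simp
  have : 1 + slope f ξ ^ 2 ≠ 0 := by positivity
  field_simp
  ring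

/-- The three sizes $1$, $\ell$, $\delta$ match those of the polar set along $\mathbf c,\mathbf
t,\mathbf n$. The defect also enters the tangential coefficient; there $\delta\le\ell$ absorbs it.
-/
theorem abs_inner_le_of_mem_polar (hc : 1 ≤ c₀) (hδ : 0 < δ) (hδl : δ ≤ tangentialLength k δ ξ)
    {ω x : E3} {B₀ B₁ B₂ : ℝ} (h0 : |ω 2| ≤ B₀)
    (h1 : |ω 0 - ω 2 * ξ| ≤ B₁ * tangentialLength k δ ξ)
    (h2 : |normalDefect f (ω 0) (ω 1) (ω 2) ξ| ≤ B₂ * δ)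
    (hx : x ∈ (innerₗ E3).polar (plank k f c₀ δ ξ)) : |inner ℝ x ω| ≤ B₀ + 2 * B₁ + 4 * B₂ := by
  obtain ⟨p0, p1, p2, -⟩ := polar_plank_bounds (by linarith) hδ hx
  have hB0 : 0 ≤ B₀ := (abs_nonneg _).trans h0
  have hl := tangentialLength_pos (k := k) hδ ξ
  have hB1 : 0 ≤ B₁ := nonneg_of_mul_nonneg_left ((abs_nonneg _).trans h1) hl
  have hB2 : 0 ≤ B₂ := nonneg_of_mul_nonneg_left ((abs_nonneg _).trans h2) hδ
  set l := tangentialLength k δ ξ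
  set m := slope f ξ
  set g := normalDefect f (ω 0) (ω 1) (ω 2) ξ
  have q1 : l * |inner ℝ (tangentVec f ξ) x| ≤ 2 := by
    refine le_trans ?_ p1
    rw [mul_assoc]
    exact le_mul_of_one_le_left (by positivity) hc
  have q2 : δ * |inner ℝ (normalVec f ξ) x| ≤ 2 := by
    refine le_trans ?_ p2
    rw [mul_assoc]
    exact le_mul_of_one_le_left (by positivity) hc
  have hpos : 0 < 1 + m ^ 2 := by positivity
  have r1 : |m / (1 + m ^ 2)| ≤ 1 := by
    rw [abs_div, abs_of_pos hpos, div_le_one hpos, ← sq_abs]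
    nlinarith [abs_nonneg m, sq_nonneg (|m| - 1)]
  have r2 : |1 / (1 + m ^ 2)| ≤ 1 := by
    rw [abs_div, abs_of_pos hpos, div_le_one hpos, abs_one]
    nlinarith [sq_nonneg m]
  rw [inner_frame_eq f ξ x ω]
  refine (abs_add_le _ _).trans ?_
  have t1 : |ω 2 * inner ℝ (centralVec f ξ) x| ≤ B₀ := by
    rw [abs_mul]
    calc _ ≤ B₀ * 1 := by gcongr
      _ = B₀ := mul_one _
  have t2 : |((ω 0 - ω 2 * ξ) + g * (m / (1 + m ^ 2))) * inner ℝ (tangentVec f ξ) x| ≤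
      2 * B₁ + 2 * B₂ := by
    rw [abs_mul]
    calc _ ≤ (|ω 0 - ω 2 * ξ| + |g| * |m / (1 + m ^ 2)|) * |inner ℝ (tangentVec f ξ) x| := by
          gcongr
          rw [← abs_mul]; exact abs_add_le _ _
      _ ≤ (B₁ * l + B₂ * l * 1) * |inner ℝ (tangentVec f ξ) x| := by
          gcongr
          exact h2.trans (by gcongr)
      _ = (B₁ + B₂) * (l * |inner ℝ (tangentVec f ξ) x|) := by ring
      _ ≤ (B₁ + B₂) * 2 := by gcongr
      _ = _ := by ring
  have t3 : |g * (1 / (1 + m ^ 2)) * inner ℝ (normalVec f ξ) x| ≤ 2 * B₂ := by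
    rw [abs_mul, abs_mul]
    calc _ ≤ B₂ * δ * 1 * |inner ℝ (normalVec f ξ) x| := by gcongr
      _ = B₂ * (δ * |inner ℝ (normalVec f ξ) x|) := by ring
      _ ≤ B₂ * 2 := by gcongr
      _ = _ := by ring
  have := abs_add_le (ω 2 * inner ℝ (centralVec f ξ) x)
    (((ω 0 - ω 2 * ξ) + g * (m / (1 + m ^ 2))) * inner ℝ (tangentVec f ξ) x)
  linarith

theorem le_tangentialLength (hk : 2 ≤ k) (hδ : 0 < δ) (hδ1 : δ ≤ 1) (hξ : ξ ∈ Icc (0 : ℝ) 1) :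
    δ ≤ tangentialLength k δ ξ := by
  have hk' : (2 : ℝ) ≤ k := by exact_mod_cast hk
  unfold tangentialLength
  split_ifs with h
  · calc δ = δ ^ (1 : ℝ) := (Real.rpow_one δ).symm
      _ ≤ δ ^ (1 / (k : ℝ)) := by
        apply Real.rpow_le_rpow_of_exponent_ge hδ hδ1
        rw [div_le_one (by linarith)]; linarith
  · have hpos : 0 < |ξ| := lt_of_le_of_lt (by positivity) (not_le.1 h)
    have h1 : |ξ| ^ (((k : ℝ) - 2) / 2) ≤ 1 :=
      Real.rpow_le_one hpos.le (by rw [abs_of_nonneg hξ.1]; exact hξ.2) (by linarith)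
    rw [le_div_iff₀ (by positivity)]
    calc δ * |ξ| ^ (((k : ℝ) - 2) / 2) ≤ δ * 1 := by gcongr
      _ = δ ^ (1 : ℝ) := by rw [mul_one, Real.rpow_one]
      _ ≤ δ ^ (1 / 2 : ℝ) := Real.rpow_le_rpow_of_exponent_ge hδ hδ1 (by norm_num)

end Plank

end ConeKakeya

/-! ### Duality with coarse envelopes, and nesting of planks. -/

namespace ConeKakeya

open Set Pointwise

/-- The constant in the duality between frequencies and wave envelopes. -/
noncomputable def dualConst (k : ℕ) (C c₀ Γ Γ₁ B : ℝ) : ℝ :=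
  B + 2 * (B * (4 + c₀ * (Γ + (1 + C))) * Γ₁) +
    4 * (B * (1 + C * (2 + 2 * (c₀ * (Γ + (1 + C)))) ^ (k - 2) *
      ((3 + c₀ * (Γ + (1 + C))) ^ 2 + (3 + c₀ * (Γ + (1 + C))))))

theorem one_le_dualConst {k : ℕ} {C c₀ Γ Γ₁ B : ℝ} (hC : 1 ≤ C) (hc : 1 ≤ c₀) (hΓ : 1 ≤ Γ)
    (hΓ₁ : 1 ≤ Γ₁) (hB : 1 ≤ B) : 1 ≤ dualConst k C c₀ Γ Γ₁ B := by
  unfold dualConst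
  have h1 : 0 ≤ 2 * (B * (4 + c₀ * (Γ + (1 + C))) * Γ₁) := by positivity
  have h2 : 0 ≤ 4 * (B * (1 + C * (2 + 2 * (c₀ * (Γ + (1 + C)))) ^ (k - 2) *
      ((3 + c₀ * (Γ + (1 + C))) ^ 2 + (3 + c₀ * (Γ + (1 + C)))))) := by positivity
  linarith

-- Every plank inside `τ` has its base point within $O(\sigma)$ of `ξ`. Over such a distance the
-- defect changes by $O(\kappa(\sigma^2|h|+\sigma|w_1-h\xi|))$ with $\kappa=K^{k-2}$, which the
-- three hypotheses on the frequency bound by $O(r^{-2})$. So these bounds persist at all those base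
-- points, and duality holds on each polar set.
set_option maxHeartbeats 1000000 in
theorem IsRegular.abs_inner_envelope_le {k : ℕ} {C : ℝ} {f q : ℝ → ℝ} (hf : IsRegular k C f q)
    (hk : 2 ≤ k) (hC : 1 ≤ C) {c₀ r K σ s T ξ Γ Γ₁ B : ℝ} (hc : 1 ≤ c₀) (hr : 1 ≤ r) (hK : 0 < K)
    (hK1 : K ≤ 1) (hσ : 0 < σ) (hσK : σ ≤ 2 * K) (hs : r⁻¹ ≤ s) (hs1 : s ≤ 1)
    (hsσ : s ^ 2 = K ^ (k - 2) * σ ^ 2) (hT : T ∈ Icc (0 : ℝ) 1) (hTK : T ≤ 2 * K)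
    (hξ : ξ ∈ Icc (0 : ℝ) 1) (hξK : ξ ≤ 2 * K) (hξT : |ξ - T| ≤ 3 * σ) (hΓ : 1 ≤ Γ)
    (hlT : tangentialLength k (s ^ 2) T ≤ Γ * σ)
    (hl : ∀ x ∈ Icc (0 : ℝ) 1, x ≤ (2 + 2 * (c₀ * (Γ + (1 + C)))) * K →
      r⁻¹ / √(K ^ (k - 2)) ≤ Γ₁ * tangentialLength k (r⁻¹ ^ 2) x) {ω : E3}
    (h0 : K ^ (k - 2) * σ ^ 2 * |ω 2| ≤ B * r⁻¹ ^ 2)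
    (h1 : K ^ (k - 2) * σ * |ω 0 - ω 2 * ξ| ≤ B * r⁻¹ ^ 2)
    (h2 : |normalDefect f (ω 0) (ω 1) (ω 2) ξ| ≤ B * r⁻¹ ^ 2)
    {R : Finset ℝ} (hR : ∀ x ∈ R, x ∈ Icc (0 : ℝ) 1) :
    ∀ x ∈ envelope k f c₀ (r⁻¹ ^ 2) R (plank k f c₀ (s ^ 2) T),
      |inner ℝ x ω| ≤ dualConst k C c₀ Γ Γ₁ B := by
  have hρ : 0 < r⁻¹ := by positivity
  have hρ1 : r⁻¹ ≤ 1 := inv_le_one_of_one_le₀ hr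
  have hs0 : 0 < s := hρ.trans_le hs
  set ρ := r⁻¹
  set κ := K ^ (k - 2) with hκ
  have hκ0 : 0 < κ := by positivity
  have hκ1 : κ ≤ 1 := pow_le_one₀ hK.le hK1
  have hδ0 : 0 < ρ ^ 2 := by positivity
  have hδ1 : ρ ^ 2 ≤ 1 := pow_le_one₀ hρ.le hρ1
  have hB0 : 0 ≤ B := nonneg_of_mul_nonneg_left ((abs_nonneg _).trans h2) hδ0
  have hsqrt : √κ * √κ = κ := Real.mul_self_sqrt hκ0.le
  have hsqrt0 : 0 < √κ := Real.sqrt_pos.2 hκ0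
  have hsσ' : s = √κ * σ := by
    have : s ^ 2 = (√κ * σ) ^ 2 := by rw [hsσ, mul_pow, pow_two √κ, hsqrt]
    exact (pow_left_inj₀ hs0.le (by positivity) two_ne_zero).1 this
  have hs2σ : s ^ 2 ≤ σ := by
    have h3 : s ^ 2 = (√κ * s) * σ := by rw [pow_two]; nth_rewrite 2 [hsσ']; ring
    have h4 : √κ ≤ 1 := Real.sqrt_le_one.2 hκ1
    rw [h3]
    have : √κ * s ≤ 1 := mul_le_one₀ h4 hs0.le hs1
    nlinarith
  set A := c₀ * (Γ + (1 + C)) with hA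
  have hA0 : 0 ≤ A := by positivity
  apply abs_inner_le_of_mem_envelope
  intro ξ' hξ' x hx
  classical
  obtain ⟨hξ'R, hsub⟩ := Finset.mem_filter.1 hξ'
  have hξ'1 := hR ξ' hξ'R
  have hd1 : |ξ' - T| ≤ A * σ := by
    refine (hf.abs_sub_le_of_plank_subset (by linarith) hδ0 (by positivity) hT hsub).trans ?_
    calc _ ≤ c₀ * (Γ * σ + (1 + C) * σ) := by gcongr
      _ = A * σ := by rw [hA]; ring
  have hd2 : |ξ' - ξ| ≤ (3 + A) * σ := by
    have := _root_.abs_sub_le ξ' T ξ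
    rw [abs_sub_comm T ξ] at this
    linarith
  have hξ'K : ξ' ≤ (2 + 2 * A) * K := by
    have := (_root_.abs_le.1 hd1).2
    have : A * σ ≤ A * (2 * K) := by gcongr
    linarith
  have hl' := hl ξ' hξ'1 hξ'K
  set l := tangentialLength k (ρ ^ 2) ξ'
  have hh : |ω 2| ≤ B := by
    have h3 : s ^ 2 * |ω 2| ≤ B * s ^ 2 := by
      rw [hsσ]
      refine h0.trans ?_
      rw [← hsσ]; gcongr
    have : 0 < s ^ 2 := by positivity
    nlinarith
  -- The right side equals $s\rho$. Dividing the bound on the displacement by $\kappa\sigma$ thus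
  -- leaves at most a multiple of the finest length $\rho/\sqrt\kappa$.
  have hδκ : ρ ^ 2 ≤ κ * σ * (ρ / √κ) := by
    have : κ * σ * (ρ / √κ) = s * ρ := by
      rw [hsσ']; nth_rewrite 1 [← hsqrt]; field_simp
    rw [this]; nlinarith
  have hb' : |ω 0 - ω 2 * ξ'| ≤ B * (4 + A) * Γ₁ * l := by
    have h3 : κ * σ * |ω 0 - ω 2 * ξ'| ≤ B * (4 + A) * ρ ^ 2 := by
      have e : ω 0 - ω 2 * ξ' = (ω 0 - ω 2 * ξ) - ω 2 * (ξ' - ξ) := by ring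
      calc κ * σ * |ω 0 - ω 2 * ξ'| ≤ κ * σ * (|ω 0 - ω 2 * ξ| + |ω 2| * ((3 + A) * σ)) := by
            gcongr
            rw [e]
            refine (abs_sub _ _).trans ?_
            rw [abs_mul]
            gcongr
        _ = κ * σ * |ω 0 - ω 2 * ξ| + (3 + A) * (κ * σ ^ 2 * |ω 2|) := by ring
        _ ≤ B * ρ ^ 2 + (3 + A) * (B * ρ ^ 2) := by gcongr
        _ = _ := by ring
    have h4 : κ * σ * |ω 0 - ω 2 * ξ'| ≤ κ * σ * (B * (4 + A) * Γ₁ * l) := by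
      calc _ ≤ B * (4 + A) * ρ ^ 2 := h3
        _ ≤ B * (4 + A) * (κ * σ * (ρ / √κ)) := by gcongr
        _ ≤ B * (4 + A) * (κ * σ * (Γ₁ * l)) := by gcongr
        _ = _ := by ring
    exact le_of_mul_le_mul_left h4 (by positivity)
  have hg' : |normalDefect f (ω 0) (ω 1) (ω 2) ξ'| ≤
      B * (1 + C * (2 + 2 * A) ^ (k - 2) * ((3 + A) ^ 2 + (3 + A))) * ρ ^ 2 := by
    have h3 := hf.normalDefect_sub_le (by linarith) hξ hξ'1
      (hξK.trans (by nlinarith : 2 * K ≤ (2 + 2 * A) * K)) hξ'K (ω 0) (ω 1) (ω 2)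
    rw [mul_pow, ← hκ] at h3
    have h4 : |ω 2| * (ξ' - ξ) ^ 2 + |ξ' - ξ| * |ω 0 - ω 2 * ξ| ≤
        |ω 2| * ((3 + A) * σ) ^ 2 + (3 + A) * σ * |ω 0 - ω 2 * ξ| := by
      rw [← sq_abs (ξ' - ξ)]
      gcongr
    set g := normalDefect f (ω 0) (ω 1) (ω 2) ξ
    set g' := normalDefect f (ω 0) (ω 1) (ω 2) ξ'
    set D := (2 + 2 * A) ^ (k - 2)
    have hD : 0 ≤ D := by positivity
    calc |g'| = |g + (g' - g)| := by congr 1; ring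
      _ ≤ |g| + |g' - g| := abs_add_le _ _
      _ ≤ B * ρ ^ 2 + C * (D * κ) *
          (|ω 2| * ((3 + A) * σ) ^ 2 + (3 + A) * σ * |ω 0 - ω 2 * ξ|) := by
          refine add_le_add h2 (h3.trans ?_)
          gcongr
      _ = B * ρ ^ 2 + C * D * ((3 + A) ^ 2 * (κ * σ ^ 2 * |ω 2|) +
          (3 + A) * (κ * σ * |ω 0 - ω 2 * ξ|)) := by ring
      _ ≤ B * ρ ^ 2 + C * D * ((3 + A) ^ 2 * (B * ρ ^ 2) + (3 + A) * (B * ρ ^ 2)) := by gcongr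
      _ = _ := by ring
  have := abs_inner_le_of_mem_polar (f := f) hc hδ0 (le_tangentialLength hk hδ0 hδ1 hξ'1)
    hh hb' hg' hx
  unfold dualConst
  exact this

set_option maxHeartbeats 1000000 in
/-- A plank is contained in every coarser plank with a nearby base point. -/
theorem IsRegular.plank_subset_plank {k : ℕ} {C : ℝ} {f q : ℝ → ℝ} (hf : IsRegular k C f q)
    (hC : 1 ≤ C) {c₀ ρ K σ s T ξ Γ ε : ℝ} (hK : 0 < K) (hΓ : 1 ≤ Γ) (hCΓ : C * 2 ^ (k - 2) ≤ Γ)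
    (hc : 27 * Γ * (1 + C ^ 2) ≤ c₀) (hρ : 0 < ρ) (hσ : 0 < σ) (hs0 : 0 < s) (hs2σ : s ^ 2 ≤ σ)
    (hsσ : s ^ 2 = K ^ (k - 2) * σ ^ 2) (hρs : ρ ≤ ε * s) (hε : ε * (9 * Γ ^ 2 * (1 + C ^ 2)) ≤ 1)
    (hT : T ∈ Icc (0 : ℝ) 1) (hTK : T ≤ 2 * K)
    (hξ : ξ ∈ Icc (0 : ℝ) 1) (hξK : ξ ≤ 2 * K) (hξT : |ξ - T| ≤ 3 * σ)
    (hlξ : tangentialLength k (ρ ^ 2) ξ ≤ Γ * (ε * σ))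
    (hlT : σ ≤ Γ * tangentialLength k (s ^ 2) T) :
    plank k f c₀ (ρ ^ 2) ξ ⊆ plank k f c₀ (s ^ 2) T := by
  intro p hp
  obtain ⟨a, b, c₁, c₂, h1, h2, h3, h4, h5, e0, e1, e2⟩ := mem_plank_iff.1 hp
  set m := slope f T with hm
  set n := slope f ξ with hn
  set κ := K ^ (k - 2) with hκ
  have hκ0 : 0 < κ := by positivity
  have hc0 : 0 < c₀ := lt_of_lt_of_le (by positivity) hc
  have hε0 : 0 < ε := pos_of_mul_pos_left (hρ.trans_le hρs) hs0.le
  have hΓ2 : Γ ≤ Γ ^ 2 := by nlinarith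
  have hD : 1 ≤ 1 + C ^ 2 := by nlinarith
  have hε1 : 9 * (ε * Γ ^ 2) ≤ 1 := by
    have : ε * Γ ^ 2 * 1 ≤ ε * Γ ^ 2 * (1 + C ^ 2) := by gcongr
    linarith
  have hε2 : 9 * ε ≤ 1 := by
    have : ε * 1 ≤ ε * Γ ^ 2 := mul_le_mul_of_nonneg_left (by linarith) hε0.le
    linarith
  have hm0 : 0 ≤ m := hf.slope_nonneg T hT
  have hn0 : 0 ≤ n := hf.slope_nonneg ξ hξ
  have hmC : m ≤ C := hf.slope_le T hT
  have hnC : n ≤ C := hf.slope_le ξ hξ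
  have ha : |a| ≤ 1 := by rw [abs_of_pos (by linarith)]; exact h2
  have hL : C * (2 * K) ^ (k - 2) ≤ Γ * κ := by
    rw [mul_pow, ← mul_assoc]; gcongr
  have hmn : |n - m| ≤ Γ * κ * (3 * σ) := by
    refine (hf.slope_sub_le (by linarith) hT hξ hTK hξK).trans ?_
    gcongr
  have htay : |f ξ - f T - m * (ξ - T)| ≤ 9 * Γ * s ^ 2 := by
    refine (hf.taylor_le (by linarith) hT hξ hTK hξK).trans ?_
    rw [← sq_abs (ξ - T)]
    calc _ ≤ Γ * κ * (3 * σ) ^ 2 := by gcongr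
      _ = 9 * Γ * s ^ 2 := by rw [hsσ]; ring
  have hfd : |f ξ - f T| ≤ C * (3 * σ) :=
    (hf.abs_sub_le hT hξ).trans (by gcongr)
  have hb : |b| ≤ c₀ * (Γ * (ε * σ)) := h3.trans (by gcongr)
  have hρ2 : ρ ^ 2 ≤ ε ^ 2 * s ^ 2 := by rw [← mul_pow]; gcongr
  have hc₁ : |c₁| ≤ c₀ * (ε ^ 2 * s ^ 2) := h4.trans (by gcongr)
  have hc₂ : |c₂| ≤ c₀ * s ^ 2 := by
    refine h5.trans ?_
    have : ε ^ 2 ≤ 1 := pow_le_one₀ hε0.le (by linarith)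
    have : ε ^ 2 * s ^ 2 ≤ 1 * s ^ 2 := by gcongr
    exact mul_le_mul_of_nonneg_left (by linarith) hc0.le
  -- `a` and `c₂` are kept. The planar remainder $(X,Y)$ of `p` after removing $a\,\mathbf
  -- c(T)+c_2\mathbf n_3$ is decomposed in the frame at `T`.
  set X := a * (ξ - T) + b - c₁ * n with hX
  set Y := a * (f ξ - f T) + b * n + c₁ with hY
  have hpos : 1 ≤ 1 + m ^ 2 := by nlinarith
  have hdiv : ∀ z : ℝ, |z / (1 + m ^ 2)| ≤ |z| := by
    intro z
    rw [abs_div, abs_of_pos (by linarith : 0 < 1 + m ^ 2)]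
    exact div_le_self (abs_nonneg z) hpos
  have hmn1 : |1 + m * n| ≤ 1 + C ^ 2 := by
    rw [abs_of_nonneg (by positivity)]
    nlinarith
  refine mem_plank_iff.2 ⟨a, (X + m * Y) / (1 + m ^ 2), (Y - m * X) / (1 + m ^ 2), c₂, h1, h2,
    (hdiv _).trans ?_, (hdiv _).trans ?_, hc₂, ?_, ?_, e2⟩
  · have e : X + m * Y = a * ((ξ - T) + m * (f ξ - f T)) + b * (1 + m * n) + c₁ * (m - n) := by
      rw [hX, hY]; ring
    have hmn2 : |m - n| ≤ C := by rw [_root_.abs_le]; constructor <;> linarith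
    have t1 : |a * ((ξ - T) + m * (f ξ - f T))| ≤ 3 * (1 + C ^ 2) * σ := by
      rw [abs_mul]
      calc _ ≤ 1 * (3 * σ + C * (C * (3 * σ))) := by
            gcongr
            refine (abs_add_le _ _).trans ?_
            rw [abs_mul, abs_of_nonneg hm0]
            gcongr
        _ = _ := by ring
    have t2 : |b * (1 + m * n)| ≤ c₀ * (Γ * (ε * σ)) * (1 + C ^ 2) := by
      rw [abs_mul]; gcongr
    have t3 : |c₁ * (m - n)| ≤ c₀ * (ε ^ 2 * s ^ 2) * C := by
      rw [abs_mul]; gcongr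
    have t3' : ε ^ 2 * s ^ 2 * C ≤ Γ * (ε * σ) * (1 + C ^ 2) := by
      calc ε ^ 2 * s ^ 2 * C ≤ (1 * ε) * σ * (1 + C ^ 2) := by
            have hC1 : C ≤ 1 + C ^ 2 := by nlinarith [sq_nonneg (C - 1)]
            have hεε : ε ^ 2 ≤ 1 * ε := by
              rw [pow_two]; exact mul_le_mul_of_nonneg_right (by linarith) hε0.le
            gcongr
        _ ≤ _ := by
            rw [mul_assoc 1 ε σ]; gcongr
    -- The displacement of the centre does not involve `c₀` and uses at most $c_0/9$, by the size of
    -- `c₀`. The extent of the small plank is proportional to `c₀` but gains a factor `ε`, and uses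
    -- at most $2c_0/9$.
    have hfin : Γ * (3 * (1 + C ^ 2) + 2 * (c₀ * Γ * ε * (1 + C ^ 2))) ≤ c₀ := by
      have h6 : c₀ * (ε * (9 * Γ ^ 2 * (1 + C ^ 2))) ≤ c₀ * 1 := by gcongr
      have e6 : Γ * (3 * (1 + C ^ 2) + 2 * (c₀ * Γ * ε * (1 + C ^ 2))) =
          (27 * Γ * (1 + C ^ 2)) / 9 + 2 / 9 * (c₀ * (ε * (9 * Γ ^ 2 * (1 + C ^ 2)))) := by ring
      rw [e6]
      linarith
    have hmain : |X + m * Y| ≤ (3 * (1 + C ^ 2) + 2 * (c₀ * Γ * ε * (1 + C ^ 2))) * σ := by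
      rw [e]
      refine (abs_add_three _ _ _).trans ?_
      have := mul_le_mul_of_nonneg_left t3' hc0.le
      linarith
    calc |X + m * Y| ≤ (3 * (1 + C ^ 2) + 2 * (c₀ * Γ * ε * (1 + C ^ 2))) * σ := hmain
      _ ≤ (3 * (1 + C ^ 2) + 2 * (c₀ * Γ * ε * (1 + C ^ 2))) *
          (Γ * tangentialLength k (s ^ 2) T) := by gcongr
      _ = Γ * (3 * (1 + C ^ 2) + 2 * (c₀ * Γ * ε * (1 + C ^ 2))) *
          tangentialLength k (s ^ 2) T := by ring
      _ ≤ _ := by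
          have := (tangentialLength_pos (k := k) (δ := s ^ 2) (by positivity) T).le
          gcongr
  · have e : Y - m * X = a * (f ξ - f T - m * (ξ - T)) + b * (n - m) + c₁ * (1 + m * n) := by
      rw [hX, hY]; ring
    rw [e]
    refine (abs_add_three _ _ _).trans ?_
    rw [abs_mul, abs_mul, abs_mul]
    calc _ ≤ 1 * (9 * Γ * s ^ 2) + c₀ * (Γ * (ε * σ)) * (Γ * κ * (3 * σ)) +
          c₀ * (ε ^ 2 * s ^ 2) * (1 + C ^ 2) := by gcongr
      _ = (9 * Γ + c₀ * (3 * (ε * Γ ^ 2)) + c₀ * (ε * (ε * (1 + C ^ 2)))) * s ^ 2 := by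
          rw [hsσ]; ring
      _ ≤ c₀ * s ^ 2 := by
          gcongr
          have h6 : ε * (1 + C ^ 2) ≤ 1 := by
            have : ε * (1 * (1 + C ^ 2)) ≤ ε * (9 * Γ ^ 2 * (1 + C ^ 2)) := by
              gcongr; linarith
            linarith
          have h7 : c₀ * (ε * (ε * (1 + C ^ 2))) ≤ c₀ * (ε * 1) := by gcongr
          have h8 : 27 * Γ * 1 ≤ 27 * Γ * (1 + C ^ 2) := by gcongr
          have h9 : c₀ * (9 * (ε * Γ ^ 2)) ≤ c₀ * 1 := by gcongr
          have h10 : c₀ * (9 * ε) ≤ c₀ * 1 := by gcongr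
          linarith
  · rw [e0]; field_simp; rw [hX]; ring
  · rw [e1]; field_simp; rw [hY]; ring

theorem card_floor_image_le (P : Finset ℝ) {σ : ℝ} {n : ℕ} (hσ : 0 < σ)
    (hP : ∀ x ∈ P, ∀ y ∈ P, |x - y| ≤ n * σ) : (P.image fun x => ⌊x / σ⌋).card ≤ n + 1 := by
  rcases P.eq_empty_or_nonempty with rfl | hne
  · simp
  obtain ⟨x₀, hx₀, hmin⟩ := P.exists_min_image id hne
  have hsub : (P.image fun x => ⌊x / σ⌋) ⊆ Finset.Icc ⌊x₀ / σ⌋ (⌊x₀ / σ⌋ + n) := by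
    intro j hj
    obtain ⟨x, hx, rfl⟩ := Finset.mem_image.1 hj
    rw [Finset.mem_Icc]
    have h1 : x₀ ≤ x := hmin x hx
    constructor
    · exact Int.floor_le_floor (by gcongr)
    · have h2 := (abs_le.1 (hP x hx x₀ hx₀)).2
      have h3 : x / σ ≤ x₀ / σ + n := by
        rw [div_add' _ _ _ hσ.ne']; gcongr; linarith
      rw [← Int.floor_add_natCast]
      exact Int.floor_le_floor h3
  refine (Finset.card_le_card hsub).trans ?_
  simp
  omega

/-- Counting separated points in a short interval. -/
theorem card_le_of_separated (P : Finset ℝ) {σ : ℝ} {n : ℕ} (hσ : 0 < σ)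
    (hP : ∀ x ∈ P, ∀ y ∈ P, |x - y| ≤ n * σ) (hsep : ∀ x ∈ P, ∀ y ∈ P, x ≠ y → σ ≤ |x - y|) :
    P.card ≤ n + 1 := by
  rw [← Finset.card_image_of_injOn (f := fun x => ⌊x / σ⌋)]
  · exact card_floor_image_le P hσ hP
  · intro x hx y hy hxy
    by_contra hne
    have h1 := Int.abs_sub_lt_one_of_floor_eq_floor hxy
    rw [← sub_div, abs_div, abs_of_pos hσ, div_lt_one hσ] at h1
    exact absurd (hsep x hx y hy hne) (not_le.2 h1)

end ConeKakeya

/-! ### Organizing the planks of one block. -/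

namespace ConeKakeya

open Set Pointwise

theorem inv_mem_scales {r : ℝ} (hr : 1 ≤ r) : r⁻¹ ∈ scales r :=
  ⟨inv_le_one_of_one_le₀ hr, 0, by simp⟩

theorem inv_le_of_mem_scales {r s : ℝ} (hr : 1 ≤ r) (hs : s ∈ scales r) : r⁻¹ ≤ s := by
  obtain ⟨-, j, rfl⟩ := hs
  rw [inv_eq_one_div]
  gcongr
  exact one_le_pow₀ (by norm_num)

theorem exists_scale_near {r x : ℝ} (hr : 1 ≤ r) (hx : r⁻¹ ≤ x) (hx1 : x ≤ 1) :
    ∃ s ∈ scales r, s ≤ x ∧ x < 2 * s := by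
  have hr0 : 0 < r := by linarith
  have h1 : 1 ≤ x * r := by rwa [inv_le_iff_one_le_mul₀ hr0] at hx
  obtain ⟨j, hj1, hj2⟩ := exists_nat_pow_near h1 (by norm_num : (1 : ℝ) < 2)
  have h2 : 2 ^ j / r ≤ x := (div_le_iff₀ hr0).2 hj1
  refine ⟨2 ^ j / r, ⟨h2.trans hx1, j, rfl⟩, h2, ?_⟩
  rw [← mul_div_assoc, lt_div_iff₀ hr0, ← pow_succ']
  exact hj2

/-- Constant in the bounds for the position of a frequency relative to the planks containing it. -/
noncomputable def frameConst (C c₀ Γ : ℝ) : ℝ :=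
  1 + 2 * c₀ * (Γ + C + 1) + 16 * Γ ^ 3 * c₀ * (1 + C) ^ 2

theorem frameConst_bounds {C c₀ Γ : ℝ} (hC : 1 ≤ C) (hc : 1 ≤ c₀) (hΓ : 1 ≤ Γ) :
    1 ≤ frameConst C c₀ Γ ∧ 1 + 2 * c₀ ≤ frameConst C c₀ Γ ∧
    2 * c₀ * (Γ + C + 1) ≤ frameConst C c₀ Γ ∧ 2 * c₀ * (1 + C) ^ 2 ≤ frameConst C c₀ Γ ∧
    16 * Γ ^ 3 * c₀ * (1 + C) ^ 2 ≤ frameConst C c₀ Γ ∧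
    8 * Γ * c₀ * (1 + C) ^ 2 ≤ frameConst C c₀ Γ := by
  unfold frameConst
  have h1 : 0 ≤ 2 * c₀ * (Γ + C + 1) := by positivity
  have h2 : 0 ≤ 16 * Γ ^ 3 * c₀ * (1 + C) ^ 2 := by positivity
  have h3 : 2 * c₀ * 1 ≤ 2 * c₀ * (Γ + C + 1) := by gcongr; linarith
  have h4 : 16 * Γ * c₀ * (1 + C) ^ 2 ≤ 16 * Γ ^ 3 * c₀ * (1 + C) ^ 2 := by
    gcongr; exact le_self_pow₀ hΓ (by norm_num)
  have h5 : 16 * 1 * c₀ * (1 + C) ^ 2 ≤ 16 * Γ * c₀ * (1 + C) ^ 2 := by gcongr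
  have h6 : 0 ≤ c₀ * (1 + C) ^ 2 := by positivity
  have h7 : 0 ≤ Γ * c₀ * (1 + C) ^ 2 := by positivity
  refine ⟨?_, ?_, ?_, ?_, ?_, ?_⟩ <;> linarith

section Block

variable {k : ℕ} {C : ℝ} {f q : ℝ → ℝ} {c₀ r K Γ Γ₁ : ℝ}

/-- At the finest scale the frequencies in the difference set of a plank are dual to its wave
envelope. -/
theorem IsRegular.abs_inner_envelope_le_finest (hf : IsRegular k C f q)
    (hk : 2 ≤ k) (hC : 1 ≤ C) (hc : 1 ≤ c₀) (hr : 1 ≤ r) (hK : 0 < K)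
    (hK1 : K ≤ 1) (hKr : r⁻¹ / √(K ^ (k - 2)) ≤ 2 * K) (hΓ : 1 ≤ Γ)
    (hl : ∀ x ∈ Icc (0 : ℝ) 1, x ≤ (2 + 2 * (c₀ * (Γ + (1 + C)))) * K →
      r⁻¹ / √(K ^ (k - 2)) ≤ Γ₁ * tangentialLength k (r⁻¹ ^ 2) x) {ξ : ℝ}
    (hξ : ξ ∈ Icc (0 : ℝ) 1) (hξK : ξ ≤ 2 * K)
    (hlξ : tangentialLength k (r⁻¹ ^ 2) ξ ≤ Γ * (r⁻¹ / √(K ^ (k - 2)))) {ω : E3}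
    (hω : ω ∈ plank k f c₀ (r⁻¹ ^ 2) ξ - plank k f c₀ (r⁻¹ ^ 2) ξ)
    {R : Finset ℝ} (hR : ∀ x ∈ R, x ∈ Icc (0 : ℝ) 1) :
    ∀ x ∈ envelope k f c₀ (r⁻¹ ^ 2) R (plank k f c₀ (r⁻¹ ^ 2) ξ),
      |inner ℝ x ω| ≤ dualConst k C c₀ Γ Γ₁ (frameConst C c₀ Γ) := by
  have hr0 : 0 < r := by linarith
  have hρ0 : 0 < r⁻¹ := by positivity
  have hρ1 : r⁻¹ ≤ 1 := inv_le_one_of_one_le₀ hr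
  have hδ0 : 0 < r⁻¹ ^ 2 := by positivity
  have hδ1 : r⁻¹ ^ 2 ≤ 1 := pow_le_one₀ hρ0.le hρ1
  have hκ0 : 0 < K ^ (k - 2) := by positivity
  have hκ1 : K ^ (k - 2) ≤ 1 := pow_le_one₀ hK.le hK1
  have hsκ : 0 < √(K ^ (k - 2)) := Real.sqrt_pos.2 hκ0
  obtain ⟨B1, B2, B3, B4, -, -⟩ := frameConst_bounds hC hc hΓ
  obtain ⟨a1, a2, a3⟩ := hf.sub_plank_bounds hC (by linarith) hδ0 hδ1 hξ hω
  set σ := r⁻¹ / √(K ^ (k - 2)) with hσ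
  have hσ0 : 0 < σ := by positivity
  have hσ2 : r⁻¹ ^ 2 = K ^ (k - 2) * σ ^ 2 := by
    rw [hσ, div_pow, Real.sq_sqrt hκ0.le]; field_simp
  have hρσ : r⁻¹ ≤ σ := by
    rw [hσ, le_div_iff₀ hsκ]
    exact mul_le_of_le_one_right hρ0.le (Real.sqrt_le_one.2 hκ1)
  have hδσ : r⁻¹ ^ 2 ≤ σ := by nlinarith
  refine hf.abs_inner_envelope_le hk hC hc hr hK hK1 hσ0 hKr le_rfl hρ1 hσ2 hξ hξK hξ hξK
    (by simp; positivity) hΓ hlξ hl ?_ ?_ ?_ hR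
  · rw [← hσ2, mul_comm]
    gcongr
    linarith
  · calc K ^ (k - 2) * σ * |ω 0 - ω 2 * ξ| ≤
        K ^ (k - 2) * σ * (2 * c₀ * (Γ * σ + (C + 1) * σ)) := by
          gcongr
          exact a2.trans (by gcongr)
      _ = 2 * c₀ * (Γ + C + 1) * r⁻¹ ^ 2 := by rw [hσ2]; ring
      _ ≤ _ := by gcongr
  · exact a3.trans (by gcongr)

theorem isOrganized_of_eq_empty {R : ℝ → Finset ℝ} (hr : 1 ≤ r) (m : ℝ → ℝ → ℝ) (M : ℕ) (C' : ℝ) :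
    IsOrganized k f c₀ r R ∅ m M C' :=
  fun _ => ⟨r⁻¹, inv_mem_scales hr, ∅, by simp, by simp, by simp, by simp⟩

theorem IsOrganized.mono {R : ℝ → Finset ℝ} {A : Finset ℝ} {m : ℝ → ℝ → ℝ} {M M' : ℕ} {C' : ℝ}
    (h : IsOrganized k f c₀ r R A m M C') (hM : M ≤ M') : IsOrganized k f c₀ r R A m M' C' := by
  intro ω
  obtain ⟨s, hs, S, h1, h2, h3⟩ := h ω
  exact ⟨s, hs, S, h1, h2.trans hM, h3⟩

/-- A bounded number of planks is organized at the finest scale. -/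
theorem IsRegular.isOrganized_finest (hf : IsRegular k C f q)
    (hk : 2 ≤ k) (hC : 1 ≤ C) (hc : 1 ≤ c₀) (hr : 1 ≤ r) (hK : 0 < K)
    (hK1 : K ≤ 1) (hKr : r⁻¹ / √(K ^ (k - 2)) ≤ 2 * K) (hΓ : 1 ≤ Γ)
    (hl : ∀ x ∈ Icc (0 : ℝ) 1, x ≤ (2 + 2 * (c₀ * (Γ + (1 + C)))) * K →
      r⁻¹ / √(K ^ (k - 2)) ≤ Γ₁ * tangentialLength k (r⁻¹ ^ 2) x)
    {R : ℝ → Finset ℝ} (hR : ∀ x ∈ R (r⁻¹ ^ 2), x ∈ Icc (0 : ℝ) 1) {A : Finset ℝ}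
    (hA : A ⊆ R (r⁻¹ ^ 2)) (hAK : ∀ ξ ∈ A, ξ ≤ 2 * K)
    (hlA : ∀ ξ ∈ A, tangentialLength k (r⁻¹ ^ 2) ξ ≤ Γ * (r⁻¹ / √(K ^ (k - 2)))) :
    IsOrganized k f c₀ r R A (fun _ ξ => ξ) A.card
      (dualConst k C c₀ Γ Γ₁ (frameConst C c₀ Γ)) := by
  classical
  intro ω
  refine ⟨r⁻¹, inv_mem_scales hr,
    A.filter (fun ξ => ω ∈ plank k f c₀ (r⁻¹ ^ 2) ξ - plank k f c₀ (r⁻¹ ^ 2) ξ),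
    (Finset.filter_subset _ _).trans hA, Finset.card_filter_le _ _, ?_, ?_⟩
  · intro ξ hξ
    obtain ⟨hξA, hξ⟩ := Finset.mem_filter.1 hξ
    exact hf.abs_inner_envelope_le_finest hk hC hc hr hK hK1 hKr hΓ hl (hR ξ (hA hξA)) (hAK ξ hξA)
      (hlA ξ hξA) hξ hR
  · exact fun ξ hξ hω => ⟨Finset.mem_filter.2 ⟨hξ, hω⟩, subset_rfl⟩

set_option maxHeartbeats 1000000 in
/-- The planks with base point in an interval on which the second derivative is almost constant
are organized, with constants independent of their number. -/
theorem IsRegular.exists_isOrganized (hf : IsRegular k C f q)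
    (hk : 2 ≤ k) (hC : 1 ≤ C) (hr : 1 ≤ r) (hK : 0 < K)
    (hK1 : 2 * K ≤ 1) (hKr : r⁻¹ / √(K ^ (k - 2)) ≤ 2 * K) (hΓ : 1 ≤ Γ)
    (hCΓ : C * 2 ^ (k - 2) ≤ Γ) (hc : 27 * Γ * (1 + C ^ 2) ≤ c₀)
    (hl : ∀ x ∈ Icc (0 : ℝ) 1, x ≤ (2 + 2 * (c₀ * (Γ + (1 + C)))) * K →
      r⁻¹ / √(K ^ (k - 2)) ≤ Γ₁ * tangentialLength k (r⁻¹ ^ 2) x)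
    {R : ℝ → Finset ℝ} (hR : ∀ x ∈ R (r⁻¹ ^ 2), x ∈ Icc (0 : ℝ) 1) {A : Finset ℝ}
    (hA : A ⊆ R (r⁻¹ ^ 2)) {α : ℝ} (hα : 0 ≤ α) (hαK : α ≤ 2 * K)
    (hAK : ∀ ξ ∈ A, ξ ∈ Ioc α (2 * K))
    (hlA : ∀ ξ ∈ A, tangentialLength k (r⁻¹ ^ 2) ξ ≤ Γ * (r⁻¹ / √(K ^ (k - 2))))
    (hq : ∀ t ∈ Ioo α (2 * K), Γ⁻¹ * K ^ (k - 2) ≤ q t ∧ q t ≤ Γ * K ^ (k - 2))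
    (hcov : ∀ s ∈ scales r, s ≤ (2 * K - α) * √(K ^ (k - 2)) → ∀ x ∈ Ioc α (2 * K),
      ∃ T ∈ R (s ^ 2), T ∈ Icc (0 : ℝ) 1 ∧ T ≤ 2 * K ∧ |x - T| ≤ 2 * (s / √(K ^ (k - 2))) ∧
        tangentialLength k (s ^ 2) T ≤ Γ * (s / √(K ^ (k - 2))) ∧
        s / √(K ^ (k - 2)) ≤ Γ * tangentialLength k (s ^ 2) T) {M : ℕ}
    (hcount : ∀ P ⊆ A, (∀ x ∈ P, ∀ y ∈ P,
      |x - y| ≤ 18 * Γ ^ 2 * (1 + C ^ 2) * (r⁻¹ / √(K ^ (k - 2)))) → P.card ≤ M) :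
    ∃ m, IsOrganized k f c₀ r R A m (2 * M + 6)
      (dualConst k C c₀ Γ Γ₁ (frameConst C c₀ Γ)) := by
  classical
  have hr0 : 0 < r := by linarith
  have hρ0 : 0 < r⁻¹ := by positivity
  have hρ1 : r⁻¹ ≤ 1 := inv_le_one_of_one_le₀ hr
  have hδ0 : 0 < r⁻¹ ^ 2 := by positivity
  have hδ1 : r⁻¹ ^ 2 ≤ 1 := pow_le_one₀ hρ0.le hρ1
  have hK1' : K ≤ 1 := by linarith
  have hc1 : 1 ≤ c₀ := by nlinarith [mul_nonneg (by linarith : 0 ≤ Γ) (sq_nonneg C)]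
  set κ := K ^ (k - 2) with hκ
  have hκ0 : 0 < κ := by positivity
  have hκ1 : κ ≤ 1 := pow_le_one₀ hK.le hK1'
  have hsκ : 0 < √κ := Real.sqrt_pos.2 hκ0
  have hsκ1 : √κ ≤ 1 := Real.sqrt_le_one.2 hκ1
  have hκκ : √κ * √κ = κ := Real.mul_self_sqrt hκ0.le
  set Λ := 18 * Γ ^ 2 * (1 + C ^ 2) with hΛ
  have hΛ2 : 2 < Λ := by nlinarith [mul_nonneg (sq_nonneg Γ) (sq_nonneg C)]
  obtain ⟨B1, B2, B3, B4, B5, B6⟩ := frameConst_bounds hC hc1 hΓ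
  choose! Tc hTcR hTc01 hTcK hTcd hTcl hTcu using hcov
  -- Each occupied cell of length $s/\sqrt\kappa$ gets a representative taken from `A`, so that
  -- `hcov` provides a centre near it; the value 0 for empty cells is never used.
  have hrep : ∀ (s : ℝ) (j : ℤ), ∃ x, (∃ y ∈ A, ⌊y / (s / √κ)⌋ = j) → x ∈ A ∧ ⌊x / (s / √κ)⌋ = j := by
    intro s j
    by_cases h : ∃ y ∈ A, ⌊y / (s / √κ)⌋ = j
    · obtain ⟨y, hy⟩ := h; exact ⟨y, fun _ => hy⟩
    · exact ⟨0, fun h' => absurd h' h⟩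
  choose rep hrep using hrep
  -- At the finest scale every plank is assigned to itself; at a coarser one, to a centre that
  -- depends only on its cell.
  refine ⟨fun s ξ => if s = r⁻¹ then ξ else Tc s (rep s ⌊ξ / (s / √κ)⌋), fun ω => ?_⟩
  set P := A.filter (fun ξ => ω ∈ plank k f c₀ (r⁻¹ ^ 2) ξ - plank k f c₀ (r⁻¹ ^ 2) ξ) with hP
  have hPA : P ⊆ A := Finset.filter_subset _ _
  have hPb : ∀ ξ ∈ P, |normalDefect f (ω 0) (ω 1) (ω 2) ξ| ≤ 2 * c₀ * (1 + C) ^ 2 * r⁻¹ ^ 2 := by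
    intro ξ hξ
    obtain ⟨hξA, hξ⟩ := Finset.mem_filter.1 hξ
    exact (hf.sub_plank_bounds hC (by linarith) hδ0 hδ1 (hR ξ (hA hξA)) hξ).2.2
  have hΓκ : Γ⁻¹ * κ ≤ Γ * κ := by
    gcongr
    exact (inv_le_one_of_one_le₀ hΓ).trans hΓ
  obtain ⟨d, hd0, hdK, hdP, hdb, hdh⟩ := hf.exists_cluster hα hαK hK1 (by positivity) hΓκ hq P
    (fun x hx => Ioc_subset_Icc_self (hAK x (hPA hx)))
    (by positivity : 0 ≤ 2 * c₀ * (1 + C) ^ 2 * r⁻¹ ^ 2) hPb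
  set Pp := P.filter (fun x => 0 ≤ ω 0 - ω 2 * x)
  set Pm := P.filter (fun x => ω 0 - ω 2 * x ≤ 0)
  have hPpm : P = Pp ∪ Pm := by
    ext x
    simp only [Pp, Pm, Finset.mem_union, Finset.mem_filter, ← and_or_left]
    exact ⟨fun h => ⟨h, le_total _ _⟩, fun h => h.1⟩
  have hPp : ∀ x ∈ Pp, ∀ y ∈ Pp, |x - y| ≤ d := by
    intro x hx y hy
    rw [Finset.mem_filter] at hx hy
    exact hdP x hx.1 y hy.1 (Or.inl ⟨hx.2, hy.2⟩)
  have hPm : ∀ x ∈ Pm, ∀ y ∈ Pm, |x - y| ≤ d := by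
    intro x hx y hy
    rw [Finset.mem_filter] at hx hy
    exact hdP x hx.1 y hy.1 (Or.inr ⟨hx.2, hy.2⟩)
  -- Short clusters contain at most `M` planks each, and the finest scale serves. For long ones
  -- $s\le d\sqrt\kappa<2s$, so $\sigma=s/\sqrt\kappa$ is comparable to `d` and each cluster meets
  -- at most three cells; hence $2M+6$.
  rcases le_or_gt d (Λ * (r⁻¹ / √κ)) with hdΛ | hdΛ
  · refine ⟨r⁻¹, inv_mem_scales hr, P, hPA.trans hA, ?_, ?_, ?_⟩
    · rw [hPpm]
      have h1 := hcount Pp ((Finset.filter_subset _ _).trans hPA)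
        fun x hx y hy => (hPp x hx y hy).trans hdΛ
      have h2 := hcount Pm ((Finset.filter_subset _ _).trans hPA)
        fun x hx y hy => (hPm x hx y hy).trans hdΛ
      have := Finset.card_union_le Pp Pm
      omega
    · intro ξ hξ
      obtain ⟨hξA, hξ⟩ := Finset.mem_filter.1 hξ
      exact hf.abs_inner_envelope_le_finest hk hC hc1 hr hK hK1' hKr hΓ hl (hR ξ (hA hξA))
        (hAK ξ hξA).2 (hlA ξ hξA) hξ hR
    · intro ξ hξ hω
      simp only [↓reduceIte]
      exact ⟨Finset.mem_filter.2 ⟨hξ, hω⟩, subset_rfl⟩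
  · have hd1 : d ≤ 1 := by linarith
    have hx1 : Λ * r⁻¹ < d * √κ := by
      rw [mul_div_assoc', div_lt_iff₀ hsκ] at hdΛ; exact hdΛ
    have hΛρ := mul_lt_mul_of_pos_right hΛ2 hρ0
    obtain ⟨s, hs, hsd, hds⟩ := exists_scale_near hr
      (by linarith : r⁻¹ ≤ d * √κ) (mul_le_one₀ hd1 hsκ.le hsκ1)
    have hs1 := hs.1
    have hρs := inv_le_of_mem_scales hr hs
    have hs0 : 0 < s := hρ0.trans_le hρs
    -- Here $2r^{-1}<\Lambda r^{-1}<d\sqrt\kappa<2s$, so the coarse branch of the assignment is the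
    -- one in force.
    have hsne : s ≠ r⁻¹ := by
      intro h; rw [h] at hds; linarith
    have hsK : s ≤ (2 * K - α) * √κ := hsd.trans (by gcongr)
    set σ := s / √κ with hσ
    have hσ0 : 0 < σ := by positivity
    have hsσ' : s = σ * √κ := by rw [hσ]; field_simp
    have hσd : σ ≤ d := by rw [hσ, div_le_iff₀ hsκ]; exact hsd
    have hdσ : d < 2 * σ := by rw [hσ, mul_div_assoc', lt_div_iff₀ hsκ]; exact hds
    have hσK : σ ≤ 2 * K := by linarith
    have hsσ : s ^ 2 = κ * σ ^ 2 := by rw [hσ, div_pow, Real.sq_sqrt hκ0.le]; field_simp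
    have hsσ1 : s ≤ σ := by rw [hsσ']; exact mul_le_of_le_one_right hσ0.le hsκ1
    have hs2σ : s ^ 2 ≤ σ := (pow_le_of_le_one hs0.le hs1 two_ne_zero).trans hsσ1
    have hrepA : ∀ ξ ∈ A, rep s ⌊ξ / σ⌋ ∈ A ∧ |ξ - rep s ⌊ξ / σ⌋| ≤ σ := by
      intro ξ hξ
      obtain ⟨h1, h2⟩ := hrep s ⌊ξ / σ⌋ ⟨ξ, hξ, rfl⟩
      refine ⟨h1, ?_⟩
      have h3 := Int.abs_sub_lt_one_of_floor_eq_floor h2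
      rw [← sub_div, abs_div, abs_of_pos hσ0, div_lt_one hσ0] at h3
      rw [abs_sub_comm]
      exact h3.le
    -- One `σ` from the cell and two from the covering property of the centres.
    have hTd : ∀ ξ ∈ A, |ξ - Tc s (rep s ⌊ξ / σ⌋)| ≤ 3 * σ := by
      intro ξ hξ
      obtain ⟨h1, h2⟩ := hrepA ξ hξ
      have h3 := hTcd s hs hsK _ (hAK _ h1)
      have := _root_.abs_sub_le ξ (rep s ⌊ξ / σ⌋) (Tc s (rep s ⌊ξ / σ⌋))
      linarith
    set S := (P.image fun x => ⌊x / σ⌋).image (fun j => Tc s (rep s j)) with hS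
    have hmemS : ∀ ξ ∈ P, Tc s (rep s ⌊ξ / σ⌋) ∈ S := fun ξ hξ =>
      Finset.mem_image_of_mem _ (Finset.mem_image_of_mem _ hξ)
    have hSex : ∀ T ∈ S, ∃ ξ ∈ P, T = Tc s (rep s ⌊ξ / σ⌋) := by
      intro T hT
      obtain ⟨j, hj, rfl⟩ := Finset.mem_image.1 hT
      obtain ⟨ξ, hξ, rfl⟩ := Finset.mem_image.1 hj
      exact ⟨ξ, hξ, rfl⟩
    refine ⟨s, hs, S, ?_, ?_, ?_, ?_⟩
    · intro T hT
      obtain ⟨ξ, hξ, rfl⟩ := hSex T hT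
      exact hTcR s hs hsK _ (hAK _ (hrepA ξ (hPA hξ)).1)
    · refine Finset.card_image_le.trans ?_
      rw [hPpm, Finset.image_union]
      refine (Finset.card_union_le _ _).trans ?_
      have h1 := card_floor_image_le Pp hσ0 (n := 2)
        fun x hx y hy => (hPp x hx y hy).trans (by push_cast; exact hdσ.le)
      have h2 := card_floor_image_le Pm hσ0 (n := 2)
        fun x hx y hy => (hPm x hx y hy).trans (by push_cast; exact hdσ.le)
      omega
    · intro T hT
      obtain ⟨ξ, hξ, rfl⟩ := hSex T hT
      have hξA := hPA hξ
      have hrA := hAK _ (hrepA ξ hξA).1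
      refine hf.abs_inner_envelope_le hk hC hc1 hr hK hK1' hσ0 hσK hρs hs1 hsσ
        (hTc01 s hs hsK _ hrA) (hTcK s hs hsK _ hrA) (hR ξ (hA hξA)) (hAK ξ hξA).2 (hTd ξ hξA) hΓ
        (hTcl s hs hsK _ hrA) hl ?_ ?_ ?_ hR
      · calc κ * σ ^ 2 * |ω 2| ≤ κ * d ^ 2 * |ω 2| := by gcongr
          _ = Γ * (Γ⁻¹ * κ * d ^ 2 * |ω 2|) := by field_simp
          _ ≤ Γ * (4 * (2 * c₀ * (1 + C) ^ 2 * r⁻¹ ^ 2)) := by gcongr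
          _ = 8 * Γ * c₀ * (1 + C) ^ 2 * r⁻¹ ^ 2 := by ring
          _ ≤ _ := by gcongr
      · calc κ * σ * |ω 0 - ω 2 * ξ| ≤ κ * d * |ω 0 - ω 2 * ξ| := by gcongr
          _ = Γ * (Γ⁻¹ * κ * d * |ω 0 - ω 2 * ξ|) := by field_simp
          _ ≤ Γ * (8 * (Γ * κ / (Γ⁻¹ * κ)) * (2 * c₀ * (1 + C) ^ 2 * r⁻¹ ^ 2)) := by
            exact mul_le_mul_of_nonneg_left (hdb ξ hξ) (by linarith)
          _ = 16 * Γ ^ 3 * c₀ * (1 + C) ^ 2 * r⁻¹ ^ 2 := by field_simp; ring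
          _ ≤ _ := by gcongr
      · exact (hPb ξ hξ).trans (by gcongr)
    · intro ξ hξ hω
      have hrA := hAK _ (hrepA ξ hξ).1
      simp only [if_neg hsne]
      refine ⟨hmemS ξ (Finset.mem_filter.2 ⟨hξ, hω⟩), ?_⟩
      have hΛ0 : 0 < Λ := by linarith
      have hΛε : r⁻¹ ≤ 2 / Λ * s := by
        rw [div_mul_eq_mul_div, le_div_iff₀ hΛ0]; linarith
      -- The constant `Λ` was chosen so that $\varepsilon=2/\Lambda$ makes
      -- $\varepsilon\cdot9\Gamma^2(1+C^2)$ equal to 1.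
      refine hf.plank_subset_plank hC (ε := 2 / Λ) hK hΓ hCΓ hc hρ0 hσ0 hs0 hs2σ hsσ hΛε ?_
        (hTc01 s hs hsK _ hrA) (hTcK s hs hsK _ hrA) (hR ξ (hA hξ)) (hAK ξ hξ).2 (hTd ξ hξ) ?_
        (hTcu s hs hsK _ hrA)
      · rw [hΛ]; apply le_of_eq; field_simp; norm_num
      · refine (hlA ξ hξ).trans ?_
        have : r⁻¹ / √κ ≤ 2 / Λ * σ := by
          rw [hσ, ← mul_div_assoc]; gcongr
        gcongr

end Block

end ConeKakeya

/-! ### Tangential lengths and the dyadic blocks. -/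

namespace ConeKakeya

open Set Pointwise

section Length

variable {k : ℕ} {ρ K x : ℝ}

theorem rpow_half_sub_two (hk : 2 ≤ k) (hx : 0 ≤ x) :
    x ^ (((k : ℝ) - 2) / 2) = √(x ^ (k - 2)) := by
  rw [Real.sqrt_eq_rpow, ← Real.rpow_natCast, ← Real.rpow_mul hx, Nat.cast_sub hk]
  congr 1
  push_cast
  ring

theorem sq_rpow_half (hρ : 0 ≤ ρ) : (ρ ^ 2) ^ (1 / 2 : ℝ) = ρ := by
  rw [← Real.sqrt_eq_rpow, Real.sqrt_sq hρ]

/-- For $w=\rho^{2/k}$ one has $w^2w^{k-2}=\rho^2$, so the two branches of the tangential length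
agree at the threshold. -/
theorem root_eq_div (hk : 2 ≤ k) (hρ : 0 < ρ) :
    (ρ ^ 2) ^ (1 / (k : ℝ)) = ρ / √(((ρ ^ 2) ^ (1 / (k : ℝ))) ^ (k - 2)) := by
  set w := (ρ ^ 2) ^ (1 / (k : ℝ)) with hw
  have hw0 : 0 < w := by positivity
  have hwk : w ^ k = ρ ^ 2 := by
    rw [hw, one_div, Real.rpow_inv_natCast_pow (by positivity) (by omega)]
  have h1 : w ^ 2 * w ^ (k - 2) = ρ ^ 2 := by rw [← pow_add, ← hwk]; congr 1; omega
  have h2 : 0 < w ^ (k - 2) := by positivity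
  rw [eq_div_iff (Real.sqrt_pos.2 h2).ne']
  apply (pow_left_inj₀ (by positivity) hρ.le two_ne_zero).1
  rw [mul_pow, Real.sq_sqrt h2.le, h1]

theorem tangentialLength_eq (hk : 2 ≤ k) (hρ : 0 ≤ ρ) (hx : 0 ≤ x) :
    tangentialLength k (ρ ^ 2) x =
      if x ≤ (ρ ^ 2) ^ (1 / (k : ℝ)) then (ρ ^ 2) ^ (1 / (k : ℝ)) else ρ / √(x ^ (k - 2)) := by
  unfold tangentialLength
  rw [abs_of_nonneg hx, sq_rpow_half hρ, rpow_half_sub_two hk hx]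

theorem div_sqrt_pow_le (hρ : 0 ≤ ρ) (hK : 0 < K) (hKx : K ≤ x) :
    ρ / √(x ^ (k - 2)) ≤ ρ / √(K ^ (k - 2)) := by
  have : 0 < √(K ^ (k - 2)) := Real.sqrt_pos.2 (by positivity)
  gcongr

theorem tangentialLength_le_root (hk : 2 ≤ k) (hρ : 0 < ρ) (hx : 0 ≤ x) :
    tangentialLength k (ρ ^ 2) x ≤ (ρ ^ 2) ^ (1 / (k : ℝ)) := by
  rw [tangentialLength_eq hk hρ.le hx]
  split_ifs with h
  · exact le_rfl
  · refine (div_sqrt_pow_le hρ.le (by positivity) (not_le.1 h).le).trans (root_eq_div hk hρ).ge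

theorem tangentialLength_le (hk : 2 ≤ k) (hρ : 0 < ρ) (hK : (ρ ^ 2) ^ (1 / (k : ℝ)) ≤ K)
    (hKx : K ≤ x) : tangentialLength k (ρ ^ 2) x ≤ ρ / √(K ^ (k - 2)) := by
  have hK0 : 0 < K := lt_of_lt_of_le (by positivity) hK
  rw [tangentialLength_eq hk hρ.le (hK0.le.trans hKx)]
  split_ifs with h
  · have : (ρ ^ 2) ^ (1 / (k : ℝ)) = K := le_antisymm hK (hKx.trans h)
    nth_rewrite 1 [root_eq_div hk hρ]
    rw [this]
  · exact div_sqrt_pow_le hρ.le hK0 hKx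

theorem div_sqrt_le_root (hk : 2 ≤ k) (hρ : 0 < ρ) (hK : (ρ ^ 2) ^ (1 / (k : ℝ)) ≤ K) :
    ρ / √(K ^ (k - 2)) ≤ (ρ ^ 2) ^ (1 / (k : ℝ)) :=
  (div_sqrt_pow_le hρ.le (by positivity) hK).trans (root_eq_div hk hρ).ge

/-- The factor `A` allows for base points beyond the block by a bounded ratio, as happens for planks
inside a coarse `τ`. -/
theorem le_mul_tangentialLength (hk : 2 ≤ k) (hρ : 0 < ρ) (hK : (ρ ^ 2) ^ (1 / (k : ℝ)) ≤ K)
    {A : ℝ} (hA : 1 ≤ A) (hx : 0 ≤ x) (hxA : x ≤ A * K) :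
    ρ / √(K ^ (k - 2)) ≤ √(A ^ (k - 2)) * tangentialLength k (ρ ^ 2) x := by
  have hw0 : 0 < (ρ ^ 2) ^ (1 / (k : ℝ)) := by positivity
  have hK0 : 0 < K := hw0.trans_le hK
  have hA1 : 1 ≤ √(A ^ (k - 2)) := Real.one_le_sqrt.2 (one_le_pow₀ hA)
  rw [tangentialLength_eq hk hρ.le hx]
  split_ifs with h
  · refine (div_sqrt_le_root hk hρ hK).trans ?_
    exact le_mul_of_one_le_left hw0.le hA1
  · have hx0 : 0 < x := hw0.trans (not_le.1 h)
    have h1 : √(x ^ (k - 2)) ≤ √(A ^ (k - 2)) * √(K ^ (k - 2)) := by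
      rw [← Real.sqrt_mul (by positivity), ← mul_pow]
      gcongr
    have h2 : 0 < √(x ^ (k - 2)) := Real.sqrt_pos.2 (by positivity)
    have h3 : 0 < √(K ^ (k - 2)) := Real.sqrt_pos.2 (by positivity)
    rw [← mul_div_assoc, div_le_div_iff₀ h3 h2]
    calc ρ * √(x ^ (k - 2)) ≤ ρ * (√(A ^ (k - 2)) * √(K ^ (k - 2))) := by gcongr
      _ = _ := by ring

theorem root_le_of_sq_le (hk : 2 ≤ k) (hρ : 0 ≤ ρ) (hK : 0 < K) (h : ρ ≤ K * √(K ^ (k - 2))) :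
    (ρ ^ 2) ^ (1 / (k : ℝ)) ≤ K := by
  have h1 : ρ ^ 2 ≤ K ^ k := by
    calc ρ ^ 2 ≤ (K * √(K ^ (k - 2))) ^ 2 := by gcongr
      _ = K ^ 2 * K ^ (k - 2) := by rw [mul_pow, Real.sq_sqrt (by positivity)]
      _ = K ^ k := by rw [← pow_add]; congr 1; omega
  calc (ρ ^ 2) ^ (1 / (k : ℝ)) ≤ (K ^ k) ^ (1 / (k : ℝ)) := by gcongr
    _ = K := by rw [one_div, Real.pow_rpow_inv_natCast hK.le (by omega)]

theorem le_root (hk : 2 ≤ k) (hρ : 0 < ρ) (hρ1 : ρ ≤ 1) : ρ ≤ (ρ ^ 2) ^ (1 / (k : ℝ)) := by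
  have hk' : (2 : ℝ) ≤ k := by exact_mod_cast hk
  calc ρ = (ρ ^ 2) ^ (1 / 2 : ℝ) := (sq_rpow_half hρ.le).symm
    _ ≤ (ρ ^ 2) ^ (1 / (k : ℝ)) :=
      Real.rpow_le_rpow_of_exponent_ge (by positivity) (pow_le_one₀ hρ.le hρ1) (by gcongr)

theorem root_le_one (hρ : 0 ≤ ρ) (hρ1 : ρ ≤ 1) : (ρ ^ 2) ^ (1 / (k : ℝ)) ≤ 1 :=
  Real.rpow_le_one (by positivity) (pow_le_one₀ hρ hρ1) (by positivity)

end Length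

/-- The hypotheses stand inside the existential so that the index can be chosen as a function on all
reals. -/
theorem exists_dyadic (x : ℝ) : ∃ m : ℕ, 0 < x → x ≤ 1 →
    1 ≤ m ∧ (2 : ℝ)⁻¹ ^ m < x ∧ x ≤ 2 * (2 : ℝ)⁻¹ ^ m := by
  by_cases h : 0 < x ∧ x ≤ 1
  · obtain ⟨n, h1, h2⟩ := exists_nat_pow_near_of_lt_one h.1 h.2
      (by norm_num : (0 : ℝ) < 2⁻¹) (by norm_num)
    refine ⟨n + 1, fun _ _ => ⟨by omega, h1, ?_⟩⟩
    rw [pow_succ]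
    linarith
  · exact ⟨0, fun h1 h2 => absurd ⟨h1, h2⟩ h⟩

section Organization

variable {k : ℕ} {C : ℝ} {f q : ℝ → ℝ} {c₀ r : ℝ} {N : ℕ} {R : ℝ → Finset ℝ}

/-- Organization of the planks near the flat point. -/
theorem IsRegular.isOrganized_near_zero (hf : IsRegular k C f q) (hk : 2 ≤ k) (hC : 1 ≤ C)
    (hr : 1 ≤ r) {Γ : ℝ} (hΓ : 1 ≤ Γ) (hc : 1 ≤ c₀)
    (hR : IsCenters k N (r⁻¹ ^ 2) (R (r⁻¹ ^ 2))) :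
    IsOrganized k f c₀ r R
      ((R (r⁻¹ ^ 2)).filter (fun ξ => ξ ≤ 2 * (r⁻¹ ^ 2) ^ (1 / (k : ℝ)))) (fun _ ξ => ξ) N
      (dualConst k C c₀ Γ √((2 + 2 * (c₀ * (Γ + (1 + C)))) ^ (k - 2)) (frameConst C c₀ Γ)) := by
  have hρ0 : 0 < r⁻¹ := by positivity
  have hρ1 : r⁻¹ ≤ 1 := inv_le_one_of_one_le₀ hr
  set w := (r⁻¹ ^ 2) ^ (1 / (k : ℝ)) with hw
  have hw0 : 0 < w := by positivity
  refine (hf.isOrganized_finest hk hC hc hr hw0 (root_le_one hρ0.le hρ1) ?_ hΓ ?_ hR.subset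
    (Finset.filter_subset _ _) ?_ ?_).mono hR.card_near_zero
  · rw [hw, ← root_eq_div hk hρ0, ← hw]; linarith
  · intro x hx hxw
    exact le_mul_tangentialLength hk hρ0 le_rfl
      (by nlinarith [mul_nonneg (by linarith : 0 ≤ c₀) (by linarith : 0 ≤ Γ + (1 + C))]) hx.1 hxw
  · exact fun ξ hξ => (Finset.mem_filter.1 hξ).2
  · intro ξ hξ
    have h01 := hR.subset ξ (Finset.mem_filter.1 hξ).1
    rw [hw, ← root_eq_div hk hρ0]
    exact (tangentialLength_le_root hk hρ0 h01.1).trans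
      (le_mul_of_one_le_left (by positivity) hΓ)

/-- Organization of the planks over one dyadic block. -/
theorem IsRegular.exists_isOrganized_dyadic (hf : IsRegular k C f q) (hk : 2 ≤ k) (hC : 1 ≤ C)
    (hr : 1 ≤ r) {Γ : ℝ} (hΓ : Γ = C * 2 ^ (k - 2)) (hc : 27 * Γ * (1 + C ^ 2) ≤ c₀)
    (hR : ∀ δ : ℝ, 0 < δ → δ ≤ 1 → IsCenters k N δ (R δ)) {b : ℕ} (hb : 1 ≤ b) {K : ℝ}
    (hKb : K = (2 : ℝ)⁻¹ ^ b) (hK : (r⁻¹ ^ 2) ^ (1 / (k : ℝ)) ≤ K) {A : Finset ℝ}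
    (hA : A ⊆ R (r⁻¹ ^ 2)) (hAK : ∀ ξ ∈ A, ξ ∈ Ioc K (2 * K)) :
    ∃ m, IsOrganized k f c₀ r R A m (2 * (⌈18 * Γ ^ 2 * (1 + C ^ 2)⌉₊ + 1) + 6)
      (dualConst k C c₀ Γ √((2 + 2 * (c₀ * (Γ + (1 + C)))) ^ (k - 2)) (frameConst C c₀ Γ)) := by
  have hρ0 : 0 < r⁻¹ := by positivity
  have hρ1 : r⁻¹ ≤ 1 := inv_le_one_of_one_le₀ hr
  have h2k : (1 : ℝ) ≤ 2 ^ (k - 2) := one_le_pow₀ (by norm_num)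
  have hCΓ : C ≤ Γ := by rw [hΓ]; exact le_mul_of_one_le_right (by linarith) h2k
  have hΓ1 : 1 ≤ Γ := hC.trans hCΓ
  have h2Γ : 2 ^ (k - 2) ≤ Γ := by rw [hΓ]; exact le_mul_of_one_le_left (by linarith) hC
  have hK0 : 0 < K := by rw [hKb]; positivity
  have hK1 : 2 * K ≤ 1 := by
    have : K ≤ (2 : ℝ)⁻¹ ^ 1 := by
      rw [hKb]; exact pow_le_pow_of_le_one (by norm_num) (by norm_num) hb
    linarith
  have hc0 : 0 ≤ c₀ := le_trans (by positivity) hc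
  set κ := K ^ (k - 2) with hκ
  have hκ0 : 0 < κ := by positivity
  have hsκ : 0 < √κ := Real.sqrt_pos.2 hκ0
  have hδ := hR (r⁻¹ ^ 2) (by positivity) (pow_le_one₀ hρ0.le hρ1)
  refine hf.exists_isOrganized hk hC hr hK0 hK1 ?_ hΓ1 hΓ.ge hc ?_ hδ.subset hA hK0.le
    (by linarith) hAK ?_ ?_ ?_ ?_
  · exact (div_sqrt_le_root hk hρ0 hK).trans (by linarith)
  · intro x hx hxw
    exact le_mul_tangentialLength hk hρ0 hK
      (by nlinarith [mul_nonneg hc0 (by linarith : 0 ≤ Γ + (1 + C))]) hx.1 hxw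
  · intro ξ hξ
    refine (tangentialLength_le hk hρ0 hK (hAK ξ hξ).1.le).trans ?_
    exact le_mul_of_one_le_left (by positivity) hΓ1
  · intro t ht
    have ht01 : t ∈ Ioo (0 : ℝ) 1 := ⟨hK0.trans ht.1, ht.2.trans_le hK1⟩
    constructor
    · refine le_trans ?_ (hf.le_second t ht01)
      have := ht.1.le
      gcongr
    · refine (hf.second_le t ht01).trans ?_
      calc C * t ^ (k - 2) ≤ C * (2 * K) ^ (k - 2) := by
            have := ht.2.le
            have := ht01.1
            gcongr
        _ = _ := by rw [hΓ, mul_pow]; ring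
  · intro s hs hsK x hx
    have hs0 : 0 < s := hρ0.trans_le (inv_le_of_mem_scales hr hs)
    -- The scales required are those with $s\le K\sqrt\kappa$, that is $s^2\le K^k$; for these the
    -- block still carries a maximal separated set of centres at scale $s^2$.
    have hK' : (s ^ 2) ^ (1 / (k : ℝ)) ≤ K := by
      apply root_le_of_sq_le hk hs0.le hK0
      rw [show 2 * K - K = K by ring] at hsK
      exact hsK
    have hcs := hR (s ^ 2) (by positivity) (pow_le_one₀ hs0.le hs.1)
    obtain ⟨T, hTR, hTK, hT⟩ := hcs.maximal b K hb hKb hK' x hx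
    rw [sq_rpow_half hs0.le, rpow_half_sub_two hk hK0.le] at hT
    refine ⟨T, hTR, hcs.subset T hTR, hTK.2, ?_, ?_, ?_⟩
    · refine hT.trans ?_
      exact le_mul_of_one_le_left (by positivity) (by norm_num)
    · refine (tangentialLength_le hk hs0 hK' hTK.1.le).trans ?_
      exact le_mul_of_one_le_left (by positivity) hΓ1
    · refine (le_mul_tangentialLength hk hs0 hK' one_le_two (hK0.le.trans hTK.1.le)
        hTK.2).trans ?_
      have := (tangentialLength_pos (k := k) (δ := s ^ 2) (by positivity) T).le
      gcongr
      refine le_trans ?_ h2Γ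
      rw [Real.sqrt_le_left (by positivity)]
      exact le_self_pow₀ h2k two_ne_zero
  · intro P hPA hP
    refine card_le_of_separated P (σ := r⁻¹ / √κ) (by positivity) ?_ ?_
    · intro x hx y hy
      refine (hP x hx y hy).trans ?_
      gcongr
      exact Nat.le_ceil _
    · intro x hx y hy hne
      have := hδ.separated b K hb hKb hK x (hA (hPA hx)) y (hA (hPA hy)) (hAK x (hPA hx))
        (hAK y (hPA hy)) hne
      rwa [sq_rpow_half hρ0.le, rpow_half_sub_two hk hK0.le] at this

/-- Organization of all planks in logarithmically many blocks. -/
theorem IsRegular.exists_organization (hf : IsRegular k C f q) (hk : 2 ≤ k) (hC : 1 ≤ C)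
    (hr : 2 ≤ r) {Γ : ℝ} (hΓ : Γ = C * 2 ^ (k - 2)) (hc : 27 * Γ * (1 + C ^ 2) ≤ c₀)
    (hR : ∀ δ : ℝ, 0 < δ → δ ≤ 1 → IsCenters k N δ (R δ)) :
    ∃ (blk : ℝ → ℕ) (m : ℕ → ℝ → ℝ → ℝ), (∀ ξ ∈ R (r⁻¹ ^ 2), blk ξ < ⌈Real.logb 2 r⌉₊) ∧
      ∀ b, IsOrganized k f c₀ r R ((R (r⁻¹ ^ 2)).filter (fun ξ => blk ξ = b)) (m b)
        (2 * (⌈18 * Γ ^ 2 * (1 + C ^ 2)⌉₊ + 1) + 6 + N)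
        (dualConst k C c₀ Γ √((2 + 2 * (c₀ * (Γ + (1 + C)))) ^ (k - 2)) (frameConst C c₀ Γ)) := by
  have hr1 : 1 ≤ r := by linarith
  have hρ0 : 0 < r⁻¹ := by positivity
  have hρ1 : r⁻¹ ≤ 1 := inv_le_one_of_one_le₀ hr1
  have h2k : (1 : ℝ) ≤ 2 ^ (k - 2) := one_le_pow₀ (by norm_num)
  have hΓ1 : 1 ≤ Γ := by rw [hΓ]; nlinarith
  have hc1 : 1 ≤ c₀ := by nlinarith [mul_nonneg (by linarith : 0 ≤ Γ) (sq_nonneg C)]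
  have hδ := hR (r⁻¹ ^ 2) (by positivity) (pow_le_one₀ hρ0.le hρ1)
  set w := (r⁻¹ ^ 2) ^ (1 / (k : ℝ)) with hw
  have hw0 : 0 < w := by positivity
  choose mm hmm using exists_dyadic
  -- Block 0 is the neighbourhood of the flat point; dyadic indices start at 1, so it is not
  -- confused with another block.
  set blk : ℝ → ℕ := fun ξ => if ξ ≤ 2 * w then 0 else mm ξ with hblk
  have hmm' : ∀ ξ ∈ R (r⁻¹ ^ 2), ¬ ξ ≤ 2 * w → 1 ≤ mm ξ ∧ (2 : ℝ)⁻¹ ^ mm ξ < ξ ∧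
      ξ ≤ 2 * (2 : ℝ)⁻¹ ^ mm ξ := fun ξ hξ h =>
    hmm ξ (by linarith) (hδ.subset ξ hξ).2
  have hex : ∀ b, ∃ m, IsOrganized k f c₀ r R ((R (r⁻¹ ^ 2)).filter (fun ξ => blk ξ = b)) m
        (2 * (⌈18 * Γ ^ 2 * (1 + C ^ 2)⌉₊ + 1) + 6 + N)
        (dualConst k C c₀ Γ √((2 + 2 * (c₀ * (Γ + (1 + C)))) ^ (k - 2)) (frameConst C c₀ Γ)) := by
    intro b
    rcases Nat.eq_zero_or_pos b with rfl | hb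
    · have : (R (r⁻¹ ^ 2)).filter (fun ξ => blk ξ = 0) =
          (R (r⁻¹ ^ 2)).filter (fun ξ => ξ ≤ 2 * w) := by
        apply Finset.filter_congr
        intro ξ hξ
        simp only [hblk]
        split_ifs with h
        · simp [h]
        · have := (hmm' ξ hξ h).1
          simp only [h, iff_false]
          omega
      rw [this]
      exact ⟨_, (hf.isOrganized_near_zero hk hC hr1 hΓ1 hc1 hδ).mono (by omega)⟩
    · have hmem : ∀ ξ ∈ (R (r⁻¹ ^ 2)).filter (fun ξ => blk ξ = b),
          ξ ∈ Ioc ((2 : ℝ)⁻¹ ^ b) (2 * (2 : ℝ)⁻¹ ^ b) ∧ 2 * w < ξ := by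
        intro ξ hξ
        obtain ⟨hξR, hξ⟩ := Finset.mem_filter.1 hξ
        simp only [hblk] at hξ
        split_ifs at hξ with h
        · omega
        · obtain ⟨-, h1, h2⟩ := hmm' ξ hξR h
          rw [hξ] at h1 h2
          exact ⟨⟨h1, h2⟩, not_le.1 h⟩
      by_cases hwK : w ≤ (2 : ℝ)⁻¹ ^ b
      · obtain ⟨m, hm⟩ := hf.exists_isOrganized_dyadic hk hC hr1 hΓ hc hR hb rfl hwK
          (Finset.filter_subset _ _) (fun ξ hξ => (hmem ξ hξ).1)
        exact ⟨m, hm.mono (by omega)⟩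
      · have : (R (r⁻¹ ^ 2)).filter (fun ξ => blk ξ = b) = ∅ := by
          rw [Finset.eq_empty_iff_forall_notMem]
          intro ξ hξ
          obtain ⟨h1, h2⟩ := hmem ξ hξ
          linarith [h1.2]
        rw [this]
        exact ⟨fun _ ξ => ξ, isOrganized_of_eq_empty hr1 _ _ _⟩
  choose m hm using hex
  refine ⟨blk, m, ?_, hm⟩
  intro ξ hξ
  simp only [hblk]
  have hlog : 0 < Real.logb 2 r := Real.logb_pos (by norm_num) (by linarith)
  split_ifs with h
  · exact Nat.ceil_pos.2 hlog
  · obtain ⟨-, h1, h2⟩ := hmm' ξ hξ h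
    rw [Nat.lt_ceil, Real.lt_logb_iff_rpow_lt (by norm_num) (by linarith), Real.rpow_natCast]
    -- $r^{-1}\le w<\xi/2\le2^{-m}$, so the dyadic index is smaller than $\log_2r$.
    have h3 : r⁻¹ < (2 : ℝ)⁻¹ ^ mm ξ := by
      have := le_root hk hρ0 hρ1
      linarith
    rw [inv_pow] at h3
    exact (inv_lt_inv₀ (by linarith) (by positivity)).1 h3

end Organization

end ConeKakeya

/-! ### The nondegenerate case: two blocks, no logarithm. -/

namespace ConeKakeya

open Set Pointwise

/-- A set of diameter at most `Λ * ρ` contained in `(2 * ρ, 1]` whose dyadic parts are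
`ρ`-separated has boundedly many points. -/
theorem card_le_of_dyadic_separated {P : Finset ℝ} {ρ Λ : ℝ} (hρ : 0 < ρ)
    (hP : ∀ x ∈ P, 2 * ρ < x ∧ x ≤ 1) (hd : ∀ x ∈ P, ∀ y ∈ P, |x - y| ≤ Λ * ρ)
    (hsep : ∀ m : ℕ, 1 ≤ m → ρ ≤ (2 : ℝ)⁻¹ ^ m →
      ∀ x ∈ P, ∀ y ∈ P, x ∈ Ioc ((2 : ℝ)⁻¹ ^ m) (2 * (2 : ℝ)⁻¹ ^ m) →
        y ∈ Ioc ((2 : ℝ)⁻¹ ^ m) (2 * (2 : ℝ)⁻¹ ^ m) → x ≠ y → ρ ≤ |x - y|) :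
    P.card ≤ (⌈Λ⌉₊ + 1) * (⌈Λ⌉₊ + 1) := by
  classical
  choose mm hmm using exists_dyadic
  have hmP : ∀ x ∈ P, 1 ≤ mm x ∧ x ∈ Ioc ((2 : ℝ)⁻¹ ^ mm x) (2 * (2 : ℝ)⁻¹ ^ mm x) := by
    intro x hx
    obtain ⟨h1, h2, h3⟩ := hmm x (by linarith [(hP x hx).1]) (hP x hx).2
    exact ⟨h1, h2, h3⟩
  rcases P.eq_empty_or_nonempty with rfl | hne
  · simp
  obtain ⟨x₀, hx₀, hmax⟩ := P.exists_max_image mm hne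
  -- Points of adjacent dyadic intervals may be arbitrarily close, so each interval is counted
  -- separately. Only $\lceil\Lambda\rceil+1$ intervals occur: for the smallest scale point `x₀`,
  -- any `x` satisfies $x\le x_0+\Lambda\rho\le2^{\lceil\Lambda\rceil}x_0$.
  have himg : P.image mm ⊆ Finset.Icc (mm x₀ - ⌈Λ⌉₊) (mm x₀) := by
    intro j hj
    obtain ⟨x, hx, rfl⟩ := Finset.mem_image.1 hj
    refine Finset.mem_Icc.2 ⟨?_, hmax x hx⟩
    have h1 := (hmP x hx).2.1
    have h2 := (hmP x₀ hx₀).2.2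
    have h3 := (le_abs_self _).trans (hd x hx x₀ hx₀)
    have h4 := (hP x₀ hx₀).1
    have h5 : (⌈Λ⌉₊ : ℝ) + 1 ≤ 2 ^ ⌈Λ⌉₊ := by
      exact_mod_cast (Nat.lt_two_pow_self (n := ⌈Λ⌉₊))
    have h6 : x ≤ 2 ^ ⌈Λ⌉₊ * x₀ := by
      have h7 : Λ * ρ ≤ ⌈Λ⌉₊ * ρ := by gcongr; exact Nat.le_ceil _
      have h8 : (⌈Λ⌉₊ : ℝ) * ρ ≤ ⌈Λ⌉₊ * x₀ := by gcongr; linarith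
      have h9 : ((⌈Λ⌉₊ : ℝ) + 1) * x₀ ≤ 2 ^ ⌈Λ⌉₊ * x₀ := by
        apply mul_le_mul_of_nonneg_right h5; linarith
      linarith
    have h10 : (2 : ℝ)⁻¹ ^ mm x < 2 ^ (⌈Λ⌉₊ + 1) * (2 : ℝ)⁻¹ ^ mm x₀ := by
      calc (2 : ℝ)⁻¹ ^ mm x < x := h1
        _ ≤ 2 ^ ⌈Λ⌉₊ * x₀ := h6
        _ ≤ 2 ^ ⌈Λ⌉₊ * (2 * (2 : ℝ)⁻¹ ^ mm x₀) := by gcongr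
        _ = _ := by ring
    rw [inv_pow, inv_pow, ← div_eq_mul_inv, lt_div_iff₀ (by positivity), inv_mul_lt_iff₀
      (by positivity), ← pow_add] at h10
    have := (pow_lt_pow_iff_right₀ (one_lt_two : (1 : ℝ) < 2)).1 h10
    omega
  have hfib : ∀ j ∈ P.image mm, (P.filter (fun x => mm x = j)).card ≤ ⌈Λ⌉₊ + 1 := by
    intro j _
    refine card_le_of_separated _ hρ ?_ ?_
    · intro x hx y hy
      refine (hd x (Finset.mem_filter.1 hx).1 y (Finset.mem_filter.1 hy).1).trans ?_
      gcongr
      exact Nat.le_ceil _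
    · intro x hx y hy hxy
      obtain ⟨hxP, rfl⟩ := Finset.mem_filter.1 hx
      obtain ⟨hyP, hyj⟩ := Finset.mem_filter.1 hy
      obtain ⟨h1, h2⟩ := hmP x hxP
      have h3 := (hmP y hyP).2
      rw [hyj] at h3
      exact hsep _ h1 (by linarith [(hP x hxP).1, h2.2]) x hxP y hyP h2 h3 hxy
  calc P.card ≤ (⌈Λ⌉₊ + 1) * (P.image mm).card := Finset.card_le_mul_card_image P _ hfib
    _ ≤ _ := by
      refine Nat.mul_le_mul_left _ ((Finset.card_le_card himg).trans ?_)
      rw [Nat.card_Icc]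
      omega

theorem tangentialLength_two {ρ x : ℝ} (hρ : 0 ≤ ρ) (hx : 0 ≤ x) :
    tangentialLength 2 (ρ ^ 2) x = ρ := by
  rw [tangentialLength_eq le_rfl hρ hx]
  have : (ρ ^ 2) ^ (1 / ((2 : ℕ) : ℝ)) = ρ := by simpa using sq_rpow_half hρ
  simp only [this]
  simp

section Organization

variable {C : ℝ} {f q : ℝ → ℝ} {c₀ r : ℝ} {N : ℕ} {R : ℝ → Finset ℝ}

/-- For nondegenerate curves, all planks away from the origin form one block. -/
theorem IsRegular.exists_isOrganized_two (hf : IsRegular 2 C f q) (hC : 1 ≤ C)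
    (hr : 2 ≤ r) (hc : 27 * C * (1 + C ^ 2) ≤ c₀)
    (hR : ∀ δ : ℝ, 0 < δ → δ ≤ 1 → IsCenters 2 N δ (R δ)) {A : Finset ℝ}
    (hA : A ⊆ R (r⁻¹ ^ 2)) (hAr : ∀ ξ ∈ A, 2 * r⁻¹ < ξ) :
    ∃ m, IsOrganized 2 f c₀ r R A m
      (2 * ((⌈18 * C ^ 2 * (1 + C ^ 2)⌉₊ + 1) * (⌈18 * C ^ 2 * (1 + C ^ 2)⌉₊ + 1)) + 6)
      (dualConst 2 C c₀ C 1 (frameConst C c₀ C)) := by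
  have hr1 : 1 ≤ r := by linarith
  have hρ0 : 0 < r⁻¹ := by positivity
  have hρ2 : 2 * r⁻¹ ≤ 1 := by
    rw [← div_eq_mul_inv, div_le_one (by linarith)]; exact hr
  have hδ := hR (r⁻¹ ^ 2) (by positivity) (pow_le_one₀ hρ0.le (by linarith))
  have hroot : ∀ {s : ℝ}, 0 ≤ s → (s ^ 2) ^ (1 / ((2 : ℕ) : ℝ)) = s := fun hs => by
    simpa using sq_rpow_half hs
  -- For $k=2$ the power $K^{k-2}$ is 1 and the second derivative is comparable to 1 on the whole
  -- interval, so it forms a single block.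
  refine hf.exists_isOrganized (K := 1 / 2) (α := 2 * r⁻¹) le_rfl hC hr1 (by norm_num)
    (by norm_num) ?_ hC (by simp) hc ?_ hδ.subset hA (by positivity) (by linarith) ?_ ?_ ?_ ?_ ?_
  · simp only [Nat.sub_self, pow_zero, Real.sqrt_one]
    linarith
  · intro x hx _
    rw [tangentialLength_two hρ0.le hx.1]
    simp
  · intro ξ hξ
    exact ⟨hAr ξ hξ, by linarith [(hδ.subset ξ (hA hξ)).2]⟩
  · intro ξ hξ
    rw [tangentialLength_two hρ0.le (hδ.subset ξ (hA hξ)).1]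
    simpa using le_mul_of_one_le_left hρ0.le hC
  · intro t ht
    have ht01 : t ∈ Ioo (0 : ℝ) 1 := ⟨by linarith [ht.1], by linarith [ht.2]⟩
    exact ⟨by simpa using hf.le_second t ht01, by simpa using hf.second_le t ht01⟩
  · intro s hs _ x hx
    have hs0 : 0 < s := hρ0.trans_le (inv_le_of_mem_scales hr1 hs)
    have hx1 : x ≤ 1 := by linarith [hx.2]
    have hx0 : 0 < x := by linarith [hx.1]
    have hcs := hR (s ^ 2) (by positivity) (pow_le_one₀ hs0.le hs.1)
    have hT : ∃ T ∈ R (s ^ 2), |x - T| ≤ 2 * s := by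
      -- Within $2s$ of the origin the centre near zero is used; farther out, $2^{-m}\ge x/2>s$ and
      -- maximality in the dyadic interval applies.
      rcases le_or_gt x (2 * s) with h | h
      · obtain ⟨T, hTR, hT⟩ := hcs.exists_near_zero
        rw [hroot hs0.le] at hT
        have := (hcs.subset T hTR).1
        exact ⟨T, hTR, _root_.abs_le.2 ⟨by linarith, by linarith⟩⟩
      · obtain ⟨m, hm⟩ := exists_dyadic x
        obtain ⟨h1, h2, h3⟩ := hm hx0 hx1
        obtain ⟨T, hTR, -, hT⟩ := hcs.maximal m _ h1 rfl
          (by rw [hroot hs0.le]; linarith) x ⟨h2, h3⟩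
        rw [sq_rpow_half hs0.le, rpow_half_sub_two le_rfl (by positivity)] at hT
        refine ⟨T, hTR, hT.trans ?_⟩
        simp only [Nat.sub_self, pow_zero, Real.sqrt_one, div_one]
        linarith
    obtain ⟨T, hTR, hT⟩ := hT
    have hT01 := hcs.subset T hTR
    refine ⟨T, hTR, hT01, by linarith [hT01.2], by simpa using hT, ?_, ?_⟩
    all_goals
      rw [tangentialLength_two hs0.le hT01.1]
      simpa using le_mul_of_one_le_left hs0.le hC
  · intro P hPA hP
    refine card_le_of_dyadic_separated hρ0
      (fun x hx => ⟨hAr x (hPA hx), (hδ.subset x (hA (hPA hx))).2⟩) ?_ ?_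
    · intro x hx y hy
      simpa using hP x hx y hy
    · intro m hm hm' x hx y hy hxm hym hne
      have := hδ.separated m _ hm rfl (by rw [hroot hρ0.le]; exact hm') x (hA (hPA hx)) y
        (hA (hPA hy)) hxm hym hne
      rw [sq_rpow_half hρ0.le, rpow_half_sub_two le_rfl (by positivity)] at this
      simpa using this

/-- For nondegenerate curves, two blocks suffice. -/
theorem IsRegular.exists_organization_two (hf : IsRegular 2 C f q) (hC : 1 ≤ C)
    (hr : 2 ≤ r) (hc : 27 * C * (1 + C ^ 2) ≤ c₀)
    (hR : ∀ δ : ℝ, 0 < δ → δ ≤ 1 → IsCenters 2 N δ (R δ)) :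
    ∃ (blk : ℝ → ℕ) (m : ℕ → ℝ → ℝ → ℝ), (∀ ξ ∈ R (r⁻¹ ^ 2), blk ξ < 2) ∧
      ∀ b < 2, IsOrganized 2 f c₀ r R ((R (r⁻¹ ^ 2)).filter (fun ξ => blk ξ = b)) (m b)
        (2 * ((⌈18 * C ^ 2 * (1 + C ^ 2)⌉₊ + 1) * (⌈18 * C ^ 2 * (1 + C ^ 2)⌉₊ + 1)) + 6 + N)
        (dualConst 2 C c₀ C 1 (frameConst C c₀ C)) := by
  have hr1 : 1 ≤ r := by linarith
  have hρ0 : 0 < r⁻¹ := by positivity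
  have hρ1 : r⁻¹ ≤ 1 := inv_le_one_of_one_le₀ hr1
  have hc1 : 1 ≤ c₀ := by nlinarith [mul_nonneg (by linarith : 0 ≤ C) (sq_nonneg C)]
  have hroot : (r⁻¹ ^ 2) ^ (1 / ((2 : ℕ) : ℝ)) = r⁻¹ := by
    simpa using sq_rpow_half hρ0.le
  obtain ⟨m₁, hm₁⟩ := hf.exists_isOrganized_two hC hr hc hR
    (A := (R (r⁻¹ ^ 2)).filter (fun ξ => ¬ ξ ≤ 2 * r⁻¹)) (Finset.filter_subset _ _)
    (fun ξ hξ => not_le.1 (Finset.mem_filter.1 hξ).2)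
  have hm₀ := hf.isOrganized_near_zero le_rfl hC hr1 hC hc1
    (hR (r⁻¹ ^ 2) (by positivity) (pow_le_one₀ hρ0.le hρ1))
  rw [hroot] at hm₀
  simp only [Nat.sub_self, pow_zero, Real.sqrt_one] at hm₀
  refine ⟨fun ξ => if ξ ≤ 2 * r⁻¹ then 0 else 1, fun b => if b = 0 then fun _ ξ => ξ else m₁,
    ?_, ?_⟩
  · intro ξ _
    dsimp only
    split_ifs <;> norm_num
  · intro b hb
    interval_cases b
    · have : (R (r⁻¹ ^ 2)).filter (fun ξ => (if ξ ≤ 2 * r⁻¹ then 0 else 1) = 0) =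
          (R (r⁻¹ ^ 2)).filter (fun ξ => ξ ≤ 2 * r⁻¹) := by
        apply Finset.filter_congr
        intro ξ _
        split_ifs with h <;> simp [h]
      rw [this]
      exact hm₀.mono (by omega)
    · have : (R (r⁻¹ ^ 2)).filter (fun ξ => (if ξ ≤ 2 * r⁻¹ then 0 else 1) = 1) =
          (R (r⁻¹ ^ 2)).filter (fun ξ => ¬ ξ ≤ 2 * r⁻¹) := by
        apply Finset.filter_congr
        intro ξ _
        split_ifs with h <;> simp [h]
      rw [this]
      exact hm₁.mono (by omega)

end Organization

theorem natCeil_logb_two_le {r : ℝ} (hr : 2 ≤ r) :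
    (⌈Real.logb 2 r⌉₊ : ℝ) ≤ 2 / Real.log 2 * Real.log r := by
  have h1 : 1 ≤ Real.logb 2 r := by
    rw [Real.le_logb_iff_rpow_le (by norm_num) (by linarith)]; simpa using hr
  have h2 := Nat.ceil_lt_add_one (by linarith : 0 ≤ Real.logb 2 r)
  have h3 : 2 / Real.log 2 * Real.log r = 2 * Real.logb 2 r := by rw [Real.logb]; ring
  rw [h3]
  linarith

end ConeKakeya

/-! ### The estimate. -/

theorem proposition3p2 (k : ℕ) (hk : 2 ≤ k) (Cm : ℕ → ℝ) (hCm : ∀ m, 1 ≤ Cm m) :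
    ∃ cmin : ℝ, 1 < cmin ∧ ∀ c₀ : ℝ, cmin ≤ c₀ → ∀ N : ℕ, ∃ C : ℝ, 0 < C ∧
      ∀ (f : ℝ → ℝ), ConeKakeya.IsFiniteType k Cm f →
      ∀ (r : ℝ), 2 ≤ r →
      ∀ (R : ℝ → Finset ℝ), (∀ δ : ℝ, 0 < δ → δ ≤ 1 → ConeKakeya.IsCenters k N δ (R δ)) →
      ∀ (T : ℝ → ℝ → Set ConeKakeya.E3),
        (∀ s ∈ ConeKakeya.scales r, ∀ ξ ∈ R (s ^ 2),
          (ConeKakeya.planksIn k f c₀ (r⁻¹ ^ 2) (R (r⁻¹ ^ 2))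
            (ConeKakeya.plank k f c₀ (s ^ 2) ξ)).Nonempty →
          ConeKakeya.IsTranslateCover N
            (ConeKakeya.envelope k f c₀ (r⁻¹ ^ 2) (R (r⁻¹ ^ 2))
              (ConeKakeya.plank k f c₀ (s ^ 2) ξ)) (T s ξ)) →
      ∀ (χ : ℝ → ConeKakeya.E3 → ℝ),
        ConeKakeya.IsPartition k f c₀ (r⁻¹ ^ 2) (R (r⁻¹ ^ 2)) χ →
      ∀ (F : SchwartzMap ConeKakeya.E3 ℂ),
        tsupport (FourierTransform.fourier (F : ConeKakeya.E3 → ℂ)) ⊆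
          Metric.cthickening (r⁻¹ ^ 2) (ConeKakeya.cone f) →
        ConeKakeya.kakeyaLHS (R (r⁻¹ ^ 2)) χ F ≤
            ENNReal.ofReal (C * Real.log r) * ConeKakeya.kakeyaRHS k f c₀ r R T χ F ∧
          (k = 2 → ConeKakeya.kakeyaLHS (R (r⁻¹ ^ 2)) χ F ≤
            ENNReal.ofReal C * ConeKakeya.kakeyaRHS k f c₀ r R T χ F) := by
  set B := max (Cm 1) (Cm 2) with hB
  have hB1 : 1 ≤ B := (hCm 1).trans (le_max_left _ _)
  set Γ := B * 2 ^ (k - 2) with hΓ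
  have hΓ1 : 1 ≤ Γ := by
    have : (1 : ℝ) ≤ 2 ^ (k - 2) := one_le_pow₀ (by norm_num)
    nlinarith
  have hcmin : 1 < 27 * Γ * (1 + B ^ 2) := by
    nlinarith [mul_nonneg (by linarith : 0 ≤ Γ) (sq_nonneg B)]
  refine ⟨27 * Γ * (1 + B ^ 2), hcmin, fun c₀ hc N => ?_⟩
  have hc1 : 1 ≤ c₀ := by linarith
  set Γ₁ := √((2 + 2 * (c₀ * (Γ + (1 + B)))) ^ (k - 2)) with hΓ₁
  set D := ConeKakeya.dualConst k B c₀ Γ Γ₁ (ConeKakeya.frameConst B c₀ Γ) with hD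
  have hΓ₁1 : 1 ≤ Γ₁ := by
    refine Real.one_le_sqrt.2 (one_le_pow₀ ?_)
    nlinarith [mul_nonneg (by linarith : 0 ≤ c₀) (by linarith : 0 ≤ Γ + (1 + B))]
  have hD1 : 1 ≤ D := ConeKakeya.one_le_dualConst hB1 hc1 hΓ1 hΓ₁1
    (ConeKakeya.frameConst_bounds hB1 hc1 hΓ1).1
  set p := ⌈18 * Γ ^ 2 * (1 + B ^ 2)⌉₊ with hp
  set M₁ := 2 * (p + 1) + 6 + N with hM₁
  set M₂ := 2 * ((p + 1) * (p + 1)) + 6 + N with hM₂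
  set a := (864 : ℝ) * N * (6 * D) ^ 6 with ha
  have ha0 : 0 ≤ a := by positivity
  have hlog2 : 0 < Real.log 2 := Real.log_pos (by norm_num)
  -- The first term serves the estimate with the logarithm, the second the two blocks for $k=2$; the
  -- summand 1 keeps the constant positive when $N=0$.
  refine ⟨2 / Real.log 2 * (M₁ * a) + 2 * (M₂ * a) + 1, by positivity, ?_⟩
  intro f hf r hr R hR T hT χ hχ F _
  have hreg := hf.isRegular hk hCm
  have hr0 : 0 < r := by linarith
  constructor
  · obtain ⟨blk, m, hblk, hm⟩ := hreg.exists_organization hk hB1 hr hΓ hc hR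
    refine (ConeKakeya.kakeyaLHS_le (by linarith) hr0 hD1 hT hχ F blk hblk m
      (fun b _ => hm b)).trans ?_
    gcongr ENNReal.ofReal ?_ * _
    have hlog : 0 ≤ Real.log r := Real.log_nonneg (by linarith)
    calc (⌈Real.logb 2 r⌉₊ : ℝ) * (M₁ * a)
        ≤ 2 / Real.log 2 * Real.log r * (M₁ * a) := by
          gcongr
          exact ConeKakeya.natCeil_logb_two_le hr
      _ = 2 / Real.log 2 * (M₁ * a) * Real.log r := by ring
      _ ≤ _ := by
          gcongr
          have : 0 ≤ 2 * (M₂ * a) := by positivity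
          linarith
  · rintro rfl
    have hΓB : Γ = B := by simp [hΓ]
    have hΓ₁B : Γ₁ = 1 := by simp [hΓ₁]
    rw [hΓ₁B, hΓB] at hD
    rw [hΓB] at hc hp
    obtain ⟨blk, m, hblk, hm⟩ := hreg.exists_organization_two hB1 hr hc hR
    rw [← hD, ← hp] at hm
    refine (ConeKakeya.kakeyaLHS_le (by linarith) hr0 hD1 hT hχ F blk hblk m hm).trans ?_
    gcongr ENNReal.ofReal ?_ * _
    have : 0 ≤ 2 / Real.log 2 * (M₁ * a) := by positivity
    rw [← hM₂, ← ha, Nat.cast_two]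
    linarith
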